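/- Let $p>3$ be a prime and let $w$ be a generator of the multiplicative group $\mathbb F_p^\ast$. Then there are exactly $15$ isomorphism classes of groups of order $p^4$, and the following groups $G_1,\dots,G_{15}$ form a system of representatives: each has order $p^4$, they are pairwise non-isomorphic, and every group of order $p^4$ is isomorphic to one of them. Each is given by generators $g_1,g_2,g_3,g_4$ and the relations listed below, where $[h,k]=h^{-1}k^{-1}hk$ and where every power $g_i^p$ and every commutator $[g_j,g_i]$ ($j>i$) that is not listed is understood to be equal to $1$; the exponent $w$ in $G_{10}$ is represented by an integer in $\{1,\dots,p-1\}$. - $G_1$: $g_1^p=g_2,\ g_2^p=g_3,\ g_3^p=g_4$; $G_1\cong C_{p^4}$. - $G_2$: $g_1^p=g_3,\ g_2^p=g_4$; $G_2\cong C_{p^2}\times C_{p^2}$. - $G_3$: $[g_2,g_1]=g_3,\ g_1^p=g_4$. - $G_4$: $[g_2,g_1]=g_4,\ g_1^p=g_3,\ g_2^p=g_4$. - $G_5$: $g_1^p=g_3,\ g_3^p=g_4$; $G_5\cong C_{p^3}\times C_p$. - $G_6$: $g_1^p=g_3,\ g_3^p=g_4,\ [g_2,g_1]=g_4$. - $G_7$: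 $[g_2,g_1]=g_3,\ [g_3,g_1]=g_4$. - $G_8$: $[g_2,g_1]=g_3,\ [g_3,g_1]=g_4,\ g_1^p=g_4$. - $G_9$: $[g_2,g_1]=g_3,\ [g_3,g_1]=g_4,\ g_2^p=g_4$. - $G_{10}$: $[g_2,g_1]=g_3,\ [g_3,g_1]=g_4,\ g_2^p=g_4^w$. - $G_{11}$: $g_1^p=g_4$; $G_{11}\cong C_{p^2}\times C_p\times C_p$. - $G_{12}$: $[g_2,g_1]=g_4$. - $G_{13}$: $[g_2,g_1]=g_4,\ g_1^p=g_4$. - $G_{14}$: $[g_2,g_1]=g_4,\ g_3^p=g_4$. - $G_{15}$: only the trivial relations; $G_{15}\cong C_p^4$. Moreover, the automorphism group of each $G_k$ is as follows. For a matrix $M=(m_{ij})\in\mathbb F_p^{4\times4}$ consider the assignment $g_i\mapsto g_1^{m_{i1}}g_2^{m_{i2}}g_3^{m_{i3}}g_4^{m_{i4}}$ $(1\le i\le 4)$, with exponents represented in $\{0,\dots,p-1\}$. For each matrix $M$ of the shape listed for $G_k$ there is exactly one automorphism of $G_k$ with these images, and every automorphism of $G_k$ arises from exactly one such matrix. The rows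 of $M$ are separated by semicolons, all parameters run through $\mathbb F_p$ subject to the stated conditions, and divisions are in $\mathbb F_p$. - $G_1$: $(u_1,u_2,u_3,u_4;\ 0,u_1,u_2,u_3;\ 0,0,u_1,u_2;\ 0,0,0,u_1)$, $u_1\ne0$. - $G_2$: $(u_1,u_2,u_3,u_4;\ v_1,v_2,v_3,v_4;\ 0,0,u_1,u_2;\ 0,0,v_1,v_2)$, $u_1v_2-v_1u_2\neq0$. - $G_3$: $(u_1,u_2,u_3,u_4;\ 0,v_2,v_3,v_4;\ 0,0,u_1v_2,0;\ 0,0,0,u_1)$, $u_1,v_2\ne0$. - $G_4$: $(1,u_2,u_3,u_4;\ 0,v_2,v_3,v_4;\ 0,0,1,u_2;\ 0,0,0,v_2)$, $v_2\ne0$. - $G_5$: $(u_1,u_2,u_3,u_4;\ 0,v_2,0,v_4;\ 0,0,u_1,u_3;\ 0,0,0,u_1)$, $u_1,v_2\neq0$. - $G_6$: $(u_1,u_2,u_3,u_4;\ 0,1,0,v_4;\ 0,0,u_1,u_3;\ 0,0,0,u_1)$, $u_1\ne0$. - $G_7$: $(u_1,u_2,u_3,u_4;\ 0,v_2,v_3,v_4;\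 0,0,u_1v_2,\ u_1v_3+\tfrac{u_1(u_1-1)v_2}{2};\ 0,0,0,u_1^2v_2)$, $u_1v_2\ne0$. - $G_8$: $(u_1,u_2,u_3,u_4;\ 0,u_1^{-1},v_3,v_4;\ 0,0,1,\ u_1v_3+\tfrac{u_1-1}{2};\ 0,0,0,u_1)$, $u_1\ne0$. - $G_9$ and $G_{10}$: $(\varepsilon,0,u_3,u_4;\ 0,v_2,v_3,v_4;\ 0,0,\varepsilon v_2,\ \varepsilon v_3+\tfrac{\varepsilon(\varepsilon-1)v_2}{2};\ 0,0,0,v_2)$, $\varepsilon\in\{1,-1\}$, $v_2\ne0$. - $G_{11}$: $(u_1,u_2,u_3,u_4;\ 0,v_2,v_3,v_4;\ 0,w_2,w_3,w_4;\ 0,0,0,u_1)$, $u_1\ne0$, $v_2w_3-w_2v_3\ne0$. - $G_{12}$: $(u_1,u_2,u_3,u_4;\ v_1,v_2,v_3,v_4;\ 0,0,w_3,w_4;\ 0,0,0,\ u_1v_2-v_1u_2)$, $u_1v_2-v_1u_2\ne0$, $w_3\ne0$. - $G_{13}$: $(u_1,u_2,u_3,u_4;\ 0,1,v_3,v_4;\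 0,0,w_3,w_4;\ 0,0,0,u_1)$, $u_1,w_3\ne0$. - $G_{14}$: $(u_1,u_2,0,u_4;\ v_1,v_2,0,v_4;\ 0,0,d,w_4;\ 0,0,0,d)$ with $d=u_1v_2-v_1u_2\ne0$. - $G_{15}$: all $M$ with $\det M\ne0$; moreover there is a group isomorphism $e:\mathrm{Aut}(G_{15})\to GL(4,p)$ such that each automorphism $\alpha$ is the one given by the transposed matrix $e(\alpha)^{T}$. -/

import Mathlib

namespace OrderP4

/-- Two group structures on the set `Fin n` are equivalent if the resulting groups are isomorphic.
Since every group of order `n` can be transported to `Fin n`, the classes of this relation are the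
isomorphism classes of groups of order `n`. -/
def isoSetoid (n : ℕ) : Setoid (Group (Fin n)) where
  r A B := Nonempty (@MulEquiv (Fin n) (Fin n) A.toMul B.toMul)
  iseqv :=
    { refl := fun A => ⟨@MulEquiv.refl (Fin n) A.toMul⟩
      symm := fun {A B} h => h.elim fun e => ⟨@MulEquiv.symm (Fin n) (Fin n) A.toMul B.toMul e⟩
      trans := fun {A B C} h h' => h.elim fun e => h'.elim fun e' =>
        ⟨@MulEquiv.trans (Fin n) (Fin n) (Fin n) A.toMul B.toMul C.toMul e e'⟩ }

/-- The commutator `[h, k] = h⁻¹ k⁻¹ h k`. -/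
def comm {G : Type*} [Group G] (h k : G) : G := h⁻¹ * k⁻¹ * h * k

/-- Words in four letters. -/
abbrev Word : Type := FreeGroup (Fin 4)

/-- The four letters. -/
def g₁ : Word := FreeGroup.of 0
def g₂ : Word := FreeGroup.of 1
def g₃ : Word := FreeGroup.of 2
def g₄ : Word := FreeGroup.of 3

/-- The relators of the power-commutator presentation on `g₁, g₂, g₃, g₄` with the relations
`gᵢ ^ p = Pᵢ`, `[g₂, g₁] = c₂₁`, `[g₃, g₁] = c₃₁`, and with the four remaining commutators
`[g₄, g₁]`, `[g₃, g₂]`, `[g₄, g₂]`, `[g₄, g₃]` equal to `1`. -/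
def pcRelators (p : ℕ) (P : Fin 4 → Word) (c₂₁ c₃₁ : Word) : Set Word :=
  {g₁ ^ p * (P 0)⁻¹, g₂ ^ p * (P 1)⁻¹, g₃ ^ p * (P 2)⁻¹, g₄ ^ p * (P 3)⁻¹,
    comm g₂ g₁ * c₂₁⁻¹, comm g₃ g₁ * c₃₁⁻¹,
    comm g₄ g₁, comm g₃ g₂, comm g₄ g₂, comm g₄ g₃}

/-- The fifteen presentations; the entry with index `k` (counted from `0`) is the one
of `G_{k+1}`. -/
def relators (p w : ℕ) : Fin 15 → Set Word := ![
  -- 1: g₁^p = g₂, g₂^p = g₃, g₃^p = g₄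
  pcRelators p ![g₂, g₃, g₄, 1] 1 1,
  -- 2: g₁^p = g₃, g₂^p = g₄
  pcRelators p ![g₃, g₄, 1, 1] 1 1,
  -- 3: [g₂,g₁] = g₃, g₁^p = g₄
  pcRelators p ![g₄, 1, 1, 1] g₃ 1,
  -- 4: [g₂,g₁] = g₄, g₁^p = g₃, g₂^p = g₄
  pcRelators p ![g₃, g₄, 1, 1] g₄ 1,
  -- 5: g₁^p = g₃, g₃^p = g₄
  pcRelators p ![g₃, 1, g₄, 1] 1 1,
  -- 6: g₁^p = g₃, g₃^p = g₄, [g₂,g₁] = g₄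
  pcRelators p ![g₃, 1, g₄, 1] g₄ 1,
  -- 7: [g₂,g₁] = g₃, [g₃,g₁] = g₄
  pcRelators p ![1, 1, 1, 1] g₃ g₄,
  -- 8: [g₂,g₁] = g₃, [g₃,g₁] = g₄, g₁^p = g₄
  pcRelators p ![g₄, 1, 1, 1] g₃ g₄,
  -- 9: [g₂,g₁] = g₃, [g₃,g₁] = g₄, g₂^p = g₄
  pcRelators p ![1, g₄, 1, 1] g₃ g₄,
  -- 10: [g₂,g₁] = g₃, [g₃,g₁] = g₄, g₂^p = g₄^w
  pcRelators p ![1, g₄ ^ w, 1, 1] g₃ g₄,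
  -- 11: g₁^p = g₄
  pcRelators p ![g₄, 1, 1, 1] 1 1,
  -- 12: [g₂,g₁] = g₄
  pcRelators p ![1, 1, 1, 1] g₄ 1,
  -- 13: [g₂,g₁] = g₄, g₁^p = g₄
  pcRelators p ![g₄, 1, 1, 1] g₄ 1,
  -- 14: [g₂,g₁] = g₄, g₃^p = g₄
  pcRelators p ![1, 1, g₄, 1] g₄ 1,
  -- 15: only trivial relations
  pcRelators p ![1, 1, 1, 1] 1 1]

/-- The group `G_{k+1}` given by the presentation with index `k`. -/
abbrev Rep (p w : ℕ) (k : Fin 15) : Type := PresentedGroup (relators p w k)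

/-- The image of the letter `gᵢ` in the presented group. -/
def gen (p w : ℕ) (k : Fin 15) (i : Fin 4) : Rep p w k := PresentedGroup.of i

/-- The product `a₁^e₁ a₂^e₂ a₃^e₃ a₄^e₄`, the exponents being represented in `{0, …, p-1}`. -/
def normalForm {p : ℕ} {G : Type*} [Group G] (a : Fin 4 → G) (e : Fin 4 → ZMod p) : G :=
  a 0 ^ (e 0).val * a 1 ^ (e 1).val * a 2 ^ (e 2).val * a 3 ^ (e 3).val

/-- `α` maps each generator `gᵢ` to the normal form whose exponents are row `i` of `M`. -/
def HasExponents {p w : ℕ} {k : Fin 15} (α : MulAut (Rep p w k))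
    (M : Matrix (Fin 4) (Fin 4) (ZMod p)) : Prop :=
  ∀ i, α (gen p w k i) = normalForm (gen p w k) (M i)

/-- For each of the fifteen groups, the exponent matrices of its automorphisms (row `i` holds the
exponents of the image of `gᵢ`). -/
def autMatrices (p : ℕ) [Fact p.Prime] : Fin 15 → Set (Matrix (Fin 4) (Fin 4) (ZMod p)) := ![
  -- 1
  {M | ∃ u₁ u₂ u₃ u₄ : ZMod p, u₁ ≠ 0 ∧
    M = !![u₁, u₂, u₃, u₄; 0, u₁, u₂, u₃; 0, 0, u₁, u₂; 0, 0, 0, u₁]},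
  -- 2
  {M | ∃ u₁ u₂ u₃ u₄ v₁ v₂ v₃ v₄ : ZMod p, u₁ * v₂ - v₁ * u₂ ≠ 0 ∧
    M = !![u₁, u₂, u₃, u₄; v₁, v₂, v₃, v₄; 0, 0, u₁, u₂; 0, 0, v₁, v₂]},
  -- 3
  {M | ∃ u₁ u₂ u₃ u₄ v₂ v₃ v₄ : ZMod p, u₁ ≠ 0 ∧ v₂ ≠ 0 ∧
    M = !![u₁, u₂, u₃, u₄; 0, v₂, v₃, v₄; 0, 0, u₁ * v₂, 0; 0, 0, 0, u₁]},
  -- 4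
  {M | ∃ u₂ u₃ u₄ v₂ v₃ v₄ : ZMod p, v₂ ≠ 0 ∧
    M = !![1, u₂, u₃, u₄; 0, v₂, v₃, v₄; 0, 0, 1, u₂; 0, 0, 0, v₂]},
  -- 5
  {M | ∃ u₁ u₂ u₃ u₄ v₂ v₄ : ZMod p, u₁ ≠ 0 ∧ v₂ ≠ 0 ∧
    M = !![u₁, u₂, u₃, u₄; 0, v₂, 0, v₄; 0, 0, u₁, u₃; 0, 0, 0, u₁]},
  -- 6
  {M | ∃ u₁ u₂ u₃ u₄ v₄ : ZMod p, u₁ ≠ 0 ∧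
    M = !![u₁, u₂, u₃, u₄; 0, 1, 0, v₄; 0, 0, u₁, u₃; 0, 0, 0, u₁]},
  -- 7
  {M | ∃ u₁ u₂ u₃ u₄ v₂ v₃ v₄ : ZMod p, u₁ * v₂ ≠ 0 ∧
    M = !![u₁, u₂, u₃, u₄; 0, v₂, v₃, v₄;
      0, 0, u₁ * v₂, u₁ * v₃ + u₁ * (u₁ - 1) * v₂ / 2; 0, 0, 0, u₁ ^ 2 * v₂]},
  -- 8
  {M | ∃ u₁ u₂ u₃ u₄ v₃ v₄ : ZMod p, u₁ ≠ 0 ∧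
    M = !![u₁, u₂, u₃, u₄; 0, u₁⁻¹, v₃, v₄;
      0, 0, 1, u₁ * v₃ + (u₁ - 1) / 2; 0, 0, 0, u₁]},
  -- 9
  {M | ∃ ε u₃ u₄ v₂ v₃ v₄ : ZMod p, (ε = 1 ∨ ε = -1) ∧ v₂ ≠ 0 ∧
    M = !![ε, 0, u₃, u₄; 0, v₂, v₃, v₄;
      0, 0, ε * v₂, ε * v₃ + ε * (ε - 1) * v₂ / 2; 0, 0, 0, v₂]},
  -- 10
  {M | ∃ ε u₃ u₄ v₂ v₃ v₄ : ZMod p, (ε = 1 ∨ ε = -1) ∧ v₂ ≠ 0 ∧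
    M = !![ε, 0, u₃, u₄; 0, v₂, v₃, v₄;
      0, 0, ε * v₂, ε * v₃ + ε * (ε - 1) * v₂ / 2; 0, 0, 0, v₂]},
  -- 11
  {M | ∃ u₁ u₂ u₃ u₄ v₂ v₃ v₄ w₂ w₃ w₄ : ZMod p, u₁ ≠ 0 ∧ v₂ * w₃ - w₂ * v₃ ≠ 0 ∧
    M = !![u₁, u₂, u₃, u₄; 0, v₂, v₃, v₄; 0, w₂, w₃, w₄; 0, 0, 0, u₁]},
  -- 12
  {M | ∃ u₁ u₂ u₃ u₄ v₁ v₂ v₃ v₄ w₃ w₄ : ZMod p, u₁ * v₂ - v₁ * u₂ ≠ 0 ∧ w₃ ≠ 0 ∧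
    M = !![u₁, u₂, u₃, u₄; v₁, v₂, v₃, v₄; 0, 0, w₃, w₄; 0, 0, 0, u₁ * v₂ - v₁ * u₂]},
  -- 13
  {M | ∃ u₁ u₂ u₃ u₄ v₃ v₄ w₃ w₄ : ZMod p, u₁ ≠ 0 ∧ w₃ ≠ 0 ∧
    M = !![u₁, u₂, u₃, u₄; 0, 1, v₃, v₄; 0, 0, w₃, w₄; 0, 0, 0, u₁]},
  -- 14
  {M | ∃ u₁ u₂ u₄ v₁ v₂ v₄ w₄ : ZMod p, u₁ * v₂ - v₁ * u₂ ≠ 0 ∧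
    M = !![u₁, u₂, 0, u₄; v₁, v₂, 0, v₄;
      0, 0, u₁ * v₂ - v₁ * u₂, w₄; 0, 0, 0, u₁ * v₂ - v₁ * u₂]},
  -- 15
  {M | M.det ≠ 0}]

end OrderP4

/-!
The fifteen presentations are treated uniformly as members of a family of power-commutator
presentations with numerical exponents (`PCData`). For exponents that satisfy a few vanishing
conditions, a polynomial multiplication turns `ℤ⁴` into a group (`Cover`). Its quotient by the
lattice of power relations is the presented group, so every element has exactly one normal form
with exponents in `{0, …, p - 1}` (`normalForm_bijective`), and in particular the order is `p ^ 4`.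

As `p > 3`, powers and commutators of normal forms are given by polynomials over `ZMod p`: the
binomial coefficients of the collection formulas vanish in the exponent `p`. Hence elements with
the exponent matrix `M` satisfy given relations exactly if `M` satisfies a system of polynomial
equations `MatRel` (`PCData.Rel.rel_normalForm_iff`). A proper subgroup of a `p`-group lies in the
kernel of a nonzero character with values in `ZMod p` (`exists_character`), so the elements
generate the group when `det M ≠ 0`. The automorphisms are therefore the solutions of `MatRel`
with the nonvanishing conditions that an automorphism imposes on the rows of `M` and on the
characters, and solving the equations gives the listed matrices (`existsUnique_aut`,
`existsUnique_matrix`).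

The groups are pairwise non-isomorphic (`eq_of_vecIso`) by invariants of the power map and of
commutators in coordinates; the last two of maximal class differ because `w` is not a square.

Conversely (`exists_rep`), a commutative group of order `p ^ 4` is sorted by its exponent. If the
group is not commutative, its centre `Z` has order `p ^ 2` or `p`. In the first case the class is
`2` and the `p`-th power map is a homomorphism into `Z`; the structure of `Z` and the position of
the `p`-th powers relative to commutators decide. In the second case there is a commutative normal
subgroup `A` of order `p ^ 3`; for `x ∉ A` and suitable `y ∈ A` the elements `x`, `y`, `[y, x]`,
`[[y, x], x]` generate, both `x ^ p` and `y ^ p` are powers of the last one, and a change of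
generators normalizes the two exponents, the second one up to squares.
-/

namespace OrderP4

/-! ### Power-commutator data and the covering group on `ℤ⁴` -/

/-- The exponents of a presentation with the relations
`g₁ ^ p = g₂ ^ a₂ g₃ ^ a₃ g₄ ^ a₄`, `g₂ ^ p = g₃ ^ b₃ g₄ ^ b₄`, `g₃ ^ p = g₄ ^ c₄`, `g₄ ^ p = 1`,
`[g₂, g₁] = g₃ ^ d₃ g₄ ^ d₄`, `[g₃, g₁] = g₄ ^ e₄`, in which all other pairs of generators
commute. -/
structure PCData where
  a₂ : ℕ
  a₃ : ℕ
  a₄ : ℕ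
  b₃ : ℕ
  b₄ : ℕ
  c₄ : ℕ
  d₃ : ℕ
  d₄ : ℕ
  e₄ : ℕ

/-- Vanishing conditions that make the presentation consistent, so that it defines a group of
order `p ^ 4`. The first five say that conjugation by `g₁` respects the power relations; the
remaining ones exclude carries from the coordinates `2` and `3` in the formula for `p`-th powers. -/
structure PCData.Consistent (D : PCData) : Prop where
  da : D.d₃ * D.a₂ = 0
  da' : D.d₄ * D.a₂ = 0
  cd : D.c₄ * D.d₃ = 0
  eb : D.e₄ * D.b₃ = 0
  ea : D.e₄ * D.a₃ = 0
  a₂_le : D.a₂ ≤ 1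
  a₃_le : D.a₃ ≤ 1
  b₃_le : D.b₃ ≤ 1
  ab : D.a₃ * D.b₃ = 0

/-- The elements `g 0, g 1, g 2, g 3` satisfy the relations with exponents `D`. -/
structure PCData.Rel (D : PCData) (p : ℕ) {G : Type*} [Group G] (g : Fin 4 → G) : Prop where
  pow0 : g 0 ^ p = g 1 ^ D.a₂ * g 2 ^ D.a₃ * g 3 ^ D.a₄
  pow1 : g 1 ^ p = g 2 ^ D.b₃ * g 3 ^ D.b₄
  pow2 : g 2 ^ p = g 3 ^ D.c₄
  pow3 : g 3 ^ p = 1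
  comm10 : comm (g 1) (g 0) = g 2 ^ D.d₃ * g 3 ^ D.d₄
  comm20 : comm (g 2) (g 0) = g 3 ^ D.e₄
  comm30 : comm (g 3) (g 0) = 1
  comm21 : comm (g 2) (g 1) = 1
  comm31 : comm (g 3) (g 1) = 1
  comm32 : comm (g 3) (g 2) = 1

/-- The integer binomial coefficient `n (n - 1) / 2`. -/
def tri (n : ℤ) : ℤ := n * (n - 1) / 2

theorem two_mul_tri (n : ℤ) : 2 * tri n = n * (n - 1) := by
  apply Int.mul_ediv_cancel'
  have := Int.even_mul_pred_self n
  exact this.two_dvd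

theorem tri_add (m n : ℤ) : tri (m + n) = tri m + tri n + m * n := by
  have h1 := two_mul_tri m
  have h2 := two_mul_tri n
  have h3 := two_mul_tri (m + n)
  nlinarith

@[simp] theorem tri_zero : tri 0 = 0 := rfl

@[simp] theorem tri_one : tri 1 = 0 := rfl

/-- The group on `ℤ⁴` in which `(x₁, x₂, x₃, x₄)` stands for `g₁ ^ x₁ g₂ ^ x₂ g₃ ^ x₃ g₄ ^ x₄`:
the group with the commutator relations of `D` but without its power relations. -/
@[ext] structure Cover (D : PCData) where
  x₁ : ℤ
  x₂ : ℤ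
  x₃ : ℤ
  x₄ : ℤ

namespace Cover

variable {D : PCData}

instance : One (Cover D) := ⟨⟨0, 0, 0, 0⟩⟩

instance : Mul (Cover D) := ⟨fun x y => ⟨x.x₁ + y.x₁, x.x₂ + y.x₂,
  x.x₃ + y.x₃ + D.d₃ * x.x₂ * y.x₁,
  x.x₄ + y.x₄ + D.d₄ * x.x₂ * y.x₁ + D.d₃ * D.e₄ * x.x₂ * tri y.x₁ + D.e₄ * x.x₃ * y.x₁⟩⟩

instance : Inv (Cover D) := ⟨fun x => ⟨-x.x₁, -x.x₂, -x.x₃ + D.d₃ * x.x₂ * x.x₁,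
  -x.x₄ + D.d₄ * x.x₂ * x.x₁ + D.e₄ * x.x₃ * x.x₁ - D.d₃ * D.e₄ * x.x₂ * (tri x.x₁ + x.x₁)⟩⟩

@[simp] theorem one_x₁ : (1 : Cover D).x₁ = 0 := rfl
@[simp] theorem one_x₂ : (1 : Cover D).x₂ = 0 := rfl
@[simp] theorem one_x₃ : (1 : Cover D).x₃ = 0 := rfl
@[simp] theorem one_x₄ : (1 : Cover D).x₄ = 0 := rfl

@[simp] theorem mul_x₁ (x y : Cover D) : (x * y).x₁ = x.x₁ + y.x₁ := rfl
@[simp] theorem mul_x₂ (x y : Cover D) : (x * y).x₂ = x.x₂ + y.x₂ := rfl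
@[simp] theorem mul_x₃ (x y : Cover D) :
    (x * y).x₃ = x.x₃ + y.x₃ + D.d₃ * x.x₂ * y.x₁ := rfl
@[simp] theorem mul_x₄ (x y : Cover D) : (x * y).x₄ = x.x₄ + y.x₄ + D.d₄ * x.x₂ * y.x₁ +
    D.d₃ * D.e₄ * x.x₂ * tri y.x₁ + D.e₄ * x.x₃ * y.x₁ := rfl

@[simp] theorem inv_x₁ (x : Cover D) : (x⁻¹).x₁ = -x.x₁ := rfl
@[simp] theorem inv_x₂ (x : Cover D) : (x⁻¹).x₂ = -x.x₂ := rfl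
@[simp] theorem inv_x₃ (x : Cover D) : (x⁻¹).x₃ = -x.x₃ + D.d₃ * x.x₂ * x.x₁ := rfl
@[simp] theorem inv_x₄ (x : Cover D) : (x⁻¹).x₄ = -x.x₄ + D.d₄ * x.x₂ * x.x₁ +
    D.e₄ * x.x₃ * x.x₁ - D.d₃ * D.e₄ * x.x₂ * (tri x.x₁ + x.x₁) := rfl

instance : Group (Cover D) := Group.ofLeftAxioms
  (by intro x y z; ext <;> simp [tri_add] <;> ring)
  (by intro x; ext <;> simp)
  (by
    intro x
    ext <;> simp
    have := two_mul_tri x.x₁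
    linear_combination (-(D.d₃ * D.e₄ * x.x₂ : ℤ)) * this)

/-- The commutator `[y, x]` in the covering group. -/
theorem comm_eq (x y : Cover D) : comm y x = ⟨0, 0, D.d₃ * (x.x₁ * y.x₂ - y.x₁ * x.x₂),
    D.d₄ * (x.x₁ * y.x₂ - y.x₁ * x.x₂) +
      D.d₃ * D.e₄ * (tri x.x₁ * y.x₂ - tri y.x₁ * x.x₂) +
      D.e₄ * (x.x₁ * y.x₃ - y.x₁ * x.x₃)⟩ := by
  have h : y * x = (x * y) * ⟨0, 0, D.d₃ * (x.x₁ * y.x₂ - y.x₁ * x.x₂),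
    D.d₄ * (x.x₁ * y.x₂ - y.x₁ * x.x₂) +
      D.d₃ * D.e₄ * (tri x.x₁ * y.x₂ - tri y.x₁ * x.x₂) +
      D.e₄ * (x.x₁ * y.x₃ - y.x₁ * x.x₃)⟩ := by
    ext <;> simp <;> ring
  have h2 : comm y x = (x * y)⁻¹ * (y * x) := by
    simp [comm, mul_assoc]
  rw [h2, h, inv_mul_cancel_left]

theorem pow_eq (x : Cover D) (n : ℕ) : x ^ n = ⟨n * x.x₁, n * x.x₂,
    n * x.x₃ + D.d₃ * x.x₁ * x.x₂ * n.choose 2,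
    n * x.x₄ + (D.d₄ * x.x₁ * x.x₂ + D.e₄ * x.x₁ * x.x₃) * n.choose 2 +
      D.d₃ * D.e₄ * x.x₂ * (tri x.x₁ * n.choose 2 + x.x₁ ^ 2 * n.choose 3)⟩ := by
  induction n with
  | zero => ext <;> simp
  | succ n ih =>
    have h2 : ((n + 1).choose 2 : ℤ) = n + n.choose 2 := by
      rw [Nat.choose_succ_succ' n 1]; simp
    have h3 : ((n + 1).choose 3 : ℤ) = n.choose 2 + n.choose 3 := by
      rw [Nat.choose_succ_succ' n 2]; simp
    rw [pow_succ, ih]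
    ext <;> simp only [mul_x₁, mul_x₂, mul_x₃, mul_x₄, h2, h3] <;> push_cast <;> ring

/-- Congruence modulo the power relations of `D`: the difference lies in the lattice spanned by
`(p, -a₂, -a₃, -a₄)`, `(0, p, -b₃, -b₄)`, `(0, 0, p, -c₄)` and `(0, 0, 0, p)`. -/
def Congr (p : ℕ) (x y : Cover D) : Prop := ∃ q r s t : ℤ,
  x.x₁ = y.x₁ + p * q ∧ x.x₂ = y.x₂ + (p * r - D.a₂ * q) ∧
  x.x₃ = y.x₃ + (p * s - D.b₃ * r - D.a₃ * q) ∧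
  x.x₄ = y.x₄ + (p * t - D.b₄ * r - D.c₄ * s - D.a₄ * q)

theorem exists_tri_mul_eq {p : ℕ} (hp : p.Coprime 2) (q : ℤ) : ∃ k : ℤ, tri (p * q) = p * k := by
  have h1 : (p : ℤ) ∣ tri (p * q) * 2 := ⟨q * (p * q - 1), by rw [mul_comm, two_mul_tri]; ring⟩
  have h2 : IsCoprime (p : ℤ) 2 := by exact_mod_cast Nat.isCoprime_iff_coprime.2 hp
  exact h2.dvd_of_dvd_mul_right h1

/-- The cosets of the subgroup of elements congruent to `1` are the congruence classes. -/
theorem congr_mul_left_iff (hD : D.Consistent) {p : ℕ} (hp : p.Coprime 2) (x y : Cover D) :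
    Congr p (x * y) x ↔ Congr p y 1 := by
  have h1 : (D.c₄ * D.d₃ : ℤ) = 0 := by exact_mod_cast hD.cd
  constructor
  · rintro ⟨q, r, s, t, e1, e2, e3, e4⟩
    simp only [mul_x₁, mul_x₂, mul_x₃, mul_x₄] at e1 e2 e3 e4
    have hy : y.x₁ = p * q := by linarith
    obtain ⟨k, hk⟩ := exists_tri_mul_eq hp q
    rw [hy] at e3 e4
    rw [hk] at e4
    refine ⟨q, r, s - D.d₃ * x.x₂ * q,
      t - D.d₄ * x.x₂ * q - D.e₄ * x.x₃ * q - D.d₃ * D.e₄ * x.x₂ * k, ?_, ?_, ?_, ?_⟩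
    · simp [hy]
    · simp; linarith
    · simp; linarith
    · simp; linear_combination e4 - x.x₂ * q * h1
  · rintro ⟨q, r, s, t, e1, e2, e3, e4⟩
    simp only [one_x₁, one_x₂, one_x₃, one_x₄, zero_add] at e1 e2 e3 e4
    obtain ⟨k, hk⟩ := exists_tri_mul_eq hp q
    refine ⟨q, r, s + D.d₃ * x.x₂ * q,
      t + D.d₄ * x.x₂ * q + D.e₄ * x.x₃ * q + D.d₃ * D.e₄ * x.x₂ * k, ?_, ?_, ?_, ?_⟩
    · simp [e1]
    · simp [e2]
    · simp [e3, e1]; ring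
    · simp [e4, e1, hk]; linear_combination x.x₂ * q * h1

/-- The elements congruent to `1` modulo the power relations. -/
def relSubgroup (hD : D.Consistent) {p : ℕ} (hp : p.Coprime 2) : Subgroup (Cover D) where
  carrier := {x | Congr p x 1}
  one_mem' := ⟨0, 0, 0, 0, by simp⟩
  mul_mem' := by
    rintro x y ⟨q, r, s, t, e1, e2, e3, e4⟩ hy
    obtain ⟨q', r', s', t', f1, f2, f3, f4⟩ := (congr_mul_left_iff hD hp x y).2 hy
    exact ⟨q + q', r + r', s + s', t + t', by rw [f1, e1]; simp; ring, by rw [f2, e2]; simp; ring,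
      by rw [f3, e3]; simp; ring, by rw [f4, e4]; simp; ring⟩
  inv_mem' := by
    rintro x ⟨q, r, s, t, e1, e2, e3, e4⟩
    refine (congr_mul_left_iff hD hp x x⁻¹).1 ⟨-q, -r, -s, -t, ?_⟩
    rw [mul_inv_cancel, e1, e2, e3, e4]
    simp

theorem mem_relSubgroup (hD : D.Consistent) {p : ℕ} (hp : p.Coprime 2) {x : Cover D} :
    x ∈ relSubgroup hD hp ↔ Congr p x 1 := Iff.rfl

theorem inv_mul_mem_relSubgroup (hD : D.Consistent) {p : ℕ} (hp : p.Coprime 2) {x y : Cover D} :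
    y⁻¹ * x ∈ relSubgroup hD hp ↔ Congr p x y := by
  rw [mem_relSubgroup, ← congr_mul_left_iff hD hp y, mul_inv_cancel_left]

theorem relSubgroup_normal (hD : D.Consistent) {p : ℕ} (hp : p.Coprime 2) :
    (relSubgroup hD hp).Normal := by
  constructor
  intro n hn g
  have h1 : (D.c₄ * D.d₃ : ℤ) = 0 := by exact_mod_cast hD.cd
  have h2 : (D.d₃ * D.a₂ : ℤ) = 0 := by exact_mod_cast hD.da
  have h3 : (D.d₄ * D.a₂ : ℤ) = 0 := by exact_mod_cast hD.da'
  have h4 : (D.e₄ * D.b₃ : ℤ) = 0 := by exact_mod_cast hD.eb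
  have h5 : (D.e₄ * D.a₃ : ℤ) = 0 := by exact_mod_cast hD.ea
  have h : g * n * g⁻¹ = n * comm n g⁻¹ := by simp [comm, mul_assoc]
  rw [h]
  refine mul_mem hn ?_
  obtain ⟨q, r, s, t, e1, e2, e3, e4⟩ := hn
  simp only [one_x₁, one_x₂, one_x₃, one_x₄, zero_add] at e1 e2 e3 e4
  obtain ⟨k, hk⟩ := exists_tri_mul_eq hp q
  generalize g⁻¹ = x
  rw [comm_eq]
  refine ⟨0, 0, D.d₃ * (x.x₁ * r - q * x.x₂), D.d₄ * (x.x₁ * r - q * x.x₂) +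
    D.d₃ * D.e₄ * (tri x.x₁ * r - k * x.x₂) + D.e₄ * (x.x₁ * s - q * x.x₃), ?_, ?_, ?_, ?_⟩
  · simp
  · simp
  · simp [e1, e2]
    linear_combination (-x.x₁ * q) * h2
  · simp [e1, e2, e3, hk]
    linear_combination (-x.x₁ * q) * h3 - tri x.x₁ * q * D.e₄ * h2 - x.x₁ * r * h4
      - x.x₁ * q * h5 + (x.x₁ * r - q * x.x₂) * h1

end Cover

/-! ### The covering group maps to every group with the given relations -/

theorem comm_eq_one_iff {G : Type*} [Group G] {h k : G} : comm h k = 1 ↔ Commute h k := by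
  rw [comm, mul_assoc, ← mul_inv_rev, inv_mul_eq_one, eq_comm]
  exact Iff.rfl

theorem comm_eq_iff {G : Type*} [Group G] {h k c : G} : comm h k = c ↔ h * k = k * h * c := by
  rw [comm, mul_assoc, ← mul_inv_rev, inv_mul_eq_iff_eq_mul]

/-- The product `g 0 ^ x₁ * g 1 ^ x₂ * g 2 ^ x₃ * g 3 ^ x₄`. -/
def Cover.eval {D : PCData} {G : Type*} [Group G] (g : Fin 4 → G) (x : Cover D) : G :=
  g 0 ^ x.x₁ * (g 1 ^ x.x₂ * g 2 ^ x.x₃ * g 3 ^ x.x₄)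

namespace PCData.Rel

variable {D : PCData} {p : ℕ} {G : Type*} [Group G] {g : Fin 4 → G}

theorem mul_three (h : D.Rel p g) (i j k i' j' k' : ℤ) :
    (g 1 ^ i * g 2 ^ j * g 3 ^ k) * (g 1 ^ i' * g 2 ^ j' * g 3 ^ k') =
      g 1 ^ (i + i') * g 2 ^ (j + j') * g 3 ^ (k + k') := by
  have h1 := (comm_eq_one_iff.1 h.comm21).zpow_zpow j i'
  have h2 := (comm_eq_one_iff.1 h.comm31).zpow_zpow k i'
  have h3 := (comm_eq_one_iff.1 h.comm32).zpow_zpow k j'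
  simp only [zpow_add, mul_assoc]
  rw [← mul_assoc (g 3 ^ k), h2.eq, mul_assoc, ← mul_assoc (g 2 ^ j), h1.eq, mul_assoc,
    ← mul_assoc (g 3 ^ k), h3.eq, mul_assoc]

theorem three_mul (h : D.Rel p g) (i j k : ℤ) :
    (g 1 ^ i * g 2 ^ j * g 3 ^ k) * g 0 = g 0 * (g 1 ^ i * g 2 ^ (j + D.d₃ * i) *
      g 3 ^ (k + D.d₄ * i + D.e₄ * j)) := by
  have h1 : SemiconjBy (g 0)⁻¹ (g 1) (g 1 * (g 2 ^ D.d₃ * g 3 ^ D.d₄)) := by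
    rw [← h.comm10, SemiconjBy, comm]; group
  have h2 : SemiconjBy (g 0)⁻¹ (g 2) (g 2 * g 3 ^ D.e₄) := by
    rw [← h.comm20, SemiconjBy, comm]; group
  have h3 : SemiconjBy (g 0)⁻¹ (g 3) (g 3) :=
    (comm_eq_one_iff.1 h.comm30).symm.inv_left
  have c1 := comm_eq_one_iff.1 h.comm21
  have c2 := comm_eq_one_iff.1 h.comm31
  have c3 := comm_eq_one_iff.1 h.comm32
  have key := ((h1.zpow_right i).mul_right (h2.zpow_right j)).mul_right (h3.zpow_right k)
  have e1 : (g 1 * (g 2 ^ D.d₃ * g 3 ^ D.d₄)) ^ i =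
      g 1 ^ i * g 2 ^ (D.d₃ * i) * g 3 ^ (D.d₄ * i) := by
    rw [Commute.mul_zpow ((c1.symm.pow_right _).mul_right (c2.symm.pow_right _)),
      Commute.mul_zpow (c3.symm.pow_pow _ _), ← zpow_natCast, ← zpow_natCast, ← zpow_mul,
      ← zpow_mul, mul_assoc]
  have e2 : (g 2 * g 3 ^ D.e₄) ^ j = g 1 ^ (0 : ℤ) * g 2 ^ j * g 3 ^ (D.e₄ * j) := by
    rw [Commute.mul_zpow (c3.symm.pow_right _), ← zpow_natCast, ← zpow_mul]
    simp
  have e4 := key.eq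
  rw [e1, e2, h.mul_three, mul_assoc _ (g 3 ^ _) (g 3 ^ k), ← zpow_add, add_zero] at e4
  rw [inv_mul_eq_iff_eq_mul, ← mul_assoc, eq_mul_inv_iff_mul_eq] at e4
  rw [e4]
  congr! 3 <;> ring_nf

theorem three_mul_inv (h : D.Rel p g) (i j k : ℤ) :
    (g 1 ^ i * g 2 ^ j * g 3 ^ k) * (g 0)⁻¹ = (g 0)⁻¹ * (g 1 ^ i * g 2 ^ (j - D.d₃ * i) *
      g 3 ^ (k - D.d₄ * i - D.e₄ * j + D.d₃ * D.e₄ * i)) := by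
  rw [mul_inv_eq_iff_eq_mul, mul_assoc (g 0)⁻¹, h.three_mul, inv_mul_cancel_left]
  congr! 2 <;> ring_nf

theorem three_mul_zpow (h : D.Rel p g) (n i j k : ℤ) :
    (g 1 ^ i * g 2 ^ j * g 3 ^ k) * g 0 ^ n = g 0 ^ n * (g 1 ^ i * g 2 ^ (j + D.d₃ * i * n) *
      g 3 ^ (k + D.d₄ * i * n + D.d₃ * D.e₄ * i * tri n + D.e₄ * j * n)) := by
  induction n using Int.induction_on with
  | zero => simp
  | succ n ih =>
    rw [zpow_add_one, ← mul_assoc, ih, mul_assoc, h.three_mul, ← mul_assoc, tri_add, tri_one]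
    congr! 3 <;> ring_nf
  | pred n ih =>
    rw [zpow_sub_one, ← mul_assoc, ih, mul_assoc, h.three_mul_inv, ← mul_assoc,
      sub_eq_add_neg (-(n : ℤ)) 1, tri_add, show tri (-1) = 1 from rfl]
    congr! 3 <;> ring_nf

theorem eval_mul (h : D.Rel p g) (x y : Cover D) :
    Cover.eval g (x * y) = Cover.eval g x * Cover.eval g y := by
  simp only [Cover.eval]
  rw [mul_assoc (g 0 ^ x.x₁), ← mul_assoc _ (g 0 ^ y.x₁), h.three_mul_zpow, mul_assoc (g 0 ^ y.x₁),
    h.mul_three, ← mul_assoc (g 0 ^ x.x₁), ← zpow_add]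
  simp only [Cover.mul_x₁, Cover.mul_x₂, Cover.mul_x₃, Cover.mul_x₄]
  congr! 3 <;> ring_nf

/-- The homomorphism from the covering group given by elements that satisfy the relations. -/
def evalHom (h : D.Rel p g) : Cover D →* G := MonoidHom.mk' (Cover.eval g) h.eval_mul

/-- Congruent elements of the covering group have the same value. -/
theorem eval_eq_of_congr (h : D.Rel p g) (hD : D.Consistent) (hp : p.Coprime 2) {x y : Cover D}
    (hxy : x.Congr p y) : Cover.eval g x = Cover.eval g y := by
  rw [← Cover.inv_mul_mem_relSubgroup hD hp] at hxy
  obtain ⟨q, r, s, t, e1, e2, e3, e4⟩ := hxy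
  suffices h2 : Cover.eval g (y⁻¹ * x) = 1 by
    have := h.eval_mul y (y⁻¹ * x)
    rwa [mul_inv_cancel_left, h2, mul_one] at this
  simp only [Cover.one_x₁, Cover.one_x₂, Cover.one_x₃, Cover.one_x₄, zero_add] at e1 e2 e3 e4
  simp only [Cover.eval, e1, e2, e3, e4]
  have f0 : g 0 ^ ((p : ℤ) * q) =
      g 1 ^ (D.a₂ * q : ℤ) * g 2 ^ (D.a₃ * q : ℤ) * g 3 ^ (D.a₄ * q : ℤ) := by
    have c1 := comm_eq_one_iff.1 h.comm21
    have c2 := comm_eq_one_iff.1 h.comm31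
    have c3 := comm_eq_one_iff.1 h.comm32
    rw [zpow_mul, zpow_natCast, h.pow0, Commute.mul_zpow
      ((c2.symm.pow_pow _ _).mul_left (c3.symm.pow_pow _ _)), Commute.mul_zpow
      (c1.symm.pow_pow _ _)]
    simp only [← zpow_natCast, ← zpow_mul]
  have f1 : g 1 ^ ((p : ℤ) * r) = g 1 ^ (0 : ℤ) * g 2 ^ (D.b₃ * r : ℤ) * g 3 ^ (D.b₄ * r : ℤ) := by
    have c3 := comm_eq_one_iff.1 h.comm32
    rw [zpow_mul, zpow_natCast, h.pow1, Commute.mul_zpow (c3.symm.pow_pow _ _)]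
    simp only [← zpow_natCast, ← zpow_mul]
    simp
  have f2 : g 2 ^ ((p : ℤ) * s) = g 1 ^ (0 : ℤ) * g 2 ^ (0 : ℤ) * g 3 ^ (D.c₄ * s : ℤ) := by
    rw [zpow_mul, zpow_natCast, h.pow2]
    simp only [← zpow_natCast, ← zpow_mul]
    simp
  have f3 : g 3 ^ ((p : ℤ) * t) = 1 := by
    rw [zpow_mul, zpow_natCast, h.pow3, one_zpow]
  have f : g 1 ^ (p * r - D.a₂ * q) * g 2 ^ (p * s - D.b₃ * r - D.a₃ * q) *
      g 3 ^ (p * t - D.b₄ * r - D.c₄ * s - D.a₄ * q) =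
      (g 1 ^ ((p : ℤ) * r) * g 2 ^ ((p : ℤ) * s) * g 3 ^ ((p : ℤ) * t)) * (g 1 ^ (-(D.a₂ * q) : ℤ) *
        g 2 ^ (- (D.b₃ * r) - D.a₃ * q) * g 3 ^ (- (D.b₄ * r) - D.c₄ * s - D.a₄ * q)) := by
    rw [h.mul_three]
    congr! 2 <;> ring_nf
  rw [f, f1, f2, f3, f0, mul_one]
  simp only [h.mul_three]
  ring_nf
  simp

end PCData.Rel

/-! ### Normal forms in the presented groups -/

namespace Cover

variable {D : PCData}

/-- The standard generators of the covering group. -/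
def basis (D : PCData) : Fin 4 → Cover D :=
  ![⟨1, 0, 0, 0⟩, ⟨0, 1, 0, 0⟩, ⟨0, 0, 1, 0⟩, ⟨0, 0, 0, 1⟩]

theorem basis_zero_pow (n : ℕ) : basis D 0 ^ n = ⟨n, 0, 0, 0⟩ := by simp [basis, pow_eq]
theorem basis_one_pow (n : ℕ) : basis D 1 ^ n = ⟨0, n, 0, 0⟩ := by simp [basis, pow_eq]
theorem basis_two_pow (n : ℕ) : basis D 2 ^ n = ⟨0, 0, n, 0⟩ := by simp [basis, pow_eq]
theorem basis_three_pow (n : ℕ) : basis D 3 ^ n = ⟨0, 0, 0, n⟩ := by simp [basis, pow_eq]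

/-- The element of the covering group with the given residues as coordinates. -/
def ofVal {p : ℕ} (e : Fin 4 → ZMod p) : Cover D := ⟨(e 0).val, (e 1).val, (e 2).val, (e 3).val⟩

theorem normalForm_basis {p : ℕ} (e : Fin 4 → ZMod p) : normalForm (basis D) e = ofVal e := by
  rw [normalForm, basis_zero_pow, basis_one_pow, basis_two_pow, basis_three_pow]
  ext <;> simp [ofVal]

theorem eq_of_val_eq {p : ℕ} [NeZero p] {a b : ZMod p} {q : ℤ}
    (h : (a.val : ℤ) = b.val + p * q) : a = b ∧ q = 0 := by
  have h1 : a = b := by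
    have := congrArg (Int.cast : ℤ → ZMod p) h
    simpa using this
  subst h1
  have h2 : (p : ℤ) * q = 0 := by linarith
  simpa [NeZero.ne p] using h2

/-- Distinct normal forms are not congruent. -/
theorem ofVal_congr_iff {p : ℕ} [NeZero p] {e f : Fin 4 → ZMod p} :
    Congr p (ofVal e : Cover D) (ofVal f) ↔ e = f := by
  constructor
  · rintro ⟨q, r, s, t, e1, e2, e3, e4⟩
    obtain ⟨h1, rfl⟩ := eq_of_val_eq e1
    obtain ⟨h2, rfl⟩ := eq_of_val_eq (a := e 1) (b := f 1)
      (show (ofVal e : Cover D).x₂ = (ofVal f : Cover D).x₂ + p * r by simpa using e2)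
    obtain ⟨h3, rfl⟩ := eq_of_val_eq (a := e 2) (b := f 2)
      (show (ofVal e : Cover D).x₃ = (ofVal f : Cover D).x₃ + p * s by simpa using e3)
    obtain ⟨h4, rfl⟩ := eq_of_val_eq (a := e 3) (b := f 3)
      (show (ofVal e : Cover D).x₄ = (ofVal f : Cover D).x₄ + p * t by simpa using e4)
    ext i
    fin_cases i <;> simp [h1, h2, h3, h4]
  · rintro rfl
    exact ⟨0, 0, 0, 0, by simp⟩

theorem exists_val_eq {p : ℕ} [NeZero p] (x : ℤ) : ∃ (a : ZMod p) (q : ℤ), x = a.val + p * q := by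
  refine ⟨x, x / p, ?_⟩
  rw [ZMod.val_intCast, Int.emod_add_mul_ediv]

/-- Every element of the covering group is congruent to a normal form. -/
theorem exists_congr_ofVal {p : ℕ} [NeZero p] (x : Cover D) :
    ∃ e : Fin 4 → ZMod p, Congr p x (ofVal e) := by
  obtain ⟨e1, q, h1⟩ := exists_val_eq (p := p) x.x₁
  obtain ⟨e2, r, h2⟩ := exists_val_eq (p := p) (x.x₂ + D.a₂ * q)
  obtain ⟨e3, s, h3⟩ := exists_val_eq (p := p) (x.x₃ + D.b₃ * r + D.a₃ * q)
  obtain ⟨e4, t, h4⟩ := exists_val_eq (p := p) (x.x₄ + D.b₄ * r + D.c₄ * s + D.a₄ * q)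
  refine ⟨![e1, e2, e3, e4], q, r, s, t, ?_⟩
  simp only [ofVal, Matrix.cons_val]
  refine ⟨?_, ?_, ?_, ?_⟩ <;> linarith

instance (hD : D.Consistent) {p : ℕ} (hp : p.Coprime 2) : (relSubgroup hD hp).Normal :=
  relSubgroup_normal hD hp

/-- The generators of the quotient of the covering group by the power relations satisfy the
relations. -/
theorem rel_quotient (hD : D.Consistent) {p : ℕ} (hp : p.Coprime 2) :
    D.Rel p (fun i => (basis D i : Cover D ⧸ relSubgroup hD hp)) := by
  have key : ∀ x y : Cover D, Congr p x y → (x : Cover D ⧸ relSubgroup hD hp) = y := by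
    intro x y h
    exact (QuotientGroup.eq.2 ((inv_mul_mem_relSubgroup hD hp).2 h)).symm
  constructor
  · have := key (basis D 0 ^ p) (basis D 1 ^ D.a₂ * basis D 2 ^ D.a₃ * basis D 3 ^ D.a₄) (by
      rw [basis_zero_pow, basis_one_pow, basis_two_pow, basis_three_pow]
      exact ⟨1, 0, 0, 0, by simp⟩)
    exact_mod_cast this
  · have := key (basis D 1 ^ p) (basis D 2 ^ D.b₃ * basis D 3 ^ D.b₄) (by
      rw [basis_one_pow, basis_two_pow, basis_three_pow]
      exact ⟨0, 1, 0, 0, by simp⟩)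
    exact_mod_cast this
  · have := key (basis D 2 ^ p) (basis D 3 ^ D.c₄) (by
      rw [basis_two_pow, basis_three_pow]
      exact ⟨0, 0, 1, 0, by simp⟩)
    exact_mod_cast this
  · have := key (basis D 3 ^ p) 1 (by
      rw [basis_three_pow]
      exact ⟨0, 0, 0, 1, by simp⟩)
    exact_mod_cast this
  · have h : comm (basis D 1) (basis D 0) = basis D 2 ^ D.d₃ * basis D 3 ^ D.d₄ := by
      rw [comm_eq, basis_two_pow, basis_three_pow]; ext <;> simp [basis]
    exact congrArg (QuotientGroup.mk' (relSubgroup hD hp)) h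
  · have h : comm (basis D 2) (basis D 0) = basis D 3 ^ D.e₄ := by
      rw [comm_eq, basis_three_pow]; ext <;> simp [basis]
    exact congrArg (QuotientGroup.mk' (relSubgroup hD hp)) h
  · have h : comm (basis D 3) (basis D 0) = 1 := by rw [comm_eq]; ext <;> simp [basis]
    exact congrArg (QuotientGroup.mk' (relSubgroup hD hp)) h
  · have h : comm (basis D 2) (basis D 1) = 1 := by rw [comm_eq]; ext <;> simp [basis]
    exact congrArg (QuotientGroup.mk' (relSubgroup hD hp)) h
  · have h : comm (basis D 3) (basis D 1) = 1 := by rw [comm_eq]; ext <;> simp [basis]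
    exact congrArg (QuotientGroup.mk' (relSubgroup hD hp)) h
  · have h : comm (basis D 3) (basis D 2) = 1 := by rw [comm_eq]; ext <;> simp [basis]
    exact congrArg (QuotientGroup.mk' (relSubgroup hD hp)) h

theorem normalForm_quotient_injective (hD : D.Consistent) {p : ℕ} [NeZero p] (hp : p.Coprime 2) :
    Function.Injective (normalForm (p := p)
      (fun i => (basis D i : Cover D ⧸ relSubgroup hD hp))) := by
  intro e f h
  have h1 : ∀ e : Fin 4 → ZMod p, normalForm (fun i => (basis D i : Cover D ⧸ relSubgroup hD hp)) e
      = ((ofVal e : Cover D) : Cover D ⧸ relSubgroup hD hp) := by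
    intro e
    rw [← normalForm_basis]
    simp [normalForm]
  rw [h1, h1] at h
  exact (ofVal_congr_iff.1 ((inv_mul_mem_relSubgroup hD hp).1 (QuotientGroup.eq.1 h))).symm

end Cover

theorem map_normalForm {p : ℕ} {G H : Type*} [Group G] [Group H] (φ : G →* H) (a : Fin 4 → G)
    (e : Fin 4 → ZMod p) : φ (normalForm a e) = normalForm (φ ∘ a) e := by
  simp [normalForm]

theorem eval_ofVal {D : PCData} {p : ℕ} {G : Type*} [Group G] (g : Fin 4 → G)
    (e : Fin 4 → ZMod p) : Cover.eval g (Cover.ofVal e : Cover D) = normalForm g e := by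
  simp [Cover.eval, Cover.ofVal, normalForm, mul_assoc]

namespace PCData.Rel

variable {D : PCData} {p : ℕ} {G H : Type*} [Group G] [Group H] {g : Fin 4 → G}

theorem map (h : D.Rel p g) (φ : G →* H) : D.Rel p (φ ∘ g) := by
  constructor
  · simpa using congrArg φ h.pow0
  · simpa using congrArg φ h.pow1
  · simpa using congrArg φ h.pow2
  · simpa using congrArg φ h.pow3
  · simpa [comm] using congrArg φ h.comm10
  · simpa [comm] using congrArg φ h.comm20
  · simpa [comm] using congrArg φ h.comm30
  · simpa [comm] using congrArg φ h.comm21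
  · simpa [comm] using congrArg φ h.comm31
  · simpa [comm] using congrArg φ h.comm32

/-- If elements that satisfy the relations generate the group, then every element of the group has
a normal form. -/
theorem normalForm_surjective [NeZero p] (h : D.Rel p g) (hD : D.Consistent) (hp : p.Coprime 2)
    (hg : Subgroup.closure (Set.range g) = ⊤) :
    Function.Surjective (normalForm (p := p) g) := by
  have h1 : h.evalHom.range = ⊤ := by
    rw [← top_le_iff, ← hg, Subgroup.closure_le]
    rintro _ ⟨i, rfl⟩
    refine ⟨Cover.basis D i, ?_⟩
    fin_cases i <;> simp [evalHom, Cover.eval, Cover.basis]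
  intro y
  obtain ⟨x, rfl⟩ := MonoidHom.range_eq_top.1 h1 y
  obtain ⟨e, he⟩ := Cover.exists_congr_ofVal (p := p) x
  exact ⟨e, by rw [← eval_ofVal (D := D), ← h.eval_eq_of_congr hD hp he]; rfl⟩

end PCData.Rel

/-- The exponents of the fifteen presentations. -/
def pcData (w : ℕ) : Fin 15 → PCData := ![
  ⟨1, 0, 0, 1, 0, 1, 0, 0, 0⟩,
  ⟨0, 1, 0, 0, 1, 0, 0, 0, 0⟩,
  ⟨0, 0, 1, 0, 0, 0, 1, 0, 0⟩,
  ⟨0, 1, 0, 0, 1, 0, 0, 1, 0⟩,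
  ⟨0, 1, 0, 0, 0, 1, 0, 0, 0⟩,
  ⟨0, 1, 0, 0, 0, 1, 0, 1, 0⟩,
  ⟨0, 0, 0, 0, 0, 0, 1, 0, 1⟩,
  ⟨0, 0, 1, 0, 0, 0, 1, 0, 1⟩,
  ⟨0, 0, 0, 0, 1, 0, 1, 0, 1⟩,
  ⟨0, 0, 0, 0, w, 0, 1, 0, 1⟩,
  ⟨0, 0, 1, 0, 0, 0, 0, 0, 0⟩,
  ⟨0, 0, 0, 0, 0, 0, 0, 1, 0⟩,
  ⟨0, 0, 1, 0, 0, 0, 0, 1, 0⟩,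
  ⟨0, 0, 0, 0, 0, 1, 0, 1, 0⟩,
  ⟨0, 0, 0, 0, 0, 0, 0, 0, 0⟩]

theorem forall_fin_fifteen {P : Fin 15 → Prop} (h0 : P 0) (h1 : P 1) (h2 : P 2) (h3 : P 3)
    (h4 : P 4) (h5 : P 5) (h6 : P 6) (h7 : P 7) (h8 : P 8) (h9 : P 9) (h10 : P 10) (h11 : P 11)
    (h12 : P 12) (h13 : P 13) (h14 : P 14) (k : Fin 15) : P k := by
  fin_cases k <;> assumption

theorem pcData_consistent (w : ℕ) (k : Fin 15) : (pcData w k).Consistent := by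
  fin_cases k <;> constructor <;> simp [pcData]

theorem lift_comm {G : Type*} [Group G] (y : Fin 4 → G) (a b : Word) :
    FreeGroup.lift y (comm a b) = comm (FreeGroup.lift y a) (FreeGroup.lift y b) := by
  simp [comm]

theorem PCData.rel_iff (D : PCData) (p : ℕ) {G : Type*} [Group G] (g : Fin 4 → G) :
    D.Rel p g ↔ g 0 ^ p = g 1 ^ D.a₂ * g 2 ^ D.a₃ * g 3 ^ D.a₄ ∧
      g 1 ^ p = g 2 ^ D.b₃ * g 3 ^ D.b₄ ∧ g 2 ^ p = g 3 ^ D.c₄ ∧ g 3 ^ p = 1 ∧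
      comm (g 1) (g 0) = g 2 ^ D.d₃ * g 3 ^ D.d₄ ∧ comm (g 2) (g 0) = g 3 ^ D.e₄ ∧
      comm (g 3) (g 0) = 1 ∧ comm (g 2) (g 1) = 1 ∧ comm (g 3) (g 1) = 1 ∧
      comm (g 3) (g 2) = 1 :=
  ⟨fun ⟨h1, h2, h3, h4, h5, h6, h7, h8, h9, h10⟩ => ⟨h1, h2, h3, h4, h5, h6, h7, h8, h9, h10⟩,
    fun ⟨h1, h2, h3, h4, h5, h6, h7, h8, h9, h10⟩ => ⟨h1, h2, h3, h4, h5, h6, h7, h8, h9, h10⟩⟩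

theorem lift_pcRelators_iff (p : ℕ) (P : Fin 4 → Word) (c d : Word) {G : Type*} [Group G]
    (g : Fin 4 → G) : (∀ r ∈ pcRelators p P c d, FreeGroup.lift g r = 1) ↔
      g 0 ^ p = FreeGroup.lift g (P 0) ∧ g 1 ^ p = FreeGroup.lift g (P 1) ∧
      g 2 ^ p = FreeGroup.lift g (P 2) ∧ g 3 ^ p = FreeGroup.lift g (P 3) ∧
      comm (g 1) (g 0) = FreeGroup.lift g c ∧ comm (g 2) (g 0) = FreeGroup.lift g d ∧
      comm (g 3) (g 0) = 1 ∧ comm (g 2) (g 1) = 1 ∧ comm (g 3) (g 1) = 1 ∧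
      comm (g 3) (g 2) = 1 := by
  simp [pcRelators, lift_comm, g₁, g₂, g₃, g₄, mul_inv_eq_one]

theorem lift_relators_iff (p w : ℕ) (k : Fin 15) {G : Type*} [Group G] (g : Fin 4 → G) :
    (∀ r ∈ relators p w k, FreeGroup.lift g r = 1) ↔ (pcData w k).Rel p g := by
  rw [PCData.rel_iff]
  fin_cases k <;> refine (lift_pcRelators_iff p _ _ _ g).trans ?_ <;>
    simp [pcData, g₂, g₃, g₄]

section Rep

variable {p w : ℕ} {k : Fin 15} {G : Type*} [Group G]

theorem rel_gen : (pcData w k).Rel p (gen p w k) := by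
  rw [← lift_relators_iff]
  intro r hr
  have h : FreeGroup.lift (gen p w k) = PresentedGroup.mk (relators p w k) := by
    ext i
    simp [gen, PresentedGroup.of]
  rw [h]
  exact PresentedGroup.one_of_mem hr

theorem closure_gen : Subgroup.closure (Set.range (gen p w k)) = ⊤ :=
  PresentedGroup.closure_range_of _

/-- The homomorphism from the presented group given by elements that satisfy its relations. -/
def repLift {g : Fin 4 → G} (h : (pcData w k).Rel p g) : Rep p w k →* G :=
  PresentedGroup.toGroup ((lift_relators_iff p w k g).2 h)

@[simp] theorem repLift_gen {g : Fin 4 → G} (h : (pcData w k).Rel p g) (i : Fin 4) :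
    repLift h (gen p w k i) = g i := PresentedGroup.toGroup.of _

theorem hom_ext {φ ψ : Rep p w k →* G} (h : ∀ i, φ (gen p w k i) = ψ (gen p w k i)) : φ = ψ :=
  PresentedGroup.ext h

/-- Every element of a presented group has exactly one normal form. -/
theorem normalForm_bijective [NeZero p] (hp : p.Coprime 2) :
    Function.Bijective (normalForm (p := p) (gen p w k)) := by
  have hD := pcData_consistent w k
  refine ⟨fun e f h => ?_, rel_gen.normalForm_surjective hD hp closure_gen⟩
  have hQ := Cover.rel_quotient hD hp
  have h1 : ∀ e : Fin 4 → ZMod p, normalForm (fun i => ((Cover.basis (pcData w k) i :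
      Cover (pcData w k)) : Cover (pcData w k) ⧸ Cover.relSubgroup hD hp)) e =
      repLift hQ (normalForm (gen p w k) e) := by
    intro e
    rw [map_normalForm]
    congr 1
    ext i
    simp
  apply Cover.normalForm_quotient_injective hD hp
  rw [h1, h1, h]

theorem card_rep [NeZero p] (hp : p.Coprime 2) : Nat.card (Rep p w k) = p ^ 4 := by
  rw [← Nat.card_congr (Equiv.ofBijective _ (normalForm_bijective (w := w) (k := k) hp))]
  simp

end Rep

/-! ### Powers and commutators of normal forms -/

/-- The exponents of the `p`-th power of the normal form with exponents `x`. -/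
def powVec (D : PCData) {p : ℕ} (x : Fin 4 → ZMod p) : Fin 4 → ZMod p :=
  ![0, D.a₂ * x 0, D.a₃ * x 0 + D.b₃ * x 1, D.a₄ * x 0 + D.b₄ * x 1 + D.c₄ * x 2]

/-- The exponents of the commutator `[h, k]` of the normal forms `h`, `k` with exponents `y`,
`x`. -/
def commVec (D : PCData) {p : ℕ} [Fact p.Prime] (y x : Fin 4 → ZMod p) : Fin 4 → ZMod p :=
  ![0, 0, D.d₃ * (x 0 * y 1 - y 0 * x 1), D.d₄ * (x 0 * y 1 - y 0 * x 1) +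
    D.d₃ * D.e₄ * (x 0 * (x 0 - 1) / 2 * y 1 - y 0 * (y 0 - 1) / 2 * x 1) +
    D.e₄ * (x 0 * y 2 - y 0 * x 2)]

theorem exists_eq_val_add {p : ℕ} [NeZero p] {z : ℤ} {a : ZMod p} (h : (z : ZMod p) = a) :
    ∃ q : ℤ, z = a.val + p * q := by
  refine ⟨z / p, ?_⟩
  rw [← h, ZMod.val_intCast, Int.emod_add_mul_ediv]

theorem val_natCast_mul {p : ℕ} [NeZero p] {a : ℕ} (ha : a ≤ 1) (x : ZMod p) :
    ((a * x : ZMod p).val : ℤ) = a * x.val := by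
  interval_cases a <;> simp

section

variable {D : PCData} {p : ℕ} {G : Type*} [Group G] {g : Fin 4 → G} [Fact p.Prime]

theorem cast_tri (h2 : (2 : ZMod p) ≠ 0) (n : ℤ) : (tri n : ZMod p) = n * (n - 1) / 2 := by
  rw [eq_div_iff h2, mul_comm]
  exact_mod_cast congrArg (Int.cast : ℤ → ZMod p) (two_mul_tri n)

theorem two_ne_zero' (hp : 3 < p) : (2 : ZMod p) ≠ 0 := by
  have : ((2 : ℕ) : ZMod p) ≠ 0 := by
    rw [Ne, ZMod.natCast_eq_zero_iff]
    exact fun h => absurd (Nat.le_of_dvd (by norm_num) h) (by omega)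
  exact_mod_cast this

theorem coprime_two (hp : 3 < p) : p.Coprime 2 :=
  (Nat.coprime_primes Fact.out Nat.prime_two).2 (by omega)

/-- The correction terms of the collection formula carry the factors `p.choose 2` and
`p.choose 3`, which `p` divides; only the power relations remain. -/
theorem PCData.Rel.normalForm_pow (h : D.Rel p g) (hD : D.Consistent) (hp : 3 < p)
    (x : Fin 4 → ZMod p) : normalForm g x ^ p = normalForm g (powVec D x) := by
  have hc : (D.c₄ * D.d₃ : ℤ) = 0 := by exact_mod_cast hD.cd
  rw [← eval_ofVal (D := D), ← eval_ofVal (D := D), show Cover.eval g (Cover.ofVal x : Cover D) ^ p =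
    Cover.eval g ((Cover.ofVal x : Cover D) ^ p) from (map_pow h.evalHom _ _).symm]
  apply h.eval_eq_of_congr hD (coprime_two hp)
  obtain ⟨K, hK⟩ : (p : ℤ) ∣ p.choose 2 := by
    exact_mod_cast (Fact.out : p.Prime).dvd_choose_self (by norm_num) (by omega)
  obtain ⟨L, hL⟩ : (p : ℤ) ∣ p.choose 3 := by
    exact_mod_cast (Fact.out : p.Prime).dvd_choose_self (by norm_num) (by omega)
  set x₁ : ℤ := ((x 0).val : ℤ)
  set x₂ : ℤ := ((x 1).val : ℤ)
  set x₃ : ℤ := ((x 2).val : ℤ)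
  set x₄ : ℤ := ((x 3).val : ℤ)
  have e1 : (((powVec D x) 1).val : ℤ) = D.a₂ * x₁ := val_natCast_mul hD.a₂_le _
  have e2 : (((powVec D x) 2).val : ℤ) = D.a₃ * x₁ + D.b₃ * x₂ := by
    rcases mul_eq_zero.1 hD.ab with h0 | h0
    · have := val_natCast_mul hD.b₃_le (x 1)
      simpa [powVec, h0, x₁, x₂] using this
    · have := val_natCast_mul hD.a₃_le (x 0)
      simpa [powVec, h0, x₁, x₂] using this
  obtain ⟨t, ht⟩ := exists_eq_val_add (p := p) (z := D.a₄ * x₁ + D.b₄ * x₂ + D.c₄ * x₃)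
    (a := powVec D x 3) (by simp [powVec, x₁, x₂, x₃])
  rw [Cover.pow_eq]
  refine ⟨x₁, x₂, x₃ + D.d₃ * x₁ * x₂ * K, t + x₄ + (D.d₄ * x₁ * x₂ + D.e₄ * x₁ * x₃) * K +
    D.d₃ * D.e₄ * x₂ * (tri x₁ * K + x₁ ^ 2 * L), ?_, ?_, ?_, ?_⟩
  · simp [Cover.ofVal, powVec, x₁]
  · simp only [Cover.ofVal]
    rw [e1]; ring
  · simp only [Cover.ofVal]
    rw [e2, hK]; ring
  · simp only [Cover.ofVal]
    rw [hK, hL]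
    linear_combination ht + x₁ * x₂ * K * hc

theorem PCData.Rel.comm_normalForm (h : D.Rel p g) (hD : D.Consistent) (hp : 3 < p)
    (y x : Fin 4 → ZMod p) :
    comm (normalForm g y) (normalForm g x) = normalForm g (commVec D y x) := by
  have hc : (D.c₄ * D.d₃ : ℤ) = 0 := by exact_mod_cast hD.cd
  have h2 := two_ne_zero' hp
  have key : ∀ a b : Cover D, comm (Cover.eval g a) (Cover.eval g b) = Cover.eval g (comm a b) := by
    intro a b
    have : h.evalHom (comm a b) = comm (h.evalHom a) (h.evalHom b) := by simp [comm]
    exact this.symm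
  rw [← eval_ofVal (D := D), ← eval_ofVal (D := D), ← eval_ofVal (D := D), key]
  apply h.eval_eq_of_congr hD (coprime_two hp)
  rw [Cover.comm_eq]
  obtain ⟨s, hs⟩ := exists_eq_val_add (p := p) (a := commVec D y x 2)
    (z := D.d₃ * ((x 0).val * (y 1).val - (y 0).val * (x 1).val)) (by simp [commVec])
  obtain ⟨t, ht⟩ := exists_eq_val_add (p := p) (a := commVec D y x 3)
    (z := D.d₄ * ((x 0).val * (y 1).val - (y 0).val * (x 1).val) +
      D.d₃ * D.e₄ * (tri (x 0).val * (y 1).val - tri (y 0).val * (x 1).val) +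
      D.e₄ * ((x 0).val * (y 2).val - (y 0).val * (x 2).val))
    (by simp [commVec, cast_tri h2])
  have hcs : (D.c₄ : ℤ) * s = 0 := by
    rcases mul_eq_zero.1 hc with h0 | h0
    · simp [h0]
    · rw [h0] at hs
      have h3 : commVec D y x 2 = 0 := by
        have : D.d₃ = 0 := by exact_mod_cast h0
        simp [commVec, this]
      rw [h3] at hs
      have : (p : ℤ) * s = 0 := by simpa using hs.symm
      simp [(Fact.out : p.Prime).ne_zero] at this
      simp [this]
  refine ⟨0, 0, s, t, ?_, ?_, ?_, ?_⟩
  · simp [Cover.ofVal, commVec]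
  · simp [Cover.ofVal, commVec]
  · simp only [Cover.ofVal]; rw [hs]; ring
  · simp only [Cover.ofVal]; rw [ht]; linear_combination hcs

theorem normalForm_zero {p : ℕ} (g : Fin 4 → G) : normalForm g (0 : Fin 4 → ZMod p) = 1 := by
  simp [normalForm]

/-- Powers of an element whose normal form involves only the last generator. -/
theorem PCData.Rel.normalForm_nsmul (h : D.Rel p g) {x : Fin 4 → ZMod p} (h0 : x 0 = 0)
    (h1 : x 1 = 0) (h2 : x 2 = 0) (n : ℕ) : normalForm g x ^ n = normalForm g (n • x) := by
  simp only [normalForm, Pi.smul_apply, h0, h1, h2, smul_zero, ZMod.val_zero, pow_zero, one_mul]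
  rw [← pow_mul]
  apply pow_eq_pow_of_modEq _ h.pow3
  rw [← ZMod.natCast_eq_natCast_iff]
  simp [mul_comm]

/-- The rows of `M`, as exponents of normal forms in a group with exponents `D`, satisfy the
relations with exponents `E`. -/
def MatRel (E D : PCData) {p : ℕ} [Fact p.Prime] (M : Fin 4 → Fin 4 → ZMod p) : Prop :=
  powVec D (M 0) = E.a₂ • M 1 + E.a₃ • M 2 + E.a₄ • M 3 ∧
  powVec D (M 1) = E.b₃ • M 2 + E.b₄ • M 3 ∧
  powVec D (M 2) = E.c₄ • M 3 ∧
  powVec D (M 3) = 0 ∧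
  commVec D (M 1) (M 0) = E.d₃ • M 2 + E.d₄ • M 3 ∧
  commVec D (M 2) (M 0) = E.e₄ • M 3 ∧
  commVec D (M 3) (M 0) = 0 ∧
  commVec D (M 2) (M 1) = 0 ∧
  commVec D (M 3) (M 1) = 0 ∧
  commVec D (M 3) (M 2) = 0

/-- A tuple of normal forms satisfies the relations of one of the fifteen presentations if and only
if the exponents satisfy the corresponding polynomial equations over `ZMod p`. -/
theorem PCData.Rel.rel_normalForm_iff (h : D.Rel p g) (hD : D.Consistent) (hp : 3 < p)
    (hg : Function.Injective (normalForm (p := p) g)) (w : ℕ) (k : Fin 15)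
    (M : Fin 4 → Fin 4 → ZMod p) :
    (pcData w k).Rel p (fun i => normalForm g (M i)) ↔ MatRel (pcData w k) D M := by
  have h1 : (1 : G) = normalForm g (0 : Fin 4 → ZMod p) := (normalForm_zero g).symm
  rw [PCData.rel_iff, MatRel]
  simp only [h.normalForm_pow hD hp, h.comm_normalForm hD hp]
  -- the relation `g₂ ^ p = g₄ ^ w` involves a proper power of a normal form; it is linear in the
  -- exponents because the commutator relations put the last row into the last coordinate
  by_cases hk : k = 9
  · subst hk
    have key : commVec D (M 1) (M 0) = M 2 → commVec D (M 2) (M 0) = M 3 →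
        normalForm g (M 3) ^ w = normalForm g (w • M 3) := by
      intro e1 e2
      apply h.normalForm_nsmul
      · rw [← e2]; simp [commVec]
      · rw [← e2]; simp [commVec]
      · rw [← e2, ← e1]; simp [commVec]
    simp only [pcData, Matrix.cons_val, pow_zero, pow_one, one_mul, mul_one, zero_smul, one_smul,
      zero_add, add_zero]
    simp only [hg.eq_iff, h1]
    constructor
    · rintro ⟨f1, f2, f3, f4, f5, f6, f7⟩
      rw [key f5 f6, hg.eq_iff] at f2
      exact ⟨f1, f2, f3, f4, f5, f6, f7⟩
    · rintro ⟨f1, f2, f3, f4, f5, f6, f7⟩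
      rw [← hg.eq_iff, ← key f5 f6] at f2
      exact ⟨f1, f2, f3, f4, f5, f6, f7⟩
  · revert k
    refine forall_fin_fifteen ?_ ?_ ?_ ?_ ?_ ?_ ?_ ?_ ?_ (fun hk => absurd rfl hk) ?_ ?_ ?_ ?_ ?_ <;>
    intro _ <;>
    simp only [pcData, Matrix.cons_val, pow_zero, pow_one, one_mul, mul_one, zero_smul, one_smul,
      zero_add, add_zero] <;>
    simp only [hg.eq_iff, h1]

end

/-! ### The exponent matrices of the automorphisms -/

theorem vec_eq_iff {α : Type*} {v u : Fin 4 → α} :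
    v = u ↔ v 0 = u 0 ∧ v 1 = u 1 ∧ v 2 = u 2 ∧ v 3 = u 3 := by
  simp [funext_iff, Fin.forall_fin_succ]

/-- The values of a homomorphism to `ZMod p` on the four generators. -/
def CharVec (D : PCData) {p : ℕ} (c : Fin 4 → ZMod p) : Prop :=
  D.a₂ * c 1 + D.a₃ * c 2 + D.a₄ * c 3 = 0 ∧ D.b₃ * c 2 + D.b₄ * c 3 = 0 ∧ D.c₄ * c 3 = 0 ∧
    D.d₃ * c 2 + D.d₄ * c 3 = 0 ∧ D.e₄ * c 3 = 0

variable {p : ℕ} [Fact p.Prime]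

theorem matRel_of_mem_autMatrices (hp : 3 < p) (w : ℕ) (k : Fin 15)
    (M : Matrix (Fin 4) (Fin 4) (ZMod p)) (hM : M ∈ autMatrices p k) :
    MatRel (pcData w k) (pcData w k) M := by
  have h2 := two_ne_zero' hp
  revert k
  refine forall_fin_fifteen ?_ ?_ ?_ ?_ ?_ ?_ ?_ ?_ ?_ ?_ ?_ ?_ ?_ ?_ ?_ <;>
  intro hM <;> simp only [autMatrices, Matrix.cons_val, Set.mem_ofPred_eq] at hM
  · obtain ⟨u₁, u₂, u₃, u₄, hu, rfl⟩ := hM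
    simp [MatRel, vec_eq_iff, powVec, commVec, pcData]
  · obtain ⟨u₁, u₂, u₃, u₄, v₁, v₂, v₃, v₄, hu, rfl⟩ := hM
    simp [MatRel, vec_eq_iff, powVec, commVec, pcData]
  · obtain ⟨u₁, u₂, u₃, u₄, v₂, v₃, v₄, hu, hv, rfl⟩ := hM
    simp [MatRel, vec_eq_iff, powVec, commVec, pcData]
  · obtain ⟨u₂, u₃, u₄, v₂, v₃, v₄, hu, rfl⟩ := hM
    simp [MatRel, vec_eq_iff, powVec, commVec, pcData]
  · obtain ⟨u₁, u₂, u₃, u₄, v₂, v₄, hu, hv, rfl⟩ := hM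
    simp [MatRel, vec_eq_iff, powVec, commVec, pcData]
  · obtain ⟨u₁, u₂, u₃, u₄, v₄, hu, rfl⟩ := hM
    simp [MatRel, vec_eq_iff, powVec, commVec, pcData]
  · obtain ⟨u₁, u₂, u₃, u₄, v₂, v₃, v₄, hu, rfl⟩ := hM
    simp [MatRel, vec_eq_iff, powVec, commVec, pcData]
    refine ⟨?_, ?_⟩ <;> ring
  · obtain ⟨u₁, u₂, u₃, u₄, v₃, v₄, hu, rfl⟩ := hM
    simp [MatRel, vec_eq_iff, powVec, commVec, pcData, hu]
    field_simp
    ring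
  · obtain ⟨ε, u₃, u₄, v₂, v₃, v₄, hε, hv, rfl⟩ := hM
    simp [MatRel, vec_eq_iff, powVec, commVec, pcData]
    rcases hε with rfl | rfl
    · simp
    · simp; ring
  · obtain ⟨ε, u₃, u₄, v₂, v₃, v₄, hε, hv, rfl⟩ := hM
    simp [MatRel, vec_eq_iff, powVec, commVec, pcData]
    rcases hε with rfl | rfl
    · simp
    · simp; ring
  · obtain ⟨u₁, u₂, u₃, u₄, v₂, v₃, v₄, w₂, w₃, w₄, hu, hv, rfl⟩ := hM
    simp [MatRel, vec_eq_iff, powVec, commVec, pcData]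
  · obtain ⟨u₁, u₂, u₃, u₄, v₁, v₂, v₃, v₄, w₃, w₄, hu, hv, rfl⟩ := hM
    simp [MatRel, vec_eq_iff, powVec, commVec, pcData]
  · obtain ⟨u₁, u₂, u₃, u₄, v₃, v₄, w₃, w₄, hu, hv, rfl⟩ := hM
    simp [MatRel, vec_eq_iff, powVec, commVec, pcData]
  · obtain ⟨u₁, u₂, u₄, v₁, v₂, v₄, w₄, hu, rfl⟩ := hM
    simp [MatRel, vec_eq_iff, powVec, commVec, pcData]
  · simp [MatRel, powVec, commVec, pcData]

theorem det_block_two_two {R : Type*} [CommRing R] (a b c d e f g h i j k l : R) :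
    (!![a, b, c, d; e, f, g, h; 0, 0, i, j; 0, 0, k, l] : Matrix (Fin 4) (Fin 4) R).det =
      (a * f - e * b) * (i * l - k * j) := by
  simp [Matrix.det_succ_row_zero, Fin.sum_univ_succ, Fin.succAbove]
  ring

theorem det_block_one_two_one {R : Type*} [CommRing R] (a b c d e f g h i j k : R) :
    (!![a, b, c, d; 0, e, f, g; 0, h, i, j; 0, 0, 0, k] : Matrix (Fin 4) (Fin 4) R).det =
      a * (e * i - h * f) * k := by
  simp [Matrix.det_succ_row_zero, Fin.sum_univ_succ, Fin.succAbove]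
  ring

theorem det_ne_zero_of_mem_autMatrices (k : Fin 15)
    (M : Matrix (Fin 4) (Fin 4) (ZMod p)) (hM : M ∈ autMatrices p k) : M.det ≠ 0 := by
  revert k
  refine forall_fin_fifteen ?_ ?_ ?_ ?_ ?_ ?_ ?_ ?_ ?_ ?_ ?_ ?_ ?_ ?_ ?_ <;>
  intro hM <;> simp only [autMatrices, Matrix.cons_val, Set.mem_ofPred_eq] at hM
  · obtain ⟨u₁, u₂, u₃, u₄, hu, rfl⟩ := hM
    simp [det_block_two_two, hu]
  · obtain ⟨u₁, u₂, u₃, u₄, v₁, v₂, v₃, v₄, hu, rfl⟩ := hM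
    simp [det_block_two_two, hu]
  · obtain ⟨u₁, u₂, u₃, u₄, v₂, v₃, v₄, hu, hv, rfl⟩ := hM
    simp [det_block_two_two, hu, hv]
  · obtain ⟨u₂, u₃, u₄, v₂, v₃, v₄, hu, rfl⟩ := hM
    simp [det_block_two_two, hu]
  · obtain ⟨u₁, u₂, u₃, u₄, v₂, v₄, hu, hv, rfl⟩ := hM
    simp [det_block_two_two, hu, hv]
  · obtain ⟨u₁, u₂, u₃, u₄, v₄, hu, rfl⟩ := hM
    simp [det_block_two_two, hu]
  · obtain ⟨u₁, u₂, u₃, u₄, v₂, v₃, v₄, hu, rfl⟩ := hM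
    simp only [mul_ne_zero_iff] at hu
    simp [det_block_two_two, hu]
  · obtain ⟨u₁, u₂, u₃, u₄, v₃, v₄, hu, rfl⟩ := hM
    simp [det_block_two_two, hu]
  · obtain ⟨ε, u₃, u₄, v₂, v₃, v₄, hε, hv, rfl⟩ := hM
    rcases hε with rfl | rfl <;> simp [det_block_two_two, hv]
  · obtain ⟨ε, u₃, u₄, v₂, v₃, v₄, hε, hv, rfl⟩ := hM
    rcases hε with rfl | rfl <;> simp [det_block_two_two, hv]
  · obtain ⟨u₁, u₂, u₃, u₄, v₂, v₃, v₄, w₂, w₃, w₄, hu, hv, rfl⟩ := hM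
    simp [det_block_one_two_one, hu, hv]
  · obtain ⟨u₁, u₂, u₃, u₄, v₁, v₂, v₃, v₄, w₃, w₄, hu, hv, rfl⟩ := hM
    simp [det_block_two_two, hu, hv]
  · obtain ⟨u₁, u₂, u₃, u₄, v₃, v₄, w₃, w₄, hu, hv, rfl⟩ := hM
    simp [det_block_two_two, hu, hv]
  · obtain ⟨u₁, u₂, u₄, v₁, v₂, v₄, w₄, hu, rfl⟩ := hM
    simp [det_block_two_two, hu]
  · exact hM

theorem exists_eq_of_matrix {α : Type*} (M : Matrix (Fin 4) (Fin 4) α) :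
    ∃ a₁ a₂ a₃ a₄ b₁ b₂ b₃ b₄ c₁ c₂ c₃ c₄ d₁ d₂ d₃ d₄ : α,
      M = !![a₁, a₂, a₃, a₄; b₁, b₂, b₃, b₄; c₁, c₂, c₃, c₄; d₁, d₂, d₃, d₄] :=
  ⟨M 0 0, M 0 1, M 0 2, M 0 3, M 1 0, M 1 1, M 1 2, M 1 3, M 2 0, M 2 1, M 2 2, M 2 3,
    M 3 0, M 3 1, M 3 2, M 3 3, by ext i j; fin_cases i <;> fin_cases j <;> rfl⟩

theorem matrix_eq_iff {α : Type*} {a₁ a₂ a₃ a₄ b₁ b₂ b₃ b₄ c₁ c₂ c₃ c₄ d₁ d₂ d₃ d₄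
    a₁' a₂' a₃' a₄' b₁' b₂' b₃' b₄' c₁' c₂' c₃' c₄' d₁' d₂' d₃' d₄' : α} :
    !![a₁, a₂, a₃, a₄; b₁, b₂, b₃, b₄; c₁, c₂, c₃, c₄; d₁, d₂, d₃, d₄] =
      !![a₁', a₂', a₃', a₄'; b₁', b₂', b₃', b₄'; c₁', c₂', c₃', c₄'; d₁', d₂', d₃', d₄'] ↔
    (a₁ = a₁' ∧ a₂ = a₂' ∧ a₃ = a₃' ∧ a₄ = a₄') ∧ (b₁ = b₁' ∧ b₂ = b₂' ∧ b₃ = b₃' ∧ b₄ = b₄') ∧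
    (c₁ = c₁' ∧ c₂ = c₂' ∧ c₃ = c₃' ∧ c₄ = c₄') ∧ d₁ = d₁' ∧ d₂ = d₂' ∧ d₃ = d₃' ∧ d₄ = d₄' := by
  simp [and_assoc]

theorem mul_sub_ne_zero_of_solvable {R : Type*} [CommRing R] [Nontrivial R] {a b c d x y z t : R}
    (h1 : a * x + b * y = 1) (h2 : c * x + d * y = 0)
    (h4 : c * z + d * t = 1) : a * d - c * b ≠ 0 := by
  intro h
  have : (a * d - c * b) * (x * t - z * y) = 1 := by
    linear_combination (c * z + d * t) * h1 + h4 - h2 * (a * z + b * t)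
  rw [h, zero_mul] at this
  exact zero_ne_one this

/-- The step from the relations to the listed shape that the two maximal class groups with
`g₂ ^ p ≠ 1` share: the last row forces `a₁ ^ 2 = 1`. -/
theorem exists_eq_of_maxClass_eqs {a₁ a₃ a₄ b₁ b₂ b₃ b₄ c₃ c₄ : ZMod p}
    (hrow : ¬(0 : ZMod p) = 0 ∨ ¬(0 : ZMod p) = 0 ∨ ¬(0 : ZMod p) = 0 ∨ ¬b₂ = 0)
    (e3 : a₁ * b₂ - b₁ * 0 = c₃)
    (e4 : a₁ * (a₁ - 1) / 2 * b₂ - b₁ * (b₁ - 1) / 2 * 0 + (a₁ * b₃ - b₁ * a₃) = c₄)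
    (f4 : a₁ * (a₁ - 1) / 2 * 0 - 0 * (0 - 1) / 2 * 0 + (a₁ * c₃ - 0 * a₃) = b₂)
    (h : b₁ * (b₁ - 1) / 2 * 0 - 0 * (0 - 1) / 2 * b₂ + (b₁ * c₃ - 0 * b₃) = 0) :
    ∃ ε u₃ u₄ v₂ v₃ v₄ : ZMod p, (ε = 1 ∨ ε = -1) ∧ v₂ ≠ 0 ∧
    !![a₁, 0, a₃, a₄; b₁, b₂, b₃, b₄; 0, 0, c₃, c₄; 0, 0, 0, b₂] =
      !![ε, 0, u₃, u₄; 0, v₂, v₃, v₄;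
      0, 0, ε * v₂, ε * v₃ + ε * (ε - 1) * v₂ / 2; 0, 0, 0, v₂] := by
  have hb₂ : b₂ ≠ 0 := by simpa using hrow
  simp only [mul_zero, zero_mul, sub_zero, zero_div, zero_add] at e3 e4 f4 h
  have hc : c₃ ≠ 0 := by rintro rfl; exact hb₂ (by simpa using f4.symm)
  have hb : b₁ = 0 := by simpa [hc] using h
  subst hb
  have ha : a₁ * a₁ = 1 := by
    apply mul_right_cancel₀ hb₂
    rw [mul_assoc, e3, f4, one_mul]
  refine ⟨a₁, a₃, a₄, b₂, b₃, b₄, mul_self_eq_one_iff.1 ha, hb₂, ?_⟩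
  simp only [matrix_eq_iff, ← e4, ← e3, true_and, and_true]
  ring

set_option maxHeartbeats 1000000 in
/-- A matrix whose rows satisfy the relations has the listed shape, provided that its last two rows
do not vanish and that it maps the space of characters onto itself; these two conditions supply the
non-vanishing of the diagonal blocks. -/
theorem mem_autMatrices_of_matRel {w : ℕ} (hp : 3 < p) (hw : (w : ZMod p) ≠ 0) (k : Fin 15)
    (M : Matrix (Fin 4) (Fin 4) (ZMod p)) (hM : MatRel (pcData w k) (pcData w k) M)
    (hrow₂ : M 2 ≠ 0) (hrow₃ : M 3 ≠ 0)
    (hchar : ∀ c, CharVec (pcData w k) c → ∃ c', CharVec (pcData w k) c' ∧ M.mulVec c' = c) :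
    M ∈ autMatrices p k := by
  have h2 := two_ne_zero' hp
  -- in the elementary abelian group every vector is a character, so `M` is invertible
  by_cases hk : k = 14
  · subst hk
    have hs : Function.Surjective M.mulVec := fun c => by
      obtain ⟨c', -, h⟩ := hchar c (by simp [CharVec, pcData])
      exact ⟨c', h⟩
    rw [Matrix.mulVec_surjective_iff_isUnit, Matrix.isUnit_iff_isUnit_det] at hs
    exact hs.ne_zero
  obtain ⟨a₁, a₂, a₃, a₄, b₁, b₂, b₃, b₄, c₁, c₂, c₃, c₄, d₁, d₂, d₃, d₄, rfl⟩ :=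
    exists_eq_of_matrix M
  simp only [Ne, vec_eq_iff, not_and_or] at hrow₂ hrow₃
  simp only [Matrix.of_apply, Matrix.cons_val, Pi.zero_apply] at hrow₂ hrow₃
  revert k
  refine forall_fin_fifteen ?_ ?_ ?_ ?_ ?_ ?_ ?_ ?_ ?_ ?_ ?_ ?_ ?_ ?_
    (fun h _ _ => absurd rfl h) <;>
  intro hk hM hchar <;> clear hk <;> simp only [autMatrices, Matrix.cons_val, Set.mem_ofPred_eq] <;>
  simp only [CharVec, pcData, vec_eq_iff, Matrix.mulVec, dotProduct, Fin.sum_univ_four] at hchar <;>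
  simp [MatRel, vec_eq_iff, powVec, commVec, pcData] at hM <;>
  simp only [Nat.cast_zero, Nat.cast_one, zero_mul, one_mul, add_zero, zero_add, true_and, and_true,
    Matrix.of_apply, Matrix.cons_val] at hchar
  · refine ⟨a₁, a₂, a₃, a₄, ?_, ?_⟩
    · grind
    · simp only [matrix_eq_iff]; grind
  · refine ⟨a₁, a₂, a₃, a₄, b₁, b₂, b₃, b₄, ?_, ?_⟩
    · obtain ⟨x, ⟨x2, x3⟩, e0, e1, -⟩ := hchar ![1, 0, 0, 0] (by simp)
      obtain ⟨y, ⟨y2, y3⟩, f0, f1, -⟩ := hchar ![0, 1, 0, 0] (by simp)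
      simp only [x2, x3, y2, y3, mul_zero, add_zero, Matrix.cons_val] at e0 e1 f0 f1
      exact mul_sub_ne_zero_of_solvable e0 e1 f1
    · clear hchar; simp only [matrix_eq_iff]; grind
  · clear hchar
    refine ⟨a₁, a₂, a₃, a₄, b₂, b₃, b₄, ?_, ?_, ?_⟩
    · grind
    · grind
    · simp only [matrix_eq_iff]; grind
  · clear hchar
    refine ⟨a₂, a₃, a₄, b₂, b₃, b₄, ?_, ?_⟩
    · grind
    · simp only [matrix_eq_iff]; grind
  · refine ⟨a₁, a₂, a₃, a₄, b₂, b₄, ?_, ?_, ?_⟩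
    · grind
    · obtain ⟨x, ⟨x2, x3⟩, -, e1, -⟩ := hchar ![0, 1, 0, 0] (by simp)
      have : b₁ = 0 := hM.2.1.1
      simp only [x2, x3, this, zero_mul, mul_zero, add_zero, zero_add, Matrix.cons_val] at e1
      exact left_ne_zero_of_mul_eq_one e1
    · clear hchar; simp only [matrix_eq_iff]; grind
  · clear hchar
    refine ⟨a₁, a₂, a₃, a₄, b₄, ?_, ?_⟩
    · grind
    · simp only [matrix_eq_iff]; grind
  · clear hchar
    obtain ⟨⟨rfl, rfl, e3, e4⟩, ⟨rfl, rfl, f3, f4⟩, -, ⟨-, h⟩, -⟩ := hM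
    simp only [mul_zero, zero_mul, sub_zero] at f3 f4 h
    subst f3
    have hc : c₃ ≠ 0 := by rintro rfl; simp [← f4] at hrow₃
    have hb : b₁ = 0 := by simpa [hc] using h
    subst hb
    simp only [zero_mul, sub_zero, zero_div] at e3 e4
    refine ⟨a₁, a₂, a₃, a₄, b₂, b₃, b₄, by rwa [e3], ?_⟩
    simp only [matrix_eq_iff, ← f4, ← e3, ← e4, true_and, and_true]
    refine ⟨?_, ?_⟩ <;> ring
  · clear hchar
    obtain ⟨⟨rfl, rfl, rfl, rfl⟩, hb, -, -, ⟨rfl, rfl, e3, e4⟩, ⟨-, -, -, f4⟩, -⟩ := hM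
    subst hb
    have ha : a₁ ≠ 0 := by simpa using hrow₃
    simp only [mul_zero, zero_mul, sub_zero, zero_div, zero_add, mul_eq_left₀ ha] at e3 e4 f4
    subst f4
    have hb : b₂ = a₁⁻¹ := eq_inv_of_mul_eq_one_right e3
    subst hb
    refine ⟨a₁, a₂, a₃, a₄, b₃, b₄, ha, ?_⟩
    simp only [matrix_eq_iff, ← e4, true_and, and_true]
    field_simp
    ring
  · clear hchar
    obtain ⟨rfl, ⟨rfl, rfl, rfl, rfl⟩, -, -, ⟨rfl, rfl, e3, e4⟩, ⟨-, -, -, f4⟩, -, ⟨-, h⟩, -⟩ := hM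
    exact exists_eq_of_maxClass_eqs hrow₃ e3 e4 f4 h
  · clear hchar
    simp only [hw, false_or, or_false] at hM
    obtain ⟨rfl, ⟨rfl, rfl, rfl, rfl⟩, -, -, ⟨rfl, rfl, e3, e4⟩, ⟨-, -, -, f4⟩, -, ⟨-, h⟩, -⟩ := hM
    exact exists_eq_of_maxClass_eqs hrow₃ e3 e4 f4 h
  · refine ⟨a₁, a₂, a₃, a₄, b₂, b₃, b₄, c₂, c₃, c₄, ?_, ?_, ?_⟩
    · clear hchar; grind
    · obtain ⟨x, x3, -, e1, e2, -⟩ := hchar ![0, 1, 0, 0] (by simp)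
      obtain ⟨y, y3, -, f1, f2, -⟩ := hchar ![0, 0, 1, 0] (by simp)
      obtain ⟨-, rfl, rfl, -⟩ := hM
      simp only [x3, y3, zero_mul, mul_zero, add_zero, zero_add, Matrix.cons_val] at e1 e2 f1 f2
      exact mul_sub_ne_zero_of_solvable e1 e2 f2
    · clear hchar; simp only [matrix_eq_iff]; grind
  · refine ⟨a₁, a₂, a₃, a₄, b₁, b₂, b₃, b₄, c₃, c₄, ?_, ?_, ?_⟩
    · clear hchar; grind
    · obtain ⟨x, x3, -, -, e2, -⟩ := hchar ![0, 0, 1, 0] (by simp)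
      have h1 : c₁ = 0 := by clear hchar e2; grind
      have h2 : c₂ = 0 := by clear hchar e2; grind
      simp only [x3, h1, h2, zero_mul, mul_zero, add_zero, zero_add, Matrix.cons_val] at e2
      exact left_ne_zero_of_mul_eq_one e2
    · clear hchar; simp only [matrix_eq_iff]; grind
  · refine ⟨a₁, a₂, a₃, a₄, b₃, b₄, c₃, c₄, ?_, ?_, ?_⟩
    · clear hchar; grind
    · obtain ⟨x, x3, -, -, e2, -⟩ := hchar ![0, 0, 1, 0] (by simp)
      have h1 : c₁ = 0 := by clear hchar e2; grind
      have h2 : c₂ = 0 := by clear hchar e2; grind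
      simp only [x3, h1, h2, zero_mul, mul_zero, add_zero, zero_add, Matrix.cons_val] at e2
      exact left_ne_zero_of_mul_eq_one e2
    · clear hchar; simp only [matrix_eq_iff]; grind
  · clear hchar
    refine ⟨a₁, a₂, a₄, b₁, b₂, b₄, c₄, ?_, ?_⟩
    · grind
    · simp only [matrix_eq_iff]; grind

/-! ### Characters with values in `ZMod p` -/

section

variable {p : ℕ} [Fact p.Prime] {G : Type*} [Group G]

theorem exists_card_eq_pow_of_ne_top (hG : Nat.card G = p ^ 4) {K : Subgroup G} (hK : K ≠ ⊤) :
    ∃ n ≤ 3, Nat.card K = p ^ n := by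
  have hp := (Fact.out : p.Prime)
  have : Finite G := Nat.finite_of_card_ne_zero (by rw [hG]; exact pow_ne_zero _ hp.ne_zero)
  obtain ⟨n, hn, h⟩ := (Nat.dvd_prime_pow hp).1 (hG ▸ K.card_subgroup_dvd_card)
  refine ⟨n, ?_, h⟩
  by_contra h4
  have : n = 4 := by omega
  subst this
  exact hK (Subgroup.eq_top_of_card_eq K (by rw [h, hG]))

theorem index_eq_of_card (hG : Nat.card G = p ^ 4) {K : Subgroup G} (hK : Nat.card K = p ^ 3) :
    K.index = p := by
  have h := K.card_mul_index
  rw [hK, hG, pow_succ p 3] at h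
  exact Nat.eq_of_mul_eq_mul_left (pow_pos (Fact.out : p.Prime).pos 3) h

theorem normal_of_card (hG : Nat.card G = p ^ 4) {K : Subgroup G} (hK : Nat.card K = p ^ 3) :
    K.Normal := by
  apply Subgroup.normal_of_index_eq_minFac_card
  rw [index_eq_of_card hG hK, hG, Nat.pow_minFac (by norm_num), (Fact.out : p.Prime).minFac_eq]

/-- A proper subgroup of a group of order `p ^ 4` lies in the kernel of a nontrivial homomorphism
to `ZMod p`. -/
theorem exists_character (hG : Nat.card G = p ^ 4) {K : Subgroup G} (hK : K ≠ ⊤) :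
    ∃ χ : G →* Multiplicative (ZMod p), (∀ x ∈ K, χ x = 1) ∧ χ ≠ 1 := by
  have hp := (Fact.out : p.Prime)
  have : Finite G := Nat.finite_of_card_ne_zero (by rw [hG]; exact pow_ne_zero _ hp.ne_zero)
  obtain ⟨n, hn, h⟩ := exists_card_eq_pow_of_ne_top hG hK
  obtain ⟨N, hN, hKN⟩ := Sylow.exists_subgroup_card_pow_prime_le p (m := 3)
    (hG ▸ pow_dvd_pow p (by norm_num)) K h hn
  have := normal_of_card hG hN
  have hq : Nat.card (G ⧸ N) = p := index_eq_of_card hG hN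
  let e : G ⧸ N ≃* Multiplicative (ZMod p) := mulEquivOfPrimeCardEq hq (by simp)
  refine ⟨e.toMonoidHom.comp (QuotientGroup.mk' N), fun x hx => ?_, fun h1 => ?_⟩
  · have : (x : G ⧸ N) = 1 := (QuotientGroup.eq_one_iff x).2 (hKN hx)
    simp [this]
  · have : N = ⊤ := by
      rw [Subgroup.eq_top_iff']
      intro x
      rw [← QuotientGroup.eq_one_iff]
      exact e.injective (by simpa using DFunLike.congr_fun h1 x)
    have h2 := index_eq_of_card hG hN
    rw [this, Subgroup.index_top] at h2
    exact hp.one_lt.ne h2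

theorem character_normalForm (χ : G →* Multiplicative (ZMod p)) (g : Fin 4 → G)
    (x : Fin 4 → ZMod p) : (χ (normalForm g x)).toAdd = x ⬝ᵥ fun i => (χ (g i)).toAdd := by
  simp [normalForm, dotProduct, Fin.sum_univ_four]

theorem PCData.Rel.charVec {D : PCData} {g : Fin 4 → G} (h : D.Rel p g)
    (χ : G →* Multiplicative (ZMod p)) : CharVec D fun i => (χ (g i)).toAdd := by
  have h1 : ∀ x : G, (χ (x ^ p)).toAdd = 0 := fun x => by simp
  have h2 : ∀ x y : G, (χ (comm x y)).toAdd = 0 := fun x y => by simp [comm]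
  refine ⟨?_, ?_, ?_, ?_, ?_⟩
  · simpa [h.pow0] using h1 (g 0)
  · simpa [h.pow1] using h1 (g 1)
  · simpa [h.pow2] using h1 (g 2)
  · simpa [h.comm10] using h2 (g 1) (g 0)
  · simpa [h.comm20] using h2 (g 2) (g 0)

theorem CharVec.rel {D : PCData} {c : Fin 4 → ZMod p} (h : CharVec D c) :
    D.Rel p (fun i => Multiplicative.ofAdd (c i)) := by
  obtain ⟨h1, h2, h3, h4, h5⟩ := h
  have h0 : ∀ x : Multiplicative (ZMod p), x ^ p = 1 := fun x => by
    rw [← ofAdd_toAdd x, ← ofAdd_nsmul]; simp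
  have hc : ∀ x y : Multiplicative (ZMod p), comm x y = 1 := fun x y =>
    comm_eq_one_iff.2 (Commute.all x y)
  constructor <;> simp only [h0, hc, ← ofAdd_nsmul, ← ofAdd_add, nsmul_eq_mul, h1, h2, h3, h4, h5,
    ofAdd_zero]

end

/-! ### The automorphisms of the presented groups -/

section

variable {p : ℕ} [Fact p.Prime] {w : ℕ} {k : Fin 15}

theorem card_rep' (hp : 3 < p) : Nat.card (Rep p w k) = p ^ 4 := card_rep (coprime_two hp)

theorem finite_rep (hp : 3 < p) : Finite (Rep p w k) := Nat.finite_of_card_ne_zero (by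
  rw [card_rep' hp]; exact pow_ne_zero _ (Fact.out : p.Prime).ne_zero)

theorem normalForm_gen_injective (hp : 3 < p) :
    Function.Injective (normalForm (p := p) (gen p w k)) := (normalForm_bijective (coprime_two hp)).1

theorem rel_rows_iff (hp : 3 < p) (l : Fin 15) (M : Fin 4 → Fin 4 → ZMod p) :
    (pcData w l).Rel p (fun i => normalForm (gen p w k) (M i)) ↔
      MatRel (pcData w l) (pcData w k) M :=
  rel_gen.rel_normalForm_iff (pcData_consistent w k) hp (normalForm_gen_injective hp) w l M

/-- An endomorphism with invertible exponent matrix is bijective: no character vanishes on its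
image. -/
theorem bijective_of_det_ne_zero (hp : 3 < p) (φ : Rep p w k →* Rep p w k)
    {M : Matrix (Fin 4) (Fin 4) (ZMod p)} (hφ : ∀ i, φ (gen p w k i) = normalForm (gen p w k) (M i))
    (hM : M.det ≠ 0) : Function.Bijective φ := by
  have := finite_rep (w := w) (k := k) hp
  suffices h : φ.range = ⊤ from
    Finite.injective_iff_bijective.1 (Finite.injective_iff_surjective.2 (MonoidHom.range_eq_top.1 h))
  by_contra h
  obtain ⟨χ, h1, h2⟩ := exists_character (card_rep' hp) h
  have h3 : M.mulVec (fun i => (χ (gen p w k i)).toAdd) = 0 := by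
    ext i
    change M i ⬝ᵥ _ = 0
    rw [← character_normalForm, ← hφ, h1 _ ⟨_, rfl⟩, toAdd_one]
  have h4 := Matrix.eq_zero_of_mulVec_eq_zero hM h3
  exact h2 (hom_ext fun i => congrFun h4 i)

theorem existsUnique_aut (hp : 3 < p) (M : Matrix (Fin 4) (Fin 4) (ZMod p))
    (hM : M ∈ autMatrices p k) : ∃! α : MulAut (Rep p w k), HasExponents α M := by
  have h := (rel_rows_iff (w := w) (k := k) hp k M).2 (matRel_of_mem_autMatrices hp w k M hM)
  refine ⟨MulEquiv.ofBijective (repLift h) (bijective_of_det_ne_zero hp _ (repLift_gen h)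
    (det_ne_zero_of_mem_autMatrices k M hM)), repLift_gen h, fun β hβ => ?_⟩
  apply MulEquiv.toMonoidHom_injective
  exact hom_ext fun i => (hβ i).trans (repLift_gen h i).symm

theorem gen_ne_one (hp : 3 < p) (i : Fin 4) : gen p w k i ≠ 1 := by
  have h1 : normalForm (p := p) (gen p w k) (Pi.single i 1) = gen p w k i := by
    have : 1 < p := by omega
    fin_cases i <;> simp [normalForm, ZMod.val_one'' this.ne']
  rw [← h1, ← normalForm_zero (p := p) (gen p w k), (normalForm_gen_injective hp).ne_iff]
  simp

theorem HasExponents.mem_autMatrices (hp : 3 < p) (hw : (w : ZMod p) ≠ 0) {α : MulAut (Rep p w k)}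
    {M : Matrix (Fin 4) (Fin 4) (ZMod p)} (h : HasExponents α M) : M ∈ autMatrices p k := by
  have h1 : (fun i => normalForm (gen p w k) (M i)) = α.toMonoidHom ∘ gen p w k :=
    funext fun i => (h i).symm
  have hrow : ∀ i, M i ≠ 0 := by
    intro i hi
    have := h i
    rw [hi, normalForm_zero, map_eq_one_iff α α.injective] at this
    exact gen_ne_one hp i this
  refine mem_autMatrices_of_matRel hp hw k M ?_ (hrow 2) (hrow 3) ?_
  · rw [← rel_rows_iff (w := w) hp k M, h1]
    exact rel_gen.map _
  · intro c hc
    -- the character with values `c`, composed with the inverse automorphism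
    let χ := (repLift hc.rel).comp (α⁻¹ : MulAut _).toMonoidHom
    refine ⟨fun i => (χ (gen p w k i)).toAdd, rel_gen.charVec χ, ?_⟩
    ext i
    change M i ⬝ᵥ _ = c i
    rw [← character_normalForm, ← h i]
    simp [χ]

theorem existsUnique_matrix (hp : 3 < p) (hw : (w : ZMod p) ≠ 0) (α : MulAut (Rep p w k)) :
    ∃! M, M ∈ autMatrices p k ∧ HasExponents α M := by
  have hb := normalForm_bijective (w := w) (k := k) (coprime_two hp)
  choose M hM using fun i => hb.2 (α (gen p w k i))
  have h : HasExponents α (Matrix.of M) := fun i => (hM i).symm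
  refine ⟨Matrix.of M, ⟨h.mem_autMatrices hp hw, h⟩, fun N hN => ?_⟩
  ext i j
  exact congrFun (hb.1 ((hN.2 i).symm.trans (h i))) j

end

/-! ### The presented groups are pairwise non-isomorphic -/

/-- An equivalence between the sets of exponents that respects the unit, `p`-th powers and
commutators of normal forms. -/
structure VecIso (p : ℕ) [Fact p.Prime] (D E : PCData) where
  toFun : (Fin 4 → ZMod p) ≃ (Fin 4 → ZMod p)
  map_zero : toFun 0 = 0
  map_pow : ∀ x, toFun (powVec D x) = powVec E (toFun x)
  map_comm : ∀ y x, toFun (commVec D y x) = commVec E (toFun y) (toFun x)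

namespace VecIso

variable {p : ℕ} [Fact p.Prime] {D E : PCData}

theorem map_pow_symm (f : VecIso p D E) (x) :
    f.toFun.symm (powVec E x) = powVec D (f.toFun.symm x) := by
  rw [Equiv.symm_apply_eq, f.map_pow, Equiv.apply_symm_apply]

theorem map_comm_symm (f : VecIso p D E) (y x) :
    f.toFun.symm (commVec E y x) = commVec D (f.toFun.symm y) (f.toFun.symm x) := by
  rw [Equiv.symm_apply_eq, f.map_comm, Equiv.apply_symm_apply, Equiv.apply_symm_apply]

theorem map_zero_symm (f : VecIso p D E) : f.toFun.symm 0 = 0 := by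
  rw [Equiv.symm_apply_eq, f.map_zero]

/-- The inverse equivalence. -/
def symm (f : VecIso p D E) : VecIso p E D where
  toFun := f.toFun.symm
  map_zero := f.map_zero_symm
  map_pow := f.map_pow_symm
  map_comm := f.map_comm_symm

theorem map_eq_zero (f : VecIso p D E) {x} : f.toFun x = 0 ↔ x = 0 := by
  conv_lhs => rw [← f.map_zero, f.toFun.apply_eq_iff_eq]

theorem exponent_one (f : VecIso p D E) (h : ∀ x : Fin 4 → ZMod p, powVec D x = 0) :
    ∀ x : Fin 4 → ZMod p, powVec E x = 0 := fun x => by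
  rw [← f.symm.map_eq_zero, f.symm.map_pow, h]

theorem exponent_two (f : VecIso p D E) (h : ∀ x : Fin 4 → ZMod p, powVec D (powVec D x) = 0) :
    ∀ x : Fin 4 → ZMod p, powVec E (powVec E x) = 0 := fun x => by
  rw [← f.symm.map_eq_zero, f.symm.map_pow, f.symm.map_pow, h]

theorem exponent_three (f : VecIso p D E)
    (h : ∀ x : Fin 4 → ZMod p, powVec D (powVec D (powVec D x)) = 0) :
    ∀ x : Fin 4 → ZMod p, powVec E (powVec E (powVec E x)) = 0 := fun x => by
  rw [← f.symm.map_eq_zero, f.symm.map_pow, f.symm.map_pow, f.symm.map_pow, h]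

theorem abelian (f : VecIso p D E) (h : ∀ x y : Fin 4 → ZMod p, commVec D x y = 0) :
    ∀ x y : Fin 4 → ZMod p, commVec E x y = 0 := fun x y => by
  rw [← f.symm.map_eq_zero, f.symm.map_comm, h]

theorem class_two (f : VecIso p D E)
    (h : ∀ x y z : Fin 4 → ZMod p, commVec D (commVec D x y) z = 0) :
    ∀ x y z : Fin 4 → ZMod p, commVec E (commVec E x y) z = 0 := fun x y z => by
  rw [← f.symm.map_eq_zero, f.symm.map_comm, f.symm.map_comm, h]

/-- The property that every element with trivial `p`-th power (`omega`) is a `p`-th power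
(`agemo`). -/
theorem omega_le_agemo (f : VecIso p D E)
    (h : ∀ x : Fin 4 → ZMod p, powVec D x = 0 → ∃ y, powVec D y = x) :
    ∀ x : Fin 4 → ZMod p, powVec E x = 0 → ∃ y, powVec E y = x := fun x hx => by
  obtain ⟨y, hy⟩ := h (f.symm.toFun x) (by rw [← f.symm.map_pow, f.symm.map_eq_zero, hx])
  exact ⟨f.toFun y, by rw [← f.map_pow, hy]; exact f.toFun.apply_symm_apply x⟩

theorem comm_mem_agemo (f : VecIso p D E)
    (h : ∀ x y : Fin 4 → ZMod p, ∃ z, powVec D z = commVec D x y) :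
    ∀ x y : Fin 4 → ZMod p, ∃ z, powVec E z = commVec E x y := fun x y => by
  obtain ⟨z, hz⟩ := h (f.symm.toFun x) (f.symm.toFun y)
  refine ⟨f.toFun z, ?_⟩
  rw [← f.map_pow, hz, ← f.symm.map_comm]
  exact f.toFun.apply_symm_apply _

theorem omega_le_center (f : VecIso p D E)
    (h : ∀ x y : Fin 4 → ZMod p, powVec D x = 0 → commVec D x y = 0) :
    ∀ x y : Fin 4 → ZMod p, powVec E x = 0 → commVec E x y = 0 := fun x y hx => by
  rw [← f.symm.map_eq_zero, f.symm.map_comm, h]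
  rw [← f.symm.map_pow, f.symm.map_eq_zero, hx]

theorem center_le_omega (f : VecIso p D E)
    (h : ∀ x : Fin 4 → ZMod p, (∀ y, commVec D x y = 0) → powVec D x = 0) :
    ∀ x : Fin 4 → ZMod p, (∀ y, commVec E x y = 0) → powVec E x = 0 := fun x hx => by
  rw [← f.symm.map_eq_zero, f.symm.map_pow, h]
  intro y
  rw [← f.map_eq_zero, f.map_comm]
  exact (congrArg (commVec E · _) (f.toFun.apply_symm_apply x)).trans (hx _)

theorem omega_abelian (f : VecIso p D E)
    (h : ∀ x y : Fin 4 → ZMod p, powVec D x = 0 → powVec D y = 0 → commVec D x y = 0) :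
    ∀ x y : Fin 4 → ZMod p, powVec E x = 0 → powVec E y = 0 → commVec E x y = 0 :=
  fun x y hx hy => by
  rw [← f.symm.map_eq_zero, f.symm.map_comm, h]
  · rw [← f.symm.map_pow, f.symm.map_eq_zero, hx]
  · rw [← f.symm.map_pow, f.symm.map_eq_zero, hy]

end VecIso

section

variable {p : ℕ} [Fact p.Prime] {w : ℕ}

/-- An isomorphism of presented groups in terms of exponents. -/
theorem nonempty_vecIso (hp : 3 < p) {k l : Fin 15} (e : Rep p w k ≃* Rep p w l) :
    Nonempty (VecIso p (pcData w k) (pcData w l)) := by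
  let f := fun k => Equiv.ofBijective _ (normalForm_bijective (w := w) (k := k) (coprime_two hp))
  have hf : ∀ k x, f k x = normalForm (gen p w k) x := fun k x => rfl
  refine ⟨⟨(f k).trans (e.toEquiv.trans (f l).symm), ?_, fun x => ?_, fun y x => ?_⟩⟩
  · simp [Equiv.symm_apply_eq, hf, normalForm_zero]
  · simp only [Equiv.trans_apply, Equiv.symm_apply_eq, hf]
    rw [← rel_gen.normalForm_pow (pcData_consistent w l) hp,
      ← rel_gen.normalForm_pow (pcData_consistent w k) hp, ← hf l, Equiv.apply_symm_apply]
    exact map_pow e _ _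
  · simp only [Equiv.trans_apply, Equiv.symm_apply_eq, hf]
    rw [← rel_gen.comm_normalForm (pcData_consistent w l) hp,
      ← rel_gen.comm_normalForm (pcData_consistent w k) hp, ← hf l, ← hf l, Equiv.apply_symm_apply,
      Equiv.apply_symm_apply]
    exact (by simp [comm] : ∀ a b, e (comm a b) = comm (e a) (e b)) _ _

theorem exponent_one_iff (hw : (w : ZMod p) ≠ 0) (k : Fin 15) :
    (∀ x : Fin 4 → ZMod p, powVec (pcData w k) x = 0) ↔ k = 6 ∨ k = 11 ∨ k = 14 := by
  have h : (∀ x : Fin 4 → ZMod p, powVec (pcData w k) x = 0) ↔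
      powVec (pcData w k) (![1, 0, 0, 0] : Fin 4 → ZMod p) = 0 ∧
      powVec (pcData w k) (![0, 1, 0, 0] : Fin 4 → ZMod p) = 0 ∧
      powVec (pcData w k) (![0, 0, 1, 0] : Fin 4 → ZMod p) = 0 := by
    refine ⟨fun h => ⟨h _, h _, h _⟩, fun ⟨h1, h2, h3⟩ x => ?_⟩
    simp [powVec] at h1 h2 h3 ⊢
    simp [h1, h2, h3]
  rw [h]
  revert k
  refine forall_fin_fifteen ?_ ?_ ?_ ?_ ?_ ?_ ?_ ?_ ?_ ?_ ?_ ?_ ?_ ?_ ?_ <;> intro _ <;>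
    simp [powVec, pcData, hw]

theorem exponent_two_iff (k : Fin 15) :
    (∀ x : Fin 4 → ZMod p, powVec (pcData w k) (powVec (pcData w k) x) = 0) ↔
      ¬(k = 0 ∨ k = 4 ∨ k = 5) := by
  have h : (∀ x : Fin 4 → ZMod p, powVec (pcData w k) (powVec (pcData w k) x) = 0) ↔
      powVec (pcData w k) (powVec (pcData w k) (![1, 0, 0, 0] : Fin 4 → ZMod p)) = 0 := by
    refine ⟨fun h => h _, ?_⟩
    revert k
    refine forall_fin_fifteen ?_ ?_ ?_ ?_ ?_ ?_ ?_ ?_ ?_ ?_ ?_ ?_ ?_ ?_ ?_ <;>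
      simp [powVec, pcData]
  rw [h]
  revert k
  refine forall_fin_fifteen ?_ ?_ ?_ ?_ ?_ ?_ ?_ ?_ ?_ ?_ ?_ ?_ ?_ ?_ ?_ <;> intro _ <;>
    simp [powVec, pcData]

theorem exponent_three_iff (k : Fin 15) :
    (∀ x : Fin 4 → ZMod p, powVec (pcData w k) (powVec (pcData w k) (powVec (pcData w k) x)) = 0) ↔
      k ≠ 0 := by
  have h : (∀ x : Fin 4 → ZMod p,
      powVec (pcData w k) (powVec (pcData w k) (powVec (pcData w k) x)) = 0) ↔
      powVec (pcData w k) (powVec (pcData w k) (powVec (pcData w k)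
        (![1, 0, 0, 0] : Fin 4 → ZMod p))) = 0 := by
    refine ⟨fun h => h _, ?_⟩
    revert k
    refine forall_fin_fifteen ?_ ?_ ?_ ?_ ?_ ?_ ?_ ?_ ?_ ?_ ?_ ?_ ?_ ?_ ?_ <;>
      simp [powVec, pcData]
  rw [h]
  revert k
  refine forall_fin_fifteen ?_ ?_ ?_ ?_ ?_ ?_ ?_ ?_ ?_ ?_ ?_ ?_ ?_ ?_ ?_ <;> intro _ <;>
    simp [powVec, pcData]

theorem abelian_iff (k : Fin 15) :
    (∀ y x : Fin 4 → ZMod p, commVec (pcData w k) y x = 0) ↔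
      k = 0 ∨ k = 1 ∨ k = 4 ∨ k = 10 ∨ k = 14 := by
  have h : (∀ y x : Fin 4 → ZMod p, commVec (pcData w k) y x = 0) ↔
      commVec (pcData w k) ![0, 1, 0, 0] (![1, 0, 0, 0] : Fin 4 → ZMod p) = 0 ∧
      commVec (pcData w k) ![0, 0, 1, 0] (![1, 0, 0, 0] : Fin 4 → ZMod p) = 0 := by
    refine ⟨fun h => ⟨h _ _, h _ _⟩, ?_⟩
    rintro ⟨h1, h2⟩ y x
    simp [commVec] at h1 h2 ⊢
    simp [h1, h2]
  rw [h]
  revert k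
  refine forall_fin_fifteen ?_ ?_ ?_ ?_ ?_ ?_ ?_ ?_ ?_ ?_ ?_ ?_ ?_ ?_ ?_ <;> intro _ <;>
    simp [commVec, pcData]

theorem class_two_iff (k : Fin 15) :
    (∀ x y z : Fin 4 → ZMod p, commVec (pcData w k) (commVec (pcData w k) x y) z = 0) ↔
      ¬(k = 6 ∨ k = 7 ∨ k = 8 ∨ k = 9) := by
  have h : (∀ x y z : Fin 4 → ZMod p, commVec (pcData w k) (commVec (pcData w k) x y) z = 0) ↔
      commVec (pcData w k) (commVec (pcData w k) ![0, 1, 0, 0] ![1, 0, 0, 0])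
        (![1, 0, 0, 0] : Fin 4 → ZMod p) = 0 := by
    refine ⟨fun h => h _ _ _, fun h x y z => ?_⟩
    simp [commVec] at h ⊢
    rcases h with h | h <;> simp [h]
  rw [h]
  revert k
  refine forall_fin_fifteen ?_ ?_ ?_ ?_ ?_ ?_ ?_ ?_ ?_ ?_ ?_ ?_ ?_ ?_ ?_ <;> intro _ <;>
    simp [commVec, pcData]

theorem not_vecIso_1_10 : IsEmpty (VecIso p (pcData w 1) (pcData w 10)) := by
  refine ⟨fun f => ?_⟩
  obtain ⟨y, hy⟩ := f.omega_le_agemo (fun x hx => ⟨![x 2, x 3, 0, 0], by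
    rw [vec_eq_iff]; simp [powVec, pcData] at hx ⊢; simp [hx]⟩) ![0, 1, 0, 0]
    (by simp [powVec, pcData])
  simp [powVec, pcData] at hy

theorem not_vecIso_2_of_comm_mem {D : PCData}
    (h : ∀ x y : Fin 4 → ZMod p, ∃ z, powVec D z = commVec D x y) :
    IsEmpty (VecIso p D (pcData w 2)) := by
  refine ⟨fun f => ?_⟩
  obtain ⟨z, hz⟩ := f.comm_mem_agemo h ![0, 1, 0, 0] ![1, 0, 0, 0]
  simp [powVec, commVec, pcData] at hz

theorem comm_mem_agemo_3 (x y : Fin 4 → ZMod p) :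
    ∃ z, powVec (pcData w 3) z = commVec (pcData w 3) x y :=
  ⟨![0, commVec (pcData w 3) x y 3, 0, 0], by simp [powVec, commVec, pcData]⟩

theorem comm_mem_agemo_12 (x y : Fin 4 → ZMod p) :
    ∃ z, powVec (pcData w 12) z = commVec (pcData w 12) x y :=
  ⟨![commVec (pcData w 12) x y 3, 0, 0, 0], by simp [powVec, commVec, pcData]⟩

theorem comm_mem_agemo_13 (x y : Fin 4 → ZMod p) :
    ∃ z, powVec (pcData w 13) z = commVec (pcData w 13) x y :=
  ⟨![0, 0, commVec (pcData w 13) x y 3, 0], by simp [powVec, commVec, pcData]⟩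

theorem omega_le_center_3 (x y : Fin 4 → ZMod p) (h : powVec (pcData w 3) x = 0) :
    commVec (pcData w 3) x y = 0 := by
  simp [powVec, commVec, pcData] at h ⊢
  simp [h]

theorem not_vecIso_3_12 : IsEmpty (VecIso p (pcData w 3) (pcData w 12)) := by
  refine ⟨fun f => ?_⟩
  have := f.omega_le_center omega_le_center_3 ![0, 1, 0, 0] ![1, 0, 0, 0] (by simp [powVec, pcData])
  simp [commVec, pcData] at this

theorem not_vecIso_3_13 : IsEmpty (VecIso p (pcData w 3) (pcData w 13)) := by
  refine ⟨fun f => ?_⟩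
  have := f.omega_le_center omega_le_center_3 ![0, 1, 0, 0] ![1, 0, 0, 0] (by simp [powVec, pcData])
  simp [commVec, pcData] at this

theorem not_vecIso_12_13 : IsEmpty (VecIso p (pcData w 12) (pcData w 13)) := by
  refine ⟨fun f => ?_⟩
  have := f.center_le_omega (fun x hx => by
    have := hx ![0, 1, 0, 0]
    simp [commVec, pcData] at this
    simp [powVec, pcData, this]) ![0, 0, 1, 0] (by simp [commVec, pcData])
  simp [powVec, pcData] at this

theorem omega_abelian_7 (x y : Fin 4 → ZMod p) (hx : powVec (pcData w 7) x = 0)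
    (hy : powVec (pcData w 7) y = 0) : commVec (pcData w 7) x y = 0 := by
  simp [powVec, pcData] at hx hy
  simp [commVec, hx, hy]

theorem not_vecIso_7_8 : IsEmpty (VecIso p (pcData w 7) (pcData w 8)) := by
  refine ⟨fun f => ?_⟩
  have := f.omega_abelian omega_abelian_7 ![0, 0, 1, 0] ![1, 0, 0, 0] (by simp [powVec, pcData])
    (by simp [powVec, pcData])
  simp [commVec, pcData] at this

theorem not_vecIso_7_9 : IsEmpty (VecIso p (pcData w 7) (pcData w 9)) := by
  refine ⟨fun f => ?_⟩
  have := f.omega_abelian omega_abelian_7 ![0, 0, 1, 0] ![1, 0, 0, 0] (by simp [powVec, pcData])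
    (by simp [powVec, pcData])
  simp [commVec, pcData] at this

/-- In the two remaining groups of maximal class, `g₂ ^ p` and `g₄` differ by a factor that is
well-defined up to squares. -/
theorem not_vecIso_8_9 (hw : ¬IsSquare (w : ZMod p)) :
    IsEmpty (VecIso p (pcData w 8) (pcData w 9)) := by
  refine ⟨fun f => ?_⟩
  have hw0 : (w : ZMod p) ≠ 0 := by rintro h; exact hw (h ▸ IsSquare.zero)
  have h0 := f.map_pow ![1, 0, 0, 0]
  have h1 := f.map_pow ![0, 1, 0, 0]
  have h2 := f.map_comm ![0, 1, 0, 0] ![1, 0, 0, 0]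
  have h3 := f.map_comm ![0, 0, 1, 0] ![1, 0, 0, 0]
  have h4 : f.toFun ![0, 0, 0, 1] ≠ 0 := by
    rw [Ne, f.map_eq_zero]; simp
  have e0 : powVec (pcData w 8) (![1, 0, 0, 0] : Fin 4 → ZMod p) = 0 := by simp [powVec, pcData]
  have e1 : powVec (pcData w 8) (![0, 1, 0, 0] : Fin 4 → ZMod p) = ![0, 0, 0, 1] := by
    simp [powVec, pcData]
  have e2 : commVec (pcData w 8) ![0, 1, 0, 0] (![1, 0, 0, 0] : Fin 4 → ZMod p) = ![0, 0, 1, 0] := by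
    simp [commVec, pcData]
  have e3 : commVec (pcData w 8) ![0, 0, 1, 0] (![1, 0, 0, 0] : Fin 4 → ZMod p) = ![0, 0, 0, 1] := by
    simp [commVec, pcData]
  rw [e0, f.map_zero] at h0
  rw [e1] at h1
  rw [e2] at h2
  rw [e3] at h3
  generalize f.toFun ![1, 0, 0, 0] = a at *
  generalize f.toFun ![0, 1, 0, 0] = b at *
  generalize f.toFun ![0, 0, 1, 0] = c at *
  generalize f.toFun ![0, 0, 0, 1] = d at *
  simp [vec_eq_iff, powVec, commVec, pcData, hw0] at h0 h1 h2 h3 h4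
  obtain ⟨c0, c1, c2, c3⟩ := h2
  rw [h0, mul_zero, sub_zero] at c2
  have hb : b 1 ≠ 0 := by
    intro hb
    rw [hb, mul_zero] at h1
    exact h4 h1.1 h1.2.1 h1.2.2.1 h1.2.2.2
  have h5 : (w : ZMod p) * b 1 = a 0 * a 0 * b 1 := by
    rw [← h1.2.2.2, h3.2.2.2, c0, c1, c2]; ring
  exact hw ⟨a 0, mul_right_cancel₀ hb h5⟩

theorem eq_of_vecIso (hw : ¬IsSquare (w : ZMod p)) {k l : Fin 15}
    (f : VecIso p (pcData w k) (pcData w l)) : k = l := by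
  have hw0 : (w : ZMod p) ≠ 0 := by rintro h; exact hw (h ▸ IsSquare.zero)
  have h1 : (k = 6 ∨ k = 11 ∨ k = 14) ↔ (l = 6 ∨ l = 11 ∨ l = 14) := by
    rw [← exponent_one_iff hw0, ← exponent_one_iff hw0]
    exact ⟨f.exponent_one, f.symm.exponent_one⟩
  have h2 : (k = 0 ∨ k = 4 ∨ k = 5) ↔ (l = 0 ∨ l = 4 ∨ l = 5) := by
    rw [← not_iff_not, ← exponent_two_iff (p := p) (w := w),
      ← exponent_two_iff (p := p) (w := w)]
    exact ⟨f.exponent_two, f.symm.exponent_two⟩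
  have h3 : k = 0 ↔ l = 0 := by
    rw [← not_iff_not, ← Ne, ← Ne, ← exponent_three_iff (p := p) (w := w),
      ← exponent_three_iff (p := p) (w := w)]
    exact ⟨f.exponent_three, f.symm.exponent_three⟩
  have h4 : (k = 0 ∨ k = 1 ∨ k = 4 ∨ k = 10 ∨ k = 14) ↔
      (l = 0 ∨ l = 1 ∨ l = 4 ∨ l = 10 ∨ l = 14) := by
    rw [← abelian_iff (p := p) (w := w), ← abelian_iff (p := p) (w := w)]
    exact ⟨f.abelian, f.symm.abelian⟩
  have h5 : (k = 6 ∨ k = 7 ∨ k = 8 ∨ k = 9) ↔ (l = 6 ∨ l = 7 ∨ l = 8 ∨ l = 9) := by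
    rw [← not_iff_not, ← class_two_iff (p := p) (w := w), ← class_two_iff (p := p) (w := w)]
    exact ⟨f.class_two, f.symm.class_two⟩
  -- the pairs that exponent, commutativity and class leave open
  have key : ∀ k l : Fin 15, ((k = 6 ∨ k = 11 ∨ k = 14) ↔ (l = 6 ∨ l = 11 ∨ l = 14)) →
      ((k = 0 ∨ k = 4 ∨ k = 5) ↔ (l = 0 ∨ l = 4 ∨ l = 5)) → (k = 0 ↔ l = 0) →
      ((k = 0 ∨ k = 1 ∨ k = 4 ∨ k = 10 ∨ k = 14) ↔
        (l = 0 ∨ l = 1 ∨ l = 4 ∨ l = 10 ∨ l = 14)) →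
      ((k = 6 ∨ k = 7 ∨ k = 8 ∨ k = 9) ↔ (l = 6 ∨ l = 7 ∨ l = 8 ∨ l = 9)) → k = l ∨
      (k, l) ∈ ({(1, 10), (2, 3), (2, 12), (2, 13), (3, 12), (3, 13), (12, 13), (7, 8), (7, 9),
        (8, 9)} : Finset (Fin 15 × Fin 15)) ∨
      (l, k) ∈ ({(1, 10), (2, 3), (2, 12), (2, 13), (3, 12), (3, 13), (12, 13), (7, 8), (7, 9),
        (8, 9)} : Finset (Fin 15 × Fin 15)) := by decide
  have no : ∀ k l : Fin 15, VecIso p (pcData w k) (pcData w l) →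
      (k, l) ∉ ({(1, 10), (2, 3), (2, 12), (2, 13), (3, 12), (3, 13), (12, 13), (7, 8), (7, 9),
        (8, 9)} : Finset (Fin 15 × Fin 15)) := by
    intro k l f h
    simp only [Finset.mem_insert, Finset.mem_singleton, Prod.mk.injEq] at h
    rcases h with ⟨rfl, rfl⟩ | ⟨rfl, rfl⟩ | ⟨rfl, rfl⟩ | ⟨rfl, rfl⟩ | ⟨rfl, rfl⟩ | ⟨rfl, rfl⟩ |
      ⟨rfl, rfl⟩ | ⟨rfl, rfl⟩ | ⟨rfl, rfl⟩ | ⟨rfl, rfl⟩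
    · exact not_vecIso_1_10.false f
    · exact (not_vecIso_2_of_comm_mem comm_mem_agemo_3).false f.symm
    · exact (not_vecIso_2_of_comm_mem comm_mem_agemo_12).false f.symm
    · exact (not_vecIso_2_of_comm_mem comm_mem_agemo_13).false f.symm
    · exact not_vecIso_3_12.false f
    · exact not_vecIso_3_13.false f
    · exact not_vecIso_12_13.false f
    · exact not_vecIso_7_8.false f
    · exact not_vecIso_7_9.false f
    · exact (not_vecIso_8_9 hw).false f
  rcases key k l h1 h2 h3 h4 h5 with h | h | h
  · exact h
  · exact absurd h (no k l f)
  · exact absurd h (no l k f.symm)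

end

/-! ### Identification of groups with the presented groups -/

section

variable {p : ℕ} [Fact p.Prime] {w : ℕ}

/-- A group of order `p ^ 4` is isomorphic to a presented group as soon as it is generated by
elements that satisfy the relations. -/
theorem nonempty_mulEquiv_rep (hp : 3 < p) {k : Fin 15} {G : Type*} [Group G]
    (hG : Nat.card G = p ^ 4) {g : Fin 4 → G} (h : (pcData w k).Rel p g)
    (hg : Subgroup.closure (Set.range g) = ⊤) : Nonempty (G ≃* Rep p w k) := by
  have : Finite (Rep p w k) := finite_rep hp
  have hs : Function.Surjective (repLift h) := by
    rw [← MonoidHom.range_eq_top, ← top_le_iff, ← hg, Subgroup.closure_le]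
    rintro _ ⟨i, rfl⟩
    exact ⟨gen p w k i, repLift_gen h i⟩
  have hb : Function.Bijective (repLift h) :=
    (Nat.bijective_iff_surjective_and_card _).2 ⟨hs, by rw [card_rep' hp, hG]⟩
  exact ⟨(MulEquiv.ofBijective _ hb).symm⟩

theorem closure_eq_top_of_forall {G : Type*} [Group G] {g : Fin 4 → G}
    (h : ∀ x, ∃ a b c d : ℕ, g 0 ^ a * g 1 ^ b * g 2 ^ c * g 3 ^ d = x) :
    Subgroup.closure (Set.range g) = ⊤ := by
  rw [Subgroup.eq_top_iff']
  intro x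
  obtain ⟨a, b, c, d, rfl⟩ := h x
  have hi : ∀ i, g i ∈ Subgroup.closure (Set.range g) :=
    fun i => Subgroup.subset_closure ⟨i, rfl⟩
  exact mul_mem (mul_mem (mul_mem (pow_mem (hi 0) a) (pow_mem (hi 1) b)) (pow_mem (hi 2) c))
    (pow_mem (hi 3) d)

theorem comm_eq_one_of_comm {G : Type*} [CommGroup G] (x y : G) : comm x y = 1 :=
  comm_eq_one_iff.2 (Commute.all x y)

omit [Fact p.Prime] in
/-- In a commutative group only the power relations have to be checked. -/
theorem PCData.rel_of_comm {D : PCData} {G : Type*} [CommGroup G] {g : Fin 4 → G}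
    (hd₃ : D.d₃ = 0) (hd₄ : D.d₄ = 0) (he : D.e₄ = 0)
    (h0 : g 0 ^ p = g 1 ^ D.a₂ * g 2 ^ D.a₃ * g 3 ^ D.a₄)
    (h1 : g 1 ^ p = g 2 ^ D.b₃ * g 3 ^ D.b₄) (h2 : g 2 ^ p = g 3 ^ D.c₄) (h3 : g 3 ^ p = 1) :
    D.Rel p g := by
  constructor <;> simp [comm_eq_one_of_comm, *]

theorem rep_zero_equiv (hp : 3 < p) :
    Nonempty (Rep p w 0 ≃* Multiplicative (ZMod (p ^ 4))) := by
  have hz : (p : ZMod (p ^ 4)) ^ 4 = 0 := by exact_mod_cast ZMod.natCast_self (p ^ 4)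
  refine (nonempty_mulEquiv_rep (w := w) (k := 0) hp (G := Multiplicative (ZMod (p ^ 4)))
    (g := fun i => Multiplicative.ofAdd (![1, p, p ^ 2, p ^ 3] i)) (by simp) ?_ ?_).map
    MulEquiv.symm
  · apply PCData.rel_of_comm <;> simp only [pcData, Matrix.cons_val, ← ofAdd_nsmul, ← ofAdd_add]
    · simp
    · simp; ring
    · simp; ring
    · rw [ofAdd_eq_one]; simp; rw [← hz]; ring
  · apply closure_eq_top_of_forall
    intro x
    refine ⟨x.toAdd.val, 0, 0, 0, ?_⟩
    have : NeZero (p ^ 4) := ⟨pow_ne_zero _ (Fact.out : p.Prime).ne_zero⟩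
    simp [← ofAdd_nsmul]

theorem rep_one_equiv (hp : 3 < p) :
    Nonempty (Rep p w 1 ≃* Multiplicative (ZMod (p ^ 2) × ZMod (p ^ 2))) := by
  have hz : (p : ZMod (p ^ 2)) ^ 2 = 0 := by exact_mod_cast ZMod.natCast_self (p ^ 2)
  have : NeZero (p ^ 2) := ⟨pow_ne_zero _ (Fact.out : p.Prime).ne_zero⟩
  refine (nonempty_mulEquiv_rep (w := w) (k := 1) hp
    (G := Multiplicative (ZMod (p ^ 2) × ZMod (p ^ 2)))
    (g := fun i => Multiplicative.ofAdd (![(1, 0), (0, 1), ((p : ZMod (p ^ 2)), 0),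
      (0, (p : ZMod (p ^ 2)))] i)) (by simp; ring) ?_ ?_).map MulEquiv.symm
  · apply PCData.rel_of_comm <;> simp only [pcData, Matrix.cons_val, ← ofAdd_nsmul, ← ofAdd_add]
    · simp
    · simp
    · refine congrArg Multiplicative.ofAdd ?_; simp [← pow_two, hz]
    · rw [ofAdd_eq_one]; simp [← pow_two, hz]
  · apply closure_eq_top_of_forall
    intro x
    refine ⟨x.toAdd.1.val, x.toAdd.2.val, 0, 0, ?_⟩
    simp [← ofAdd_nsmul, ← ofAdd_add]

theorem rep_four_equiv (hp : 3 < p) :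
    Nonempty (Rep p w 4 ≃* Multiplicative (ZMod (p ^ 3) × ZMod p)) := by
  have hz : (p : ZMod (p ^ 3)) ^ 3 = 0 := by exact_mod_cast ZMod.natCast_self (p ^ 3)
  have : NeZero (p ^ 3) := ⟨pow_ne_zero _ (Fact.out : p.Prime).ne_zero⟩
  refine (nonempty_mulEquiv_rep (w := w) (k := 4) hp
    (G := Multiplicative (ZMod (p ^ 3) × ZMod p))
    (g := fun i => Multiplicative.ofAdd (![(1, 0), (0, 1), ((p : ZMod (p ^ 3)), 0),
      ((p : ZMod (p ^ 3)) ^ 2, 0)] i)) (by simp; ring) ?_ ?_).map MulEquiv.symm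
  · apply PCData.rel_of_comm <;> simp only [pcData, Matrix.cons_val, ← ofAdd_nsmul, ← ofAdd_add]
    · simp
    · simp
    · refine congrArg Multiplicative.ofAdd ?_; simp [← pow_two]
    · rw [ofAdd_eq_one]; simp [← pow_succ', hz]
  · apply closure_eq_top_of_forall
    intro x
    refine ⟨x.toAdd.1.val, x.toAdd.2.val, 0, 0, ?_⟩
    simp [← ofAdd_nsmul, ← ofAdd_add]

theorem rep_ten_equiv (hp : 3 < p) :
    Nonempty (Rep p w 10 ≃* Multiplicative (ZMod (p ^ 2) × ZMod p × ZMod p)) := by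
  have hz : (p : ZMod (p ^ 2)) ^ 2 = 0 := by exact_mod_cast ZMod.natCast_self (p ^ 2)
  have : NeZero (p ^ 2) := ⟨pow_ne_zero _ (Fact.out : p.Prime).ne_zero⟩
  refine (nonempty_mulEquiv_rep (w := w) (k := 10) hp
    (G := Multiplicative (ZMod (p ^ 2) × ZMod p × ZMod p))
    (g := fun i => Multiplicative.ofAdd (![(1, 0, 0), (0, 1, 0), (0, 0, 1),
      ((p : ZMod (p ^ 2)), 0, 0)] i)) (by simp; ring) ?_ ?_).map MulEquiv.symm
  · apply PCData.rel_of_comm <;> simp only [pcData, Matrix.cons_val, ← ofAdd_nsmul, ← ofAdd_add]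
    · simp
    · simp
    · simp
    · rw [ofAdd_eq_one]; simp [← pow_two, hz]
  · apply closure_eq_top_of_forall
    intro x
    refine ⟨x.toAdd.1.val, x.toAdd.2.1.val, x.toAdd.2.2.val, 0, ?_⟩
    simp [← ofAdd_nsmul, ← ofAdd_add]

theorem rep_fourteen_equiv (hp : 3 < p) :
    Nonempty (Rep p w 14 ≃* Multiplicative (Fin 4 → ZMod p)) := by
  have h0 : ∀ x : Multiplicative (Fin 4 → ZMod p), x ^ p = 1 := fun x => by
    rw [← ofAdd_toAdd x, ← ofAdd_nsmul]; simp
  refine (nonempty_mulEquiv_rep (w := w) (k := 14) hp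
    (G := Multiplicative (Fin 4 → ZMod p))
    (g := fun i => Multiplicative.ofAdd (Pi.single i 1)) (by simp) ?_ ?_).map MulEquiv.symm
  · apply PCData.rel_of_comm <;> simp [pcData, h0]
  · apply closure_eq_top_of_forall
    intro x
    refine ⟨(x.toAdd 0).val, (x.toAdd 1).val, (x.toAdd 2).val, (x.toAdd 3).val, ?_⟩
    simp only [← ofAdd_nsmul, ← ofAdd_add]
    apply Multiplicative.toAdd.injective
    ext i
    fin_cases i <;> simp [nsmul_eq_mul, -ZMod.natCast_val] <;> exact ZMod.natCast_zmod_val _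

/-! ### The automorphism group of the elementary abelian group -/

theorem normalForm_add (hp : 3 < p) (x y : Fin 4 → ZMod p) :
    normalForm (gen p w 14) (x + y) = normalForm (gen p w 14) x * normalForm (gen p w 14) y := by
  have h := rel_gen (p := p) (w := w) (k := 14)
  rw [← eval_ofVal (D := pcData w 14), ← eval_ofVal (D := pcData w 14),
    ← eval_ofVal (D := pcData w 14), ← h.eval_mul]
  apply (h.eval_eq_of_congr (pcData_consistent w 14) (coprime_two hp) _).symm
  have key : ∀ a b : ZMod p, ∃ q : ℤ, (a.val + b.val : ℤ) = (a + b).val + p * q :=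
    fun a b => exists_eq_val_add (by simp)
  obtain ⟨q, hq⟩ := key (x 0) (y 0)
  obtain ⟨r, hr⟩ := key (x 1) (y 1)
  obtain ⟨s, hs⟩ := key (x 2) (y 2)
  obtain ⟨t, ht⟩ := key (x 3) (y 3)
  refine ⟨q, r, s, t, ?_, ?_, ?_, ?_⟩ <;>
    simp only [Cover.mul_x₁, Cover.mul_x₂, Cover.mul_x₃, Cover.mul_x₄, Cover.ofVal, hq, hr, hs, ht,
      Pi.add_apply] <;>
    simp [pcData]

/-- Normal forms identify the elementary abelian group with the additive group of vectors. -/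
noncomputable def vecEquiv (w : ℕ) (hp : 3 < p) :
    Multiplicative (Fin 4 → ZMod p) ≃* Rep p w 14 :=
  MulEquiv.ofBijective (MonoidHom.mk' (fun x => normalForm (gen p w 14) x.toAdd)
    fun _ _ => normalForm_add hp _ _) (normalForm_bijective (coprime_two hp))

theorem vecEquiv_ofAdd (hp : 3 < p) (x : Fin 4 → ZMod p) :
    vecEquiv w hp (Multiplicative.ofAdd x) = normalForm (gen p w 14) x := rfl

/-- An automorphism of the elementary abelian group with exponent matrix `M` acts on exponents by
`x ↦ x M`. -/
theorem HasExponents.apply_normalForm (hp : 3 < p) {α : MulAut (Rep p w 14)}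
    {M : Matrix (Fin 4) (Fin 4) (ZMod p)} (h : HasExponents α M) (x : Fin 4 → ZMod p) :
    α (normalForm (gen p w 14) x) = normalForm (gen p w 14) (Matrix.vecMul x M) := by
  have h1 : ∀ i (n : ZMod p), (normalForm (gen p w 14) (M i)) ^ n.val =
      vecEquiv w hp (Multiplicative.ofAdd (n • M i)) := by
    intro i n
    rw [← vecEquiv_ofAdd hp, ← map_pow, ← ofAdd_nsmul]
    congr 2
    ext j
    simp
  have h2 : ⇑(MulEquiv.toMonoidHom α) ∘ gen p w 14 =
      fun i => normalForm (gen p w 14) (M i) := funext h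
  rw [← MulEquiv.coe_toMonoidHom, map_normalForm, h2, ← vecEquiv_ofAdd hp]
  simp only [normalForm] at h1 ⊢
  simp only [h1, ← map_mul, ← ofAdd_add]
  congr 2
  ext j
  simp [Matrix.vecMul, dotProduct, Fin.sum_univ_four]

theorem HasExponents.mul (hp : 3 < p) {α β : MulAut (Rep p w 14)}
    {M N : Matrix (Fin 4) (Fin 4) (ZMod p)} (hα : HasExponents α M) (hβ : HasExponents β N) :
    HasExponents (α * β) (N * M) := by
  intro i
  rw [MulAut.mul_apply, hβ i, hα.apply_normalForm hp]
  rfl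

theorem exists_mulEquiv_GL (hp : 3 < p) (hw : (w : ZMod p) ≠ 0) :
    ∃ e : MulAut (Rep p w 14) ≃* GL (Fin 4) (ZMod p),
      ∀ α, HasExponents α (e α : Matrix (Fin 4) (Fin 4) (ZMod p)).transpose := by
  choose M hM hM' using fun α : MulAut (Rep p w 14) => existsUnique_matrix hp hw α
  have hu : ∀ {α N}, HasExponents α N → N = M α := fun {α N} h =>
    hM' α N ⟨h.mem_autMatrices hp hw, h⟩
  have hdet : ∀ α, (M α).transpose.det ≠ 0 := fun α => by
    rw [Matrix.det_transpose]
    exact det_ne_zero_of_mem_autMatrices 14 _ (hM α).1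
  let f : MulAut (Rep p w 14) →* GL (Fin 4) (ZMod p) := MonoidHom.mk'
    (fun α => Matrix.GeneralLinearGroup.mkOfDetNeZero (M α).transpose (hdet α)) (by
      intro α β
      ext1
      change (M (α * β)).transpose = (M α).transpose * (M β).transpose
      rw [← Matrix.transpose_mul, ← hu ((hM α).2.mul hp (hM β).2)])
  have hf : ∀ α, (f α : Matrix (Fin 4) (Fin 4) (ZMod p)).transpose = M α := fun α =>
    Matrix.transpose_transpose _
  refine ⟨MulEquiv.ofBijective f ⟨fun α β h => ?_, fun A => ?_⟩, fun α => ?_⟩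
  · have h1 : M α = M β := by rw [← hf, ← hf, h]
    exact (existsUnique_aut hp (M α) (hM α).1).unique (hM α).2 (h1 ▸ (hM β).2)
  · have hA : (A : Matrix (Fin 4) (Fin 4) (ZMod p)).transpose ∈ autMatrices p 14 := by
      change Matrix.det _ ≠ 0
      rw [Matrix.det_transpose]
      exact (Matrix.isUnits_det_units A).ne_zero
    obtain ⟨α, hα, -⟩ := existsUnique_aut (w := w) hp _ hA
    refine ⟨α, Units.ext (Matrix.transpose_injective ?_)⟩
    rw [hf, ← hu hα]
  · change HasExponents α (f α : Matrix (Fin 4) (Fin 4) (ZMod p)).transpose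
    rw [hf]
    exact (hM α).2

/-! ### Counting isomorphism classes -/

/-- A complete irredundant list of groups of order `n` computes the number of isomorphism
classes. -/
theorem card_quotient_isoSetoid {n m : ℕ} (hn : n ≠ 0) (R : Fin m → Type) [∀ k, Group (R k)]
    (hcard : ∀ k, Nat.card (R k) = n) (hinj : ∀ k l, Nonempty (R k ≃* R l) → k = l)
    (hsurj : ∀ (H : Type) [Group H], Nat.card H = n → ∃ k, Nonempty (H ≃* R k)) :
    Nat.card (Quotient (isoSetoid n)) = m := by
  have e : ∀ k, Nonempty (R k ≃ Fin n) := fun k =>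
    have : Finite (R k) := Nat.finite_of_card_ne_zero (by rw [hcard]; exact hn)
    ⟨Finite.equivFinOfCardEq (hcard k)⟩
  have e := fun k => Classical.choice (e k)
  let A : Fin m → Group (Fin n) := fun k => (e k).symm.group
  have eA : ∀ k, Nonempty (@MulEquiv (Fin n) (R k) (A k).toMul _) := fun k =>
    ⟨@MulEquiv.mk _ _ (A k).toMul _ (e k).symm fun x y => (e k).symm_apply_apply _⟩
  have hb : Function.Bijective fun k => (Quotient.mk (isoSetoid n) (A k)) := by
    constructor
    · intro k l h
      obtain ⟨f⟩ : Nonempty (@MulEquiv (Fin n) (Fin n) (A k).toMul (A l).toMul) :=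
        Quotient.exact h
      obtain ⟨f1⟩ := eA k
      obtain ⟨f2⟩ := eA l
      exact hinj k l ⟨(@MulEquiv.trans _ _ _ _ (A k).toMul _ (@MulEquiv.symm _ _ (A k).toMul _ f1)
        (@MulEquiv.trans _ _ _ (A k).toMul (A l).toMul _ f f2))⟩
    · intro q
      induction q using Quotient.inductionOn with | h B =>
      obtain ⟨k, ⟨f⟩⟩ := @hsurj (Fin n) B (by simp)
      obtain ⟨f1⟩ := eA k
      refine ⟨k, Quotient.sound ⟨?_⟩⟩
      exact @MulEquiv.trans _ _ _ (A k).toMul _ B.toMul f1 (@MulEquiv.symm _ _ B.toMul _ f)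
  rw [← Nat.card_congr (Equiv.ofBijective _ hb), Nat.card_fin]

end

/-! ### Counting in subgroups of a group of order `p ^ 4` -/

section

variable {p : ℕ} [Fact p.Prime] {G : Type*} [Group G]

omit [Group G] in
theorem finite_of_card (hG : Nat.card G = p ^ 4) : Finite G :=
  Nat.finite_of_card_ne_zero (by rw [hG]; exact pow_ne_zero _ (Fact.out : p.Prime).ne_zero)

theorem exists_card_eq_pow (hG : Nat.card G = p ^ 4) (K : Subgroup G) :
    ∃ n ≤ 4, Nat.card K = p ^ n :=
  (Nat.dvd_prime_pow Fact.out).1 (hG ▸ K.card_subgroup_dvd_card)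

theorem mul_card_le_of_lt (hG : Nat.card G = p ^ 4) {K L : Subgroup G} (h : K < L) :
    p * Nat.card K ≤ Nat.card L := by
  have hp := (Fact.out : p.Prime)
  have := finite_of_card hG
  obtain ⟨n, -, hn⟩ := exists_card_eq_pow hG K
  obtain ⟨m, -, hm⟩ := exists_card_eq_pow hG L
  have h1 : Nat.card K < Nat.card L := by
    refine lt_of_le_of_ne (Subgroup.card_le_of_le h.le) fun h2 => ?_
    exact h.ne (Subgroup.eq_of_le_of_card_ge h.le h2.ge)
  rw [hn, hm] at h1 ⊢
  rw [← pow_succ']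
  exact Nat.pow_le_pow_right hp.pos ((Nat.pow_lt_pow_iff_right hp.one_lt).1 h1)

theorem exists_notMem (hG : Nat.card G = p ^ 4) {K : Subgroup G} {n : ℕ} (hn : n < 4)
    (hK : Nat.card K = p ^ n) : ∃ x, x ∉ K := by
  by_contra! h
  have h1 : K = ⊤ := (Subgroup.eq_top_iff' K).2 h
  rw [h1, Subgroup.card_top, hG] at hK
  exact hn.ne' (Nat.pow_right_injective (Fact.out : p.Prime).two_le hK)

theorem eq_top_of_card_pow_three (hG : Nat.card G = p ^ 4) {K L : Subgroup G}
    (hK : Nat.card K = p ^ 3) (hKL : K ≤ L) {x : G} (hx : x ∈ L) (hxK : x ∉ K) : L = ⊤ := by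
  have := finite_of_card hG
  have h : K < L := lt_of_le_of_ne hKL (by rintro rfl; exact hxK hx)
  have h1 := mul_card_le_of_lt hG h
  rw [hK, ← pow_succ', ← hG] at h1
  exact Subgroup.eq_top_of_le_card L h1

/-- Four elements generate a group of order `p ^ 4` if they drop out one by one along a chain of
subgroups. -/
theorem eq_top_of_chain (hG : Nat.card G = p ^ 4) {L S₁ S₂ S₃ : Subgroup G} {a b c d : G}
    (ha : a ∈ L ⊓ S₃ ⊓ S₂ ⊓ S₁) (hb : b ∈ L ⊓ S₃ ⊓ S₂) (hc : c ∈ L ⊓ S₃) (hd : d ∈ L)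
    (ha1 : a ≠ 1) (hb1 : b ∉ S₁) (hc2 : c ∉ S₂) (hd3 : d ∉ S₃) : L = ⊤ := by
  have hp := (Fact.out : p.Prime)
  have := finite_of_card hG
  have key : ∀ {K S : Subgroup G} {x : G}, x ∈ K → x ∉ S → K ⊓ S < K := fun {K S x} h1 h2 =>
    lt_of_le_of_ne inf_le_left fun h => h2 (by
      have h3 : x ∈ K ⊓ S := by rw [h]; exact h1
      exact h3.2)
  have h4 := mul_card_le_of_lt hG (key hd hd3)
  have h3 := mul_card_le_of_lt hG (key hc hc2)
  have h2 := mul_card_le_of_lt hG (key hb hb1)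
  have h1 := mul_card_le_of_lt hG (K := ⊥) (L := L ⊓ S₃ ⊓ S₂ ⊓ S₁)
    (bot_lt_iff_ne_bot.2 fun h => ha1 (by rw [h] at ha; exact Subgroup.mem_bot.1 ha))
  rw [Subgroup.card_bot, mul_one] at h1
  apply Subgroup.eq_top_of_le_card
  rw [hG]
  calc p ^ 4 = p * (p * (p * p)) := by ring
    _ ≤ p * (p * (p * Nat.card ↥(L ⊓ S₃ ⊓ S₂ ⊓ S₁))) := by gcongr
    _ ≤ p * (p * Nat.card ↥(L ⊓ S₃ ⊓ S₂)) := by gcongr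
    _ ≤ p * Nat.card ↥(L ⊓ S₃) := by gcongr
    _ ≤ Nat.card L := h4

/-- The subgroup generated by a normal subgroup and one further element. -/
def adjoin (K : Subgroup G) [K.Normal] (y : G) : Subgroup G :=
  (Subgroup.zpowers (y : G ⧸ K)).comap (QuotientGroup.mk' K)

theorem le_adjoin (K : Subgroup G) [K.Normal] (y : G) : K ≤ adjoin K y := fun x hx => by
  have : (x : G ⧸ K) = 1 := (QuotientGroup.eq_one_iff x).2 hx
  simp [adjoin, this, one_mem]

theorem mem_adjoin_iff {K : Subgroup G} [K.Normal] {x y : G} :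
    x ∈ adjoin K y ↔ ∃ n : ℤ, ∃ k ∈ K, y ^ n * k = x := by
  simp only [adjoin, Subgroup.mem_comap, QuotientGroup.coe_mk', Subgroup.mem_zpowers_iff]
  refine exists_congr fun n => ?_
  rw [← QuotientGroup.mk_zpow, QuotientGroup.eq]
  constructor
  · exact fun h => ⟨_, h, by group⟩
  · rintro ⟨k, hk, rfl⟩
    simpa using hk

theorem adjoin_le {K L : Subgroup G} [K.Normal] {y : G} (h : K ≤ L) (hy : y ∈ L) :
    adjoin K y ≤ L := fun x hx => by
  obtain ⟨n, k, hk, rfl⟩ := mem_adjoin_iff.1 hx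
  exact mul_mem (zpow_mem hy n) (h hk)

theorem card_adjoin [Finite G] {K : Subgroup G} [K.Normal] {n : ℕ} (hK : Nat.card K = p ^ n)
    {y : G} (hy : y ∉ K) (hyp : y ^ p ∈ K) : Nat.card (adjoin K y) = p ^ (n + 1) := by
  have h1 : orderOf (y : G ⧸ K) = p := by
    apply orderOf_eq_prime
    · rw [← QuotientGroup.mk_pow, QuotientGroup.eq_one_iff]; exact hyp
    · rwa [Ne, QuotientGroup.eq_one_iff]
  have h2 := (adjoin K y).card_mul_index
  rw [adjoin, Subgroup.index_comap_of_surjective _ (QuotientGroup.mk'_surjective K)] at h2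
  have h3 := (Subgroup.zpowers (y : G ⧸ K)).card_mul_index
  rw [Nat.card_zpowers, h1] at h3
  have h4 := K.card_mul_index
  rw [Subgroup.index, ← h3, hK, ← h2] at h4
  have h5 : (Subgroup.zpowers (y : G ⧸ K)).index ≠ 0 := Subgroup.index_ne_zero_of_finite
  rw [pow_succ, adjoin]
  exact (Nat.eq_of_mul_eq_mul_right (Nat.pos_of_ne_zero h5) (by rw [← h4]; ring)).symm

/-- New generators whose exponents form an invertible matrix identify the group, if they satisfy
the relations of one of the fifteen presentations. -/
theorem nonempty_mulEquiv_of_matRel (hp : 3 < p) {w : ℕ} {k : Fin 15} (hG : Nat.card G = p ^ 4)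
    {D : PCData} (hD : D.Consistent) {g : Fin 4 → G} (h : D.Rel p g)
    (hg : Subgroup.closure (Set.range g) = ⊤) (M : Matrix (Fin 4) (Fin 4) (ZMod p))
    (hM : MatRel (pcData w k) D M) (hdet : M.det ≠ 0) : Nonempty (G ≃* Rep p w k) := by
  have := finite_of_card hG
  have hb : Function.Bijective (normalForm (p := p) g) :=
    (Nat.bijective_iff_surjective_and_card _).2
      ⟨h.normalForm_surjective hD (coprime_two hp) hg, by simp [hG]⟩
  refine nonempty_mulEquiv_rep hp hG ((h.rel_normalForm_iff hD hp hb.1 w k M).2 hM) ?_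
  by_contra hne
  obtain ⟨χ, h1, h2⟩ := exists_character hG hne
  have h3 : M.mulVec (fun i => (χ (g i)).toAdd) = 0 := by
    ext i
    change M i ⬝ᵥ _ = 0
    rw [← character_normalForm, h1 _ (Subgroup.subset_closure ⟨i, rfl⟩), toAdd_one]
  have h4 := Matrix.eq_zero_of_mulVec_eq_zero hdet h3
  refine h2 (MonoidHom.eq_of_eqOn_dense hg ?_)
  rintro _ ⟨i, rfl⟩
  exact congrFun h4 i

end

/-! ### Commutative groups of order `p ^ 4` -/

section

variable {p : ℕ} [Fact p.Prime]

/-- If the `p`-th power of `y` is a power of `x` and the order of `y` does not exceed that of `x`,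
then `y` can be corrected by a power of `x` to have trivial `p`-th power. -/
theorem exists_mul_zpow_pow_eq_one {G : Type*} [Group G] {x y : G} {m : ℕ}
    (hmul : ∀ n : ℤ, (y * x ^ n) ^ p = y ^ p * (x ^ n) ^ p) (hx : orderOf x = p ^ (m + 1))
    (hy : y ^ p ∈ Subgroup.zpowers x) (hym : y ^ p ^ (m + 1) = 1) :
    ∃ n : ℤ, (y * x ^ n) ^ p = 1 := by
  have hp := (Fact.out : p.Prime)
  obtain ⟨k, hk⟩ := Subgroup.mem_zpowers_iff.1 hy
  have h1 : x ^ (k * (p ^ m : ℕ)) = 1 := by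
    rw [zpow_mul, hk, zpow_natCast, ← pow_mul, ← pow_succ', hym]
  rw [← orderOf_dvd_iff_zpow_eq_one, hx, pow_succ', Nat.cast_mul] at h1
  have h2 : (p : ℤ) ∣ k :=
    Int.dvd_of_mul_dvd_mul_right (by exact_mod_cast pow_ne_zero m hp.ne_zero) h1
  obtain ⟨j, rfl⟩ := h2
  refine ⟨-j, ?_⟩
  rw [hmul, ← hk, ← zpow_natCast (x ^ (-j)), ← zpow_mul, ← zpow_add]
  convert zpow_zero x using 2
  ring

theorem mem_closure_range {G : Type*} [Group G] (g : Fin 4 → G) (i : Fin 4) :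
    g i ∈ Subgroup.closure (Set.range g) :=
  Subgroup.subset_closure ⟨i, rfl⟩

section

variable {w : ℕ} {G : Type*} [CommGroup G]

theorem exists_rep_of_exponent_four (hp : 3 < p) (hG : Nat.card G = p ^ 4) {x : G}
    (hx : x ^ p ^ 3 ≠ 1) : Nonempty (G ≃* Rep p w 0) := by
  have hp' := (Fact.out : p.Prime)
  have := finite_of_card hG
  have h4 : x ^ p ^ 4 = 1 := hG ▸ pow_card_eq_one'
  refine nonempty_mulEquiv_rep hp hG (g := ![x, x ^ p, x ^ p ^ 2, x ^ p ^ 3]) ?_ ?_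
  · apply PCData.rel_of_comm <;> simp [pcData, ← pow_mul, ← pow_succ, ← pow_two, h4]
  · apply Subgroup.eq_top_of_le_card
    rw [hG, ← orderOf_eq_prime_pow hx h4, ← Nat.card_zpowers]
    apply Subgroup.card_le_of_le
    rw [Subgroup.zpowers_le]
    exact mem_closure_range ![x, x ^ p, x ^ p ^ 2, x ^ p ^ 3] 0

theorem exists_rep_of_exponent_three (hp : 3 < p) (hG : Nat.card G = p ^ 4)
    (hexp : ∀ y : G, y ^ p ^ 3 = 1) {x : G} (hx : x ^ p ^ 2 ≠ 1) : Nonempty (G ≃* Rep p w 4) := by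
  have := finite_of_card hG
  have hox : orderOf x = p ^ 3 := orderOf_eq_prime_pow hx (hexp x)
  have hK : Nat.card (Subgroup.zpowers x) = p ^ 3 := by rw [Nat.card_zpowers, hox]
  obtain ⟨y, hy⟩ := exists_notMem hG (by norm_num) hK
  have hyp : y ^ p ∈ Subgroup.zpowers x := by
    have := (Subgroup.zpowers x).pow_index_mem y
    rwa [index_eq_of_card hG hK] at this
  obtain ⟨n, hn⟩ := exists_mul_zpow_pow_eq_one (fun _ => mul_pow _ _ _) hox hyp (hexp y)
  have hy' : y * x ^ n ∉ Subgroup.zpowers x := by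
    rwa [Subgroup.mul_mem_cancel_right _ (zpow_mem (Subgroup.mem_zpowers x) n)]
  generalize y * x ^ n = y' at hn hy'
  have hi := mem_closure_range ![x, y', x ^ p, x ^ p ^ 2]
  refine nonempty_mulEquiv_rep hp hG (g := ![x, y', x ^ p, x ^ p ^ 2]) ?_
    (eq_top_of_card_pow_three hG hK (Subgroup.zpowers_le.2 (hi 0)) (hi 1) hy')
  apply PCData.rel_of_comm <;> simp [pcData, ← pow_mul, ← pow_succ, ← pow_two, hn, hexp]

theorem exists_rep_of_exponent_two (hp : 3 < p) (hG : Nat.card G = p ^ 4)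
    (hexp : ∀ y : G, y ^ p ^ 2 = 1) {x : G} (hx : x ^ p ≠ 1) :
    Nonempty (G ≃* Rep p w 1) ∨ Nonempty (G ≃* Rep p w 10) := by
  have := finite_of_card hG
  by_cases h : ∃ y : G, y ^ p ∉ Subgroup.zpowers (x ^ p)
  · left
    obtain ⟨y, hy⟩ := h
    have hi := mem_closure_range ![x, y, x ^ p, y ^ p]
    refine nonempty_mulEquiv_rep hp hG (g := ![x, y, x ^ p, y ^ p]) ?_
      (eq_top_of_chain hG (S₁ := Subgroup.zpowers (x ^ p)) (S₂ := (powMonoidHom p).ker)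
        (S₃ := (Subgroup.zpowers (x ^ p)).comap (powMonoidHom p))
        (a := x ^ p) (b := y ^ p) (c := x) (d := y)
        ⟨⟨⟨hi 2, ?_⟩, ?_⟩, Subgroup.mem_zpowers _⟩ ⟨⟨hi 3, ?_⟩, ?_⟩ ⟨hi 0, ?_⟩ (hi 1) hx hy ?_ ?_)
    · apply PCData.rel_of_comm <;> simp [pcData, ← pow_mul, ← pow_two, hexp]
    all_goals simp [← pow_mul, ← pow_two, MonoidHom.mem_ker, one_mem, *]
  · right
    push Not at h
    have hox : orderOf x = p ^ 2 := orderOf_eq_prime_pow (by simpa using hx) (hexp x)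
    have hK : Nat.card (Subgroup.zpowers x) = p ^ 2 := by rw [Nat.card_zpowers, hox]
    have hmem (y : G) : y ^ p ∈ Subgroup.zpowers x :=
      Subgroup.zpowers_le.2 (pow_mem (Subgroup.mem_zpowers x) p) (h y)
    obtain ⟨y, hy⟩ := exists_notMem hG (by norm_num) hK
    obtain ⟨n, hn⟩ := exists_mul_zpow_pow_eq_one (fun _ => mul_pow _ _ _) hox (hmem y) (hexp y)
    have hy' : y * x ^ n ∉ Subgroup.zpowers x := by
      rwa [Subgroup.mul_mem_cancel_right _ (zpow_mem (Subgroup.mem_zpowers x) n)]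
    generalize y * x ^ n = y' at hn hy'
    have hK3 := card_adjoin hK hy' (hn ▸ one_mem _)
    obtain ⟨t, ht⟩ := exists_notMem hG (by norm_num) hK3
    obtain ⟨m, hm⟩ := exists_mul_zpow_pow_eq_one (fun _ => mul_pow _ _ _) hox (hmem t) (hexp t)
    have ht' : t * x ^ m ∉ adjoin (Subgroup.zpowers x) y' := by
      rwa [Subgroup.mul_mem_cancel_right _ (le_adjoin _ _ (zpow_mem (Subgroup.mem_zpowers x) m))]
    generalize t * x ^ m = t' at hm ht'
    have hi := mem_closure_range ![x, y', t', x ^ p]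
    refine nonempty_mulEquiv_rep hp hG (g := ![x, y', t', x ^ p]) ?_
      (eq_top_of_card_pow_three hG hK3 (adjoin_le (Subgroup.zpowers_le.2 (hi 0)) (hi 1)) (hi 2)
        ht')
    apply PCData.rel_of_comm <;> simp [pcData, ← pow_mul, ← pow_two, hn, hm, hexp]

theorem exists_rep_of_exponent_one (hp : 3 < p) (hG : Nat.card G = p ^ 4)
    (hexp : ∀ y : G, y ^ p = 1) : Nonempty (G ≃* Rep p w 14) := by
  have := finite_of_card hG
  obtain ⟨a, ha⟩ := exists_notMem hG (K := ⊥) (n := 0) (by norm_num) (by simp)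
  have hK1 : Nat.card (adjoin ⊥ a) = p ^ 1 := card_adjoin (by simp) ha (hexp a ▸ one_mem _)
  obtain ⟨b, hb⟩ := exists_notMem hG (by norm_num) hK1
  have hK2 := card_adjoin hK1 hb (hexp b ▸ one_mem _)
  obtain ⟨c, hc⟩ := exists_notMem hG (by norm_num) hK2
  have hK3 := card_adjoin hK2 hc (hexp c ▸ one_mem _)
  obtain ⟨d, hd⟩ := exists_notMem hG (by norm_num) hK3
  have hi := mem_closure_range ![a, b, c, d]
  refine nonempty_mulEquiv_rep hp hG (g := ![a, b, c, d]) ?_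
    (eq_top_of_card_pow_three hG hK3
      (adjoin_le (adjoin_le (adjoin_le bot_le (hi 0)) (hi 1)) (hi 2)) (hi 3) hd)
  apply PCData.rel_of_comm <;> simp [pcData, hexp]

/-- The commutative groups are told apart by their exponent, and those of exponent `p ^ 2` by
the image of the `p`-th power map. -/
theorem exists_rep_of_comm (hp : 3 < p) (hG : Nat.card G = p ^ 4) :
    ∃ k, Nonempty (G ≃* Rep p w k) := by
  by_cases h3 : ∃ x : G, x ^ p ^ 3 ≠ 1
  · exact ⟨0, exists_rep_of_exponent_four hp hG h3.choose_spec⟩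
  by_cases h2 : ∃ x : G, x ^ p ^ 2 ≠ 1
  · exact ⟨4, exists_rep_of_exponent_three hp hG (by simpa using h3) h2.choose_spec⟩
  by_cases h1 : ∃ x : G, x ^ p ≠ 1
  · exact (exists_rep_of_exponent_two hp hG (by simpa using h2) h1.choose_spec).elim
      (fun h => ⟨1, h⟩) fun h => ⟨10, h⟩
  · exact ⟨14, exists_rep_of_exponent_one hp hG (by simpa using h1)⟩

end

end

/-! ### Groups of order `p ^ 4` whose centre has order `p ^ 2` -/

section

variable {p : ℕ} {G : Type*} [Group G]

theorem pow_mul_of_mul_eq {x y z : G} (h : y * x = x * y * z) (hz : z ∈ Subgroup.center G)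
    (n : ℕ) : y ^ n * x = x * y ^ n * z ^ n := by
  induction n with
  | zero => simp
  | succ n ih =>
    have hc := Subgroup.mem_center_iff.1 (pow_mem hz n)
    rw [pow_succ', mul_assoc, ih, ← mul_assoc, ← mul_assoc, h, pow_succ' z,
      mul_assoc (x * y), ← Subgroup.mem_center_iff.1 hz]
    group

/-- The collection formula for two elements with a central commutator. -/
theorem mul_pow_of_mul_eq {x y z : G} (h : y * x = x * y * z) (hz : z ∈ Subgroup.center G)
    (n : ℕ) : (x * y) ^ n = x ^ n * y ^ n * z ^ n.choose 2 := by
  induction n with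
  | zero => simp
  | succ n ih =>
    have hc (m : ℕ) (u : G) : u * z ^ m = z ^ m * u := Subgroup.mem_center_iff.1 (pow_mem hz m) u
    have h2 : (n + 1).choose 2 = n + n.choose 2 := by simp [Nat.choose_succ_succ']
    calc (x * y) ^ (n + 1) = x ^ n * (y ^ n * x) * y * z ^ n.choose 2 := by
          rw [pow_succ, ih, mul_assoc _ (z ^ _), ← hc]; group
      _ = x ^ (n + 1) * y ^ n * (z ^ n * y) * z ^ n.choose 2 := by
          rw [pow_mul_of_mul_eq h hz, pow_succ]; group
      _ = _ := by rw [← hc, h2, pow_add, pow_succ y]; group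

/-- A central commutator `z = [y, x]` has trivial `p`-th power if `y ^ p` is central. -/
theorem pow_eq_one_of_mul_eq {x y z : G} (h : y * x = x * y * z) (hz : z ∈ Subgroup.center G)
    (hy : y ^ p ∈ Subgroup.center G) : z ^ p = 1 := by
  have h1 := pow_mul_of_mul_eq h hz p
  rw [← Subgroup.mem_center_iff.1 hy x] at h1
  simpa using h1

variable [Fact p.Prime]

omit [Fact p.Prime] in
theorem pow_eq_one_of_mem_zpowers {u z : G} (hu : u ^ p = 1) (h : z ∈ Subgroup.zpowers u) :
    z ^ p = 1 := by
  obtain ⟨k, rfl⟩ := Subgroup.mem_zpowers_iff.1 h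
  rw [← zpow_natCast, zpow_comm, zpow_natCast, hu, one_zpow]

omit [Fact p.Prime] in
theorem comm_mul_eq_of_commute {x y k : G} (hk : Commute k x)
    (hz : comm y x ∈ Subgroup.center G) : comm (y * k) x = comm y x := by
  have h1 := Subgroup.mem_center_iff.1 hz k
  calc comm (y * k) x = k⁻¹ * (y⁻¹ * x⁻¹ * y) * (k * x) := by unfold comm; group
    _ = k⁻¹ * (comm y x * k) := by rw [hk.eq]; unfold comm; group
    _ = comm y x := by rw [← h1]; group

theorem dvd_choose_two (hp : 3 < p) : p ∣ p.choose 2 :=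
  (Fact.out : p.Prime).dvd_choose_self (by norm_num) (by lia)

theorem exists_pow_eq_of_mem_zpowers [Finite G] {u z : G} (hu : u ^ p = 1) (hz : z ≠ 1)
    (h : z ∈ Subgroup.zpowers u) : ∃ e : ℕ, z ^ e = u := by
  have h1 : u ≠ 1 := by rintro rfl; simp at h; exact hz h
  have h2 : z ^ p = 1 := pow_eq_one_of_mem_zpowers hu h
  have h3 : Subgroup.zpowers z = Subgroup.zpowers u :=
    Subgroup.eq_of_le_of_card_ge (Subgroup.zpowers_le.2 h)
      (by rw [Nat.card_zpowers, Nat.card_zpowers, orderOf_eq_prime hu h1, orderOf_eq_prime h2 hz])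
  have h4 : u ∈ Subgroup.zpowers z := h3 ▸ Subgroup.mem_zpowers u
  exact (mem_powers_iff_mem_zpowers (x := z)).2 h4

theorem mem_zpowers_pow {c z : G} (hc : orderOf c = p ^ 2) (h : z ∈ Subgroup.zpowers c)
    (hz : z ^ p = 1) : z ∈ Subgroup.zpowers (c ^ p) := by
  obtain ⟨k, rfl⟩ := Subgroup.mem_zpowers_iff.1 h
  rw [← zpow_natCast, ← zpow_mul, ← orderOf_dvd_iff_zpow_eq_one, hc, pow_two, Nat.cast_mul] at hz
  obtain ⟨j, rfl⟩ := Int.dvd_of_mul_dvd_mul_right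
    (by exact_mod_cast (Fact.out : p.Prime).ne_zero) hz
  exact ⟨j, by simp [zpow_mul]⟩

theorem exists_pow_of_mem_zpowers [Finite G] {z u : G} (h : u ∈ Subgroup.zpowers z) :
    ∃ n : ℕ, u = z ^ n := by
  obtain ⟨n, hn⟩ := (mem_powers_iff_mem_zpowers (x := z)).2 h
  exact ⟨n, hn.symm⟩

theorem not_isCyclic_quotient_center (hnc : ∃ x y : G, y * x ≠ x * y) :
    ¬ IsCyclic (G ⧸ Subgroup.center G) := fun h => by
  obtain ⟨x, y, hxy⟩ := hnc
  exact hxy (((QuotientGroup.mk' (Subgroup.center G)).isMulCommutative_of_isCyclic_of_ker_le_center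
    (by simp)).is_comm.comm y x)

theorem card_center_of_noncomm (hG : Nat.card G = p ^ 4) (hnc : ∃ x y : G, y * x ≠ x * y) :
    Nat.card (Subgroup.center G) = p ∨ Nat.card (Subgroup.center G) = p ^ 2 := by
  have hp := (Fact.out : p.Prime)
  have := finite_of_card hG
  have : Nontrivial G := by
    obtain ⟨x, y, h⟩ := hnc
    exact ⟨x, y, by rintro rfl; exact h rfl⟩
  have h1 := (IsPGroup.of_card hG).center_nontrivial
  obtain ⟨n, hn, h⟩ := exists_card_eq_pow hG (Subgroup.center G)
  have h2 := not_isCyclic_quotient_center hnc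
  interval_cases n
  · exact absurd (Subgroup.card_eq_one.1 (by simpa using h)) ((Subgroup.nontrivial_iff_ne_bot _).1 h1)
  · exact Or.inl (by simpa using h)
  · exact Or.inr h
  · exact absurd (isCyclic_of_prime_card (p := p) (index_eq_of_card hG h)) h2
  · refine absurd ?_ h2
    have h3 : Subgroup.center G = ⊤ := Subgroup.eq_top_of_card_eq _ (by rw [h, hG])
    obtain ⟨x, y, hxy⟩ := hnc
    exact absurd ((Subgroup.mem_center_iff.1 (h3 ▸ Subgroup.mem_top x : x ∈ Subgroup.center G)) y)
      hxy

section

variable (hG : Nat.card G = p ^ 4) (hnc : ∃ x y : G, y * x ≠ x * y)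
  (hZ : Nat.card (Subgroup.center G) = p ^ 2)

include hG hZ

theorem card_quotient_center : Nat.card (G ⧸ Subgroup.center G) = p ^ 2 := by
  have h := (Subgroup.center G).card_mul_index
  rw [hZ, hG, Subgroup.index] at h
  exact Nat.eq_of_mul_eq_mul_left (pow_pos (Fact.out : p.Prime).pos 2) (by rw [h]; ring)

theorem comm_mem_center (a b : G) : comm a b ∈ Subgroup.center G := by
  have h := IsPGroup.isMulCommutative_of_card_eq_prime_sq (card_quotient_center hG hZ)
  rw [← QuotientGroup.eq_one_iff]
  have h2 := h.is_comm.comm (a : G ⧸ Subgroup.center G) b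
  simp only [comm, QuotientGroup.mk_mul, QuotientGroup.mk_inv]
  rw [mul_assoc, h2]
  group

include hnc

theorem pow_mem_center (a : G) : a ^ p ∈ Subgroup.center G := by
  have := finite_of_card hG
  have hc := card_quotient_center hG hZ
  by_contra h
  refine not_isCyclic_quotient_center hnc (isCyclic_of_orderOf_eq_card (a : G ⧸ Subgroup.center G)
    ((orderOf_eq_prime_pow (n := 1) ?_ ?_).trans hc.symm))
  · rwa [pow_one, ← QuotientGroup.mk_pow, QuotientGroup.eq_one_iff]
  · rw [← hc]; exact pow_card_eq_one'

theorem comm_pow_eq_one (a b : G) : comm a b ^ p = 1 :=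
  pow_eq_one_of_mul_eq (comm_eq_iff.1 rfl) (comm_mem_center hG hZ a b)
    (pow_mem_center hG hnc hZ a)

/-- If the centre has order `p ^ 2`, then the `p`-th power map is a homomorphism. -/
theorem mul_pow_prime (hp : 3 < p) (a b : G) : (a * b) ^ p = a ^ p * b ^ p := by
  rw [mul_pow_of_mul_eq (comm_eq_iff.1 rfl) (comm_mem_center hG hZ b a)]
  obtain ⟨m, hm⟩ := dvd_choose_two hp
  rw [hm, pow_mul, comm_pow_eq_one hG hnc hZ, one_pow, mul_one]

end

/-- Two elements that do not commute, together with two independent central elements, generate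
the group. -/
theorem eq_top_of_central_chain (hG : Nat.card G = p ^ 4) {L : Subgroup G} {x y b a : G}
    (hx : x ∈ L) (hy : y ∈ L) (hb : b ∈ L) (ha : a ∈ L) (hxy : y * x ≠ x * y)
    (hbZ : b ∈ Subgroup.center G) (haZ : a ∈ Subgroup.center G) (ha1 : a ≠ 1)
    (hba : b ∉ Subgroup.zpowers a) : L = ⊤ := by
  refine eq_top_of_chain hG (S₁ := Subgroup.zpowers a) (S₂ := Subgroup.center G)
    (S₃ := Subgroup.centralizer {x}) (a := a) (b := b) (c := x) (d := y)
    ⟨⟨⟨ha, ?_⟩, haZ⟩, Subgroup.mem_zpowers a⟩ ⟨⟨hb, ?_⟩, hbZ⟩ ⟨hx, ?_⟩ hy ha1 hba ?_ ?_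
  · exact Subgroup.center_le_centralizer _ haZ
  · exact Subgroup.center_le_centralizer _ hbZ
  · simp [Subgroup.mem_centralizer_singleton_iff]
  · exact fun h => hxy (Subgroup.mem_center_iff.1 h y)
  · exact fun h => hxy (Subgroup.mem_centralizer_singleton_iff.1 h)


omit [Fact p.Prime] in
/-- If the last two generators are central, only one commutator has to be checked. -/
theorem PCData.rel_of_central {D : PCData} {x y b a : G} (he : D.e₄ = 0)
    (hb : b ∈ Subgroup.center G) (ha : a ∈ Subgroup.center G)
    (h0 : x ^ p = y ^ D.a₂ * b ^ D.a₃ * a ^ D.a₄) (h1 : y ^ p = b ^ D.b₃ * a ^ D.b₄)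
    (h2 : b ^ p = a ^ D.c₄) (h3 : a ^ p = 1) (h10 : comm y x = b ^ D.d₃ * a ^ D.d₄) :
    D.Rel p ![x, y, b, a] := by
  have hb' (u : G) : comm b u = 1 := comm_eq_one_iff.2 (Subgroup.mem_center_iff.1 hb u).symm
  have ha' (u : G) : comm a u = 1 := comm_eq_one_iff.2 (Subgroup.mem_center_iff.1 ha u).symm
  constructor <;> simp [*]

section

variable {w : ℕ} (hp : 3 < p) (hG : Nat.card G = p ^ 4)
  (hZ : Nat.card (Subgroup.center G) = p ^ 2)

include hp hG hZ

/-- Here `x ^ p` generates the centre. A second generator is corrected by a power of `x` to have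
trivial `p`-th power, and then replaced by a power of itself to normalize the commutator. -/
theorem exists_rep_of_cyclic_center_of_pow_ne_one (hnc : ∃ x y : G, y * x ≠ x * y) {x : G}
    (hx : x ^ p ^ 2 ≠ 1) : Nonempty (G ≃* Rep p w 5) := by
  have := finite_of_card hG
  have hxp := pow_mem_center hG hnc hZ x
  have hcen {c : G} (hc : c ∈ Subgroup.center G) : c ^ p ^ 2 = 1 := by
    have h := pow_card_eq_one' (x := (⟨c, hc⟩ : Subgroup.center G))
    rw [hZ] at h
    exact congrArg Subtype.val h
  have h3 (u : G) : u ^ p ^ 3 = 1 := by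
    rw [pow_succ', pow_mul]; exact hcen (pow_mem_center hG hnc hZ u)
  have hox : orderOf x = p ^ 3 := orderOf_eq_prime_pow hx (h3 x)
  have hoc : orderOf (x ^ p) = p ^ 2 := orderOf_eq_prime_pow
    (by rwa [pow_one, ← pow_mul, ← pow_two]) (hcen hxp)
  have hZx : Subgroup.zpowers (x ^ p) = Subgroup.center G :=
    Subgroup.eq_of_le_of_card_ge (Subgroup.zpowers_le.2 hxp) (by rw [hZ, Nat.card_zpowers, hoc])
  have hxZ : x ∉ Subgroup.center G := fun h => hx (hcen h)
  obtain ⟨y, hy⟩ : ∃ y, y * x ≠ x * y := by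
    by_contra! h
    exact hxZ (Subgroup.mem_center_iff.2 h)
  obtain ⟨n, hn⟩ := exists_mul_zpow_pow_eq_one (y := y)
    (fun _ => mul_pow_prime hG hnc hZ hp _ _) hox
    (Subgroup.zpowers_le.2 (pow_mem (Subgroup.mem_zpowers x) p)
      (hZx ▸ pow_mem_center hG hnc hZ y)) (h3 y)
  have hy' : y * x ^ n * x ≠ x * (y * x ^ n) := fun h => hy <| by
    rw [mul_assoc, ← zpow_add_one, add_comm, zpow_add, zpow_one, ← mul_assoc, ← mul_assoc] at h
    exact mul_right_cancel h
  generalize y * x ^ n = y' at hn hy'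
  have hz : comm y' x ≠ 1 := fun h => hy' (comm_eq_one_iff.1 h)
  have hzZ := comm_mem_center hG hZ y' x
  have hzp := comm_pow_eq_one hG hnc hZ y' x
  obtain ⟨e, he⟩ := exists_pow_eq_of_mem_zpowers (u := (x ^ p) ^ p)
    (by rw [← pow_mul, ← pow_two]; exact hcen hxp) hz (mem_zpowers_pow hoc (hZx ▸ hzZ) hzp)
  have hu : ((x ^ p) ^ p) ^ p = 1 := by rw [← pow_mul, ← pow_two]; exact hcen hxp
  have hu1 : (x ^ p) ^ p ≠ 1 := by rwa [← pow_mul, ← pow_two]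
  have hc : comm (y' ^ e) x = (x ^ p) ^ p := by
    rw [comm_eq_iff, pow_mul_of_mul_eq (comm_eq_iff.1 rfl) hzZ, he]
  have hi := mem_closure_range ![x, y' ^ e, x ^ p, (x ^ p) ^ p]
  refine nonempty_mulEquiv_rep hp hG (g := ![x, y' ^ e, x ^ p, (x ^ p) ^ p])
    (PCData.rel_of_central rfl hxp (pow_mem hxp p) ?_ ?_ ?_ hu ?_)
    (eq_top_of_central_chain hG (hi 0) (hi 1) (hi 2) (hi 3) (fun h => hu1 ?_) hxp (pow_mem hxp p)
      hu1 fun h => hu1 ?_)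
  · simp [pcData]
  · simp [pcData, ← pow_mul, mul_comm e, pow_mul y', hn]
  · simp [pcData]
  · simp [pcData, hc]
  · rw [← hc, comm_eq_one_iff]; exact h
  · exact pow_eq_one_of_mem_zpowers hu h

/-- Two generators that do not commute are corrected by powers of the central element `c` to have
trivial `p`-th powers; the commutator is a power of `c ^ p`. -/
theorem exists_rep_of_cyclic_center_of_pow_eq_one (hnc : ∃ x y : G, y * x ≠ x * y) {c : G}
    (hc : c ∈ Subgroup.center G) (hcp : c ^ p ≠ 1) (hexp : ∀ x : G, x ^ p ^ 2 = 1) :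
    Nonempty (G ≃* Rep p w 13) := by
  have := finite_of_card hG
  have hoc : orderOf c = p ^ 2 := orderOf_eq_prime_pow (by simpa using hcp) (hexp c)
  have hZc : Subgroup.zpowers c = Subgroup.center G :=
    Subgroup.eq_of_le_of_card_ge (Subgroup.zpowers_le.2 hc) (by rw [hZ, Nat.card_zpowers, hoc])
  have key (u : G) : ∃ n : ℤ, (u * c ^ n) ^ p = 1 :=
    exists_mul_zpow_pow_eq_one (fun _ => mul_pow_prime hG hnc hZ hp _ _) hoc
      (hZc ▸ pow_mem_center hG hnc hZ u) (hexp u)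
  obtain ⟨x, y, hxy⟩ := hnc
  obtain ⟨m, hm⟩ := key x
  obtain ⟨n, hn⟩ := key y
  have hy' : y * c ^ n * (x * c ^ m) ≠ x * c ^ m * (y * c ^ n) := fun h => hxy <| by
    have hcm (k : ℤ) (u : G) : Commute u (c ^ k) := Subgroup.mem_center_iff.1 (zpow_mem hc k) u
    have h1 : Commute (y * c ^ n) (x * c ^ m) := h
    simpa [mul_assoc] using ((h1.mul_left (hcm (-n) _).symm).mul_right (hcm (-m) _)).eq
  generalize x * c ^ m = x' at hm hy'
  generalize y * c ^ n = y' at hn hy'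
  have hz : comm y' x' ≠ 1 := fun h => hy' (comm_eq_one_iff.1 h)
  have hzZ := comm_mem_center hG hZ y' x'
  have hzp := comm_pow_eq_one hG ⟨x, y, hxy⟩ hZ y' x'
  have hu : (c ^ p) ^ p = 1 := by rw [← pow_mul, ← pow_two, hexp]
  obtain ⟨e, he⟩ := exists_pow_eq_of_mem_zpowers hu hz (mem_zpowers_pow hoc (hZc ▸ hzZ) hzp)
  have hcc : comm (y' ^ e) x' = c ^ p := by
    rw [comm_eq_iff, pow_mul_of_mul_eq (comm_eq_iff.1 rfl) hzZ, he]
  have hi := mem_closure_range ![x', y' ^ e, c, c ^ p]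
  refine nonempty_mulEquiv_rep hp hG (g := ![x', y' ^ e, c, c ^ p])
    (PCData.rel_of_central rfl hc (pow_mem hc p) ?_ ?_ ?_ hu ?_)
    (eq_top_of_central_chain hG (hi 0) (hi 1) (hi 2) (hi 3) (fun h => hcp ?_) hc (pow_mem hc p)
      hcp fun h => hcp ?_)
  · simp [pcData, hm]
  · simp [pcData, ← pow_mul, mul_comm e, pow_mul y', hn]
  · simp [pcData]
  · simp [pcData, hcc]
  · rw [← hcc, comm_eq_one_iff]; exact h
  · exact pow_eq_one_of_mem_zpowers hu h

omit hp in
/-- If the centre is elementary of rank two, then two independent elements span it. -/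
theorem exists_zpow_mul_pow_of_mem_center (hexp : ∀ c ∈ Subgroup.center G, c ^ p = 1) {z c u : G}
    (hz : z ∈ Subgroup.center G) (hz1 : z ≠ 1) (hc : c ∈ Subgroup.center G)
    (hcz : c ∉ Subgroup.zpowers z) (hu : u ∈ Subgroup.center G) :
    ∃ (i : ℤ) (j : ℕ), u = c ^ i * z ^ j := by
  have := finite_of_card hG
  have hle : Subgroup.zpowers z ≤ Subgroup.center G := Subgroup.zpowers_le.2 hz
  have hN : (Subgroup.zpowers z).Normal := ⟨fun n hn g => by
    rwa [Subgroup.mem_center_iff.1 (hle hn) g, mul_inv_cancel_right]⟩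
  have h1 : Nat.card (Subgroup.zpowers z) = p ^ 1 := by
    rw [Nat.card_zpowers, orderOf_eq_prime (hexp z hz) hz1, pow_one]
  have h2 := card_adjoin h1 hcz (hexp c hc ▸ one_mem _)
  have h3 : adjoin (Subgroup.zpowers z) c = Subgroup.center G :=
    Subgroup.eq_of_le_of_card_ge (adjoin_le hle hc) (by rw [hZ, h2])
  obtain ⟨i, k, hk, rfl⟩ := mem_adjoin_iff.1 (h3 ▸ hu)
  obtain ⟨j, rfl⟩ := exists_pow_of_mem_zpowers hk
  exact ⟨i, j, rfl⟩

/-- The centre is spanned by `z = [y, x]` and `x ^ p`. After a correction of `y` by a power of `x`,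
the power `y ^ p` lies in the span of `z`, and it decides between the two groups. -/
theorem exists_rep_of_pow_notMem_zpowers_comm (hexp : ∀ c ∈ Subgroup.center G, c ^ p = 1)
    {x y : G} (hxy : y * x ≠ x * y) (hx : x ^ p ∉ Subgroup.zpowers (comm y x)) :
    Nonempty (G ≃* Rep p w 2) ∨ Nonempty (G ≃* Rep p w 3) := by
  have hnc : ∃ x y : G, y * x ≠ x * y := ⟨x, y, hxy⟩
  have hz : comm y x ≠ 1 := fun h => hxy (comm_eq_one_iff.1 h)
  have hzZ := comm_mem_center hG hZ y x
  have hxp := pow_mem_center hG hnc hZ x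
  obtain ⟨i, j, hij⟩ := exists_zpow_mul_pow_of_mem_center hG hZ hexp hzZ hz hxp hx
    (pow_mem_center hG hnc hZ y)
  have hy' : (y * x ^ (-i)) ^ p = comm y x ^ j := by
    rw [mul_pow_prime hG hnc hZ hp, hij, ← zpow_natCast (x ^ (-i)), ← zpow_mul, mul_comm (-i),
      zpow_mul, zpow_natCast, Subgroup.mem_center_iff.1 (pow_mem hzZ j), mul_assoc, zpow_neg,
      mul_inv_cancel, mul_one]
  have hc : comm (y * x ^ (-i)) x = comm y x :=
    comm_mul_eq_of_commute ((Commute.refl x).zpow_left _) hzZ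
  generalize y * x ^ (-i) = y' at hy' hc
  generalize comm y x = z at *
  have hy'x : y' * x ≠ x * y' := fun h => hz (hc.symm.trans (comm_eq_one_iff.2 h))
  by_cases hj : z ^ j = 1
  · left
    have hi := mem_closure_range ![x, y', z, x ^ p]
    refine nonempty_mulEquiv_rep hp hG (g := ![x, y', z, x ^ p])
      (PCData.rel_of_central rfl hzZ hxp ?_ ?_ ?_ (hexp _ hxp) ?_)
      (eq_top_of_central_chain hG (hi 0) (hi 1) (hi 3) (hi 2) hy'x hxp hzZ hz hx)
    all_goals simp [pcData, hy', hj, hexp z hzZ, hc]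
  · right
    have hj0 : (j : ZMod p) ≠ 0 := fun h => hj <| by
      obtain ⟨m, rfl⟩ := (ZMod.natCast_eq_zero_iff _ _).1 h
      rw [pow_mul, hexp z hzZ, one_pow]
    have hi := mem_closure_range ![x, y', x ^ p, z]
    -- the generators `x ^ j`, `y'`, `x ^ (p j)`, `z ^ j` make the commutator equal to `y' ^ p`
    refine nonempty_mulEquiv_of_matRel hp hG (g := ![x, y', x ^ p, z])
      (D := ⟨0, 1, 0, 0, j, 0, 0, 1, 0⟩) (by constructor <;> simp)
      (PCData.rel_of_central rfl hxp hzZ ?_ ?_ ?_ (hexp _ hzZ) ?_)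
      (eq_top_of_central_chain hG (hi 0) (hi 1) (hi 2) (hi 3) hy'x hxp hzZ hz hx)
      !![(j : ZMod p), 0, 0, 0; 0, 1, 0, 0; 0, 0, j, 0; 0, 0, 0, j] ?_ ?_
    · simp
    · simp [hy']
    · simp [hexp _ hxp]
    · simp [hc]
    · simp [MatRel, vec_eq_iff, powVec, commVec, pcData]
    · rw [det_block_two_two]; simp [hj0]

/-- All noncentral `p`-th powers are powers of the commutator `z`, so the span of `x` and `y` is
extraspecial of order `p ^ 3` and splits off a central factor; it decides whether the `p`-th
powers of `x` and `y` vanish. -/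
theorem exists_rep_of_pow_mem_zpowers_comm (hexp : ∀ c ∈ Subgroup.center G, c ^ p = 1)
    (hnc : ∃ x y : G, y * x ≠ x * y)
    (h : ∀ x y : G, y * x ≠ x * y → x ^ p ∈ Subgroup.zpowers (comm y x)) :
    Nonempty (G ≃* Rep p w 11) ∨ Nonempty (G ≃* Rep p w 12) := by
  have := finite_of_card hG
  obtain ⟨x, y, hxy⟩ := hnc
  have hz : comm y x ≠ 1 := fun h => hxy (comm_eq_one_iff.1 h)
  have hzZ := comm_mem_center hG hZ y x
  have hx := h x y hxy
  have hy : y ^ p ∈ Subgroup.zpowers (comm y x) := by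
    have h1 := h y x hxy.symm
    have h2 : comm x y = (comm y x)⁻¹ := by unfold comm; group
    rwa [h2, Subgroup.zpowers_inv] at h1
  have hc : comm y x = comm y x := rfl
  generalize hze : comm y x = z at *
  obtain ⟨a, ha⟩ := exists_pow_of_mem_zpowers hx
  obtain ⟨b, hb⟩ := exists_pow_of_mem_zpowers hy
  obtain ⟨c, hc, hcz⟩ : ∃ c ∈ Subgroup.center G, c ∉ Subgroup.zpowers z := by
    by_contra! hle
    have h1 := Subgroup.card_le_of_le (show Subgroup.center G ≤ Subgroup.zpowers z from hle)
    have hp' := (Fact.out : p.Prime)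
    rw [hZ, Nat.card_zpowers, orderOf_eq_prime (hexp z hzZ) hz] at h1
    nlinarith
  have hi := mem_closure_range ![x, y, c, z]
  have key := fun k : Fin 15 => nonempty_mulEquiv_of_matRel (w := w) (k := k) hp hG
    (g := ![x, y, c, z]) (D := ⟨0, 0, a, 0, b, 0, 0, 1, 0⟩) (by constructor <;> simp)
    (PCData.rel_of_central rfl hc hzZ (by simp [ha]) (by simp [hb]) (by simp [hexp _ hc])
      (hexp _ hzZ) (by simp [hze]))
    (eq_top_of_central_chain hG (hi 0) (hi 1) (hi 2) (hi 3) hxy hc hzZ hz hcz)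
  -- the new second generator `x ^ (-b) y ^ a` has trivial `p`-th power
  by_cases ha0 : (a : ZMod p) = 0
  · by_cases hb0 : (b : ZMod p) = 0
    · exact .inl (key 11 1 (by simp [MatRel, vec_eq_iff, powVec, commVec, pcData, ha0, hb0])
        (by simp))
    · refine .inr (key 12 !![0, 1, 0, 0; -(b : ZMod p), 0, 0, 0; 0, 0, 1, 0; 0, 0, 0, b] ?_ ?_)
      · simp [MatRel, vec_eq_iff, powVec, commVec, pcData, ha0]
      · rw [det_block_two_two]; simp [hb0]
  · refine .inr (key 12 !![1, 0, 0, 0; -(b : ZMod p), a, 0, 0; 0, 0, 1, 0; 0, 0, 0, a] ?_ ?_)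
    · simp [MatRel, vec_eq_iff, powVec, commVec, pcData]; try ring
    · rw [det_block_two_two]; simp [ha0]

/-- The groups with centre of order `p ^ 2` are told apart by the structure of the centre and by
the position of the `p`-th powers relative to the commutators. -/
theorem exists_rep_of_card_center (hnc : ∃ x y : G, y * x ≠ x * y) :
    ∃ k, Nonempty (G ≃* Rep p w k) := by
  by_cases hc : ∃ c ∈ Subgroup.center G, c ^ p ≠ 1
  · obtain ⟨c, hc, hcp⟩ := hc
    by_cases hx : ∃ x : G, x ^ p ^ 2 ≠ 1
    · obtain ⟨x, hx⟩ := hx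
      exact ⟨5, exists_rep_of_cyclic_center_of_pow_ne_one hp hG hZ hnc hx⟩
    · exact ⟨13, exists_rep_of_cyclic_center_of_pow_eq_one hp hG hZ hnc hc hcp (by simpa using hx)⟩
  · push Not at hc
    by_cases h : ∃ x y : G, y * x ≠ x * y ∧ x ^ p ∉ Subgroup.zpowers (comm y x)
    · obtain ⟨x, y, hxy, hx⟩ := h
      exact (exists_rep_of_pow_notMem_zpowers_comm hp hG hZ hc hxy hx).elim
        (fun h => ⟨2, h⟩) fun h => ⟨3, h⟩
    · push Not at h
      exact (exists_rep_of_pow_mem_zpowers_comm hp hG hZ hc hnc h).elim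
        (fun h => ⟨11, h⟩) fun h => ⟨12, h⟩

end

end

/-! ### Groups of order `p ^ 4` whose centre has order `p` -/

section

variable {p : ℕ} [Fact p.Prime] {G : Type*} [Group G]

theorem comm_mem_of_card_eq_sq (hG : Nat.card G = p ^ 4) {K : Subgroup G} [K.Normal]
    (hK : Nat.card K = p ^ 2) (a b : G) : comm a b ∈ K := by
  have h1 : Nat.card (G ⧸ K) = p ^ 2 := by
    have h := K.card_mul_index
    rw [hK, hG, Subgroup.index] at h
    exact Nat.eq_of_mul_eq_mul_left (pow_pos (Fact.out : p.Prime).pos 2) (by rw [h]; ring)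
  have h := IsPGroup.isMulCommutative_of_card_eq_prime_sq h1
  rw [← QuotientGroup.eq_one_iff]
  have h2 := h.is_comm.comm (a : G ⧸ K) b
  simp only [comm, QuotientGroup.mk_mul, QuotientGroup.mk_inv]
  rw [mul_assoc, h2]
  group

omit [Fact p.Prime] in
theorem comm_mul_right_of_comm_mem_center {n : G} (hn : ∀ g, comm n g ∈ Subgroup.center G)
    (g h : G) : comm n (g * h) = comm n g * comm n h := by
  have h1 := Subgroup.mem_center_iff.1 (hn g)
  calc comm n (g * h) = comm n h * (h⁻¹ * (comm n g * h)) := by unfold comm; group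
    _ = comm n g * comm n h := by rw [← h1 h, inv_mul_cancel_left, h1]

/-- If the centre `Z` has order `p`, some `n ∉ Z` is central modulo `Z`. It spans with `Z` a
normal subgroup `K` of order `p ^ 2`, and its centralizer `A ≥ K` has order `p ^ 3` and is
commutative. -/
theorem exists_chain_of_card_center (hG : Nat.card G = p ^ 4)
    (hZ : Nat.card (Subgroup.center G) = p) :
    ∃ K A : Subgroup G, K.Normal ∧ A.Normal ∧ Subgroup.center G ≤ K ∧ K ≤ A ∧
      Nat.card K = p ^ 2 ∧ Nat.card A = p ^ 3 ∧ (∀ a ∈ A, ∀ b ∈ A, a * b = b * a) ∧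
      (∀ k ∈ K, ∀ g, comm k g ∈ Subgroup.center G) := by
  have hp := (Fact.out : p.Prime)
  have := finite_of_card hG
  have hpow {c : G} (hc : c ∈ Subgroup.center G) : c ^ p = 1 := by
    have h := pow_card_eq_one' (x := (⟨c, hc⟩ : Subgroup.center G))
    rw [hZ] at h
    exact congrArg Subtype.val h
  have hZ1 : Nat.card (Subgroup.center G) = p ^ 1 := by rw [hZ, pow_one]
  have hnt : Nontrivial (G ⧸ Subgroup.center G) := by
    obtain ⟨x, hx⟩ := exists_notMem hG (by norm_num) hZ1
    exact ⟨(x : G ⧸ Subgroup.center G), 1, fun h => hx ((QuotientGroup.eq_one_iff x).1 h)⟩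
  have hc := ((IsPGroup.of_card hG).to_quotient (Subgroup.center G)).center_nontrivial
  obtain ⟨⟨q, hq⟩, hq1⟩ := exists_ne (1 : Subgroup.center (G ⧸ Subgroup.center G))
  obtain ⟨n, rfl⟩ := QuotientGroup.mk_surjective q
  have hnZ : n ∉ Subgroup.center G := fun h =>
    hq1 (Subtype.ext ((QuotientGroup.eq_one_iff n).2 h))
  have hcen {k : G} (hk : (k : G ⧸ Subgroup.center G) ∈ Subgroup.center (G ⧸ Subgroup.center G))
      (g : G) : comm k g ∈ Subgroup.center G := by
    rw [← QuotientGroup.eq_one_iff]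
    simp only [comm, QuotientGroup.mk_mul, QuotientGroup.mk_inv]
    rw [mul_assoc, ← Subgroup.mem_center_iff.1 hk]
    group
  have hn := hcen hq
  have hnp : n ^ p ∈ Subgroup.center G := by
    rw [Subgroup.mem_center_iff]
    intro g
    rw [pow_mul_of_mul_eq (comm_eq_iff.1 rfl) (hn g), hpow (hn g), mul_one]
  have hKc : ∀ k ∈ adjoin (Subgroup.center G) n,
      (k : G ⧸ Subgroup.center G) ∈ Subgroup.center (G ⧸ Subgroup.center G) := fun k hk =>
    Subgroup.zpowers_le.2 hq hk
  have hK := card_adjoin hZ1 hnZ hnp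
  have hKN : (adjoin (Subgroup.center G) n).Normal := ⟨fun k hk g => by
    have h1 := le_adjoin _ n (hcen (hKc k hk) g⁻¹)
    have h2 := mul_mem hk h1
    rwa [comm, ← mul_assoc, ← mul_assoc, mul_inv_cancel_left, inv_inv] at h2⟩
  -- the centralizer of `n` is the kernel of `g ↦ [n, g]`
  let φ : G →* Subgroup.center G :=
    { toFun g := ⟨comm n g, hn g⟩
      map_one' := by simp [comm]
      map_mul' g h := Subtype.ext (comm_mul_right_of_comm_mem_center hn g h) }
  have hφ : φ.ker = Subgroup.centralizer {n} := by
    ext g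
    rw [MonoidHom.mem_ker, Subgroup.mem_centralizer_singleton_iff, Subtype.ext_iff]
    exact comm_eq_one_iff.trans eq_comm
  have hA : Nat.card (Subgroup.centralizer {n}) = p ^ 3 := by
    rw [← hφ]
    obtain ⟨m, hm, hm'⟩ := exists_card_eq_pow hG φ.ker
    have h1 := φ.ker.card_mul_index
    rw [Subgroup.index_ker, hG, hm'] at h1
    have h2 : Nat.card φ.range ≤ p := hZ ▸ Subgroup.card_le_card_group _
    have h3 : 4 ≤ m + 1 := (Nat.pow_le_pow_iff_right hp.one_lt).1 <| by
      rw [← h1, pow_succ]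
      exact Nat.mul_le_mul_left _ h2
    obtain rfl | rfl : m = 3 ∨ m = 4 := by lia
    · exact hm'
    · have h3 : φ.ker = ⊤ := Subgroup.eq_top_of_card_eq _ (by rw [hm', hG])
      refine absurd (Subgroup.mem_center_iff.2 fun g => ?_) hnZ
      exact Subgroup.mem_centralizer_singleton_iff.1 (hφ ▸ h3 ▸ Subgroup.mem_top g)
  have hKA : adjoin (Subgroup.center G) n ≤ Subgroup.centralizer {n} :=
    adjoin_le (Subgroup.center_le_centralizer _)
      (Subgroup.mem_centralizer_singleton_iff.2 rfl)
  -- the centre of the centralizer contains `K`, which has index `p` in it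
  have hKA' : adjoin (Subgroup.center G) n ≤
      Subgroup.centralizer (Subgroup.centralizer {n} : Subgroup G) :=
    adjoin_le (Subgroup.center_le_centralizer _) (Subgroup.mem_centralizer_iff.2 fun h hh =>
      Subgroup.mem_centralizer_singleton_iff.1 hh)
  have hlt : adjoin (Subgroup.center G) n < Subgroup.centralizer {n} :=
    lt_of_le_of_ne hKA fun h => by
      rw [h, hA] at hK
      exact absurd (Nat.pow_right_injective hp.two_le hK) (by norm_num)
  obtain ⟨x, hxA, hxK⟩ := SetLike.exists_of_lt hlt
  have hAx : adjoin (adjoin (Subgroup.center G) n) x = Subgroup.centralizer {n} := by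
    refine Subgroup.eq_of_le_of_card_ge (adjoin_le hKA hxA) ?_
    have h1 := mul_card_le_of_lt hG (K := adjoin (Subgroup.center G) n)
      (L := adjoin (adjoin (Subgroup.center G) n) x) (lt_of_le_of_ne (le_adjoin _ _) fun h =>
        hxK (h ▸ mem_adjoin_iff.2 ⟨1, 1, one_mem _, by simp⟩))
    rwa [hK, ← pow_succ', ← hA] at h1
  have hxx : Subgroup.centralizer {n} ≤ Subgroup.centralizer {x} := by
    rw [← hAx]
    refine adjoin_le (fun k hk => ?_) (Subgroup.mem_centralizer_singleton_iff.2 rfl)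
    exact Subgroup.mem_centralizer_singleton_iff.2
      (Subgroup.mem_centralizer_iff.1 (hKA' hk) x hxA).symm
  have hAA : Subgroup.centralizer {n} ≤
      Subgroup.centralizer (Subgroup.centralizer {n} : Subgroup G) := by
    conv_lhs => rw [← hAx]
    exact adjoin_le hKA' (Subgroup.mem_centralizer_iff.2 fun h hh =>
      Subgroup.mem_centralizer_singleton_iff.1 (hxx hh))
  exact ⟨_, _, hKN, normal_of_card hG hA, le_adjoin _ _, hKA, hK, hA,
    fun a ha b hb => (Subgroup.mem_centralizer_iff.1 (hAA hb) a ha),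
    fun k hk => hcen (hKc k hk)⟩

omit [Fact p.Prime] in
/-- The collection formula for generators of a group of maximal class. -/
theorem mul_pow_of_maximal_class {x y c d : G} (h1 : y * x = x * y * c) (h2 : c * x = x * c * d)
    (hd : d ∈ Subgroup.center G) (n : ℕ) : y * x ^ n = x ^ n * y * c ^ n * d ^ n.choose 2 := by
  induction n with
  | zero => simp
  | succ n ih =>
    have hc (m : ℕ) (u : G) : u * d ^ m = d ^ m * u := Subgroup.mem_center_iff.1 (pow_mem hd m) u
    have h3 : (n + 1).choose 2 = n + n.choose 2 := by simp [Nat.choose_succ_succ']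
    calc y * x ^ (n + 1) = x ^ n * y * (c ^ n * x) * d ^ n.choose 2 := by
          rw [pow_succ, ← mul_assoc, ih, mul_assoc _ (d ^ _), ← hc]; group
      _ = x ^ n * (y * x) * c ^ n * d ^ n * d ^ n.choose 2 := by
          rw [pow_mul_of_mul_eq h2 hd]; group
      _ = _ := by rw [h1, h3, pow_add, pow_succ, pow_succ']; group

/-- Let `K ≤ A` be as in `exists_chain_of_card_center`. For `x ∉ A` and `y ∈ A` outside `K`, the
elements `x`, `y`, `c = [y, x]`, `d = [c, x]` generate the group, and `x ^ p` and `y ^ p` are powers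
of `d`. -/
theorem exists_rep_of_card_center_eq_prime {w : ℕ} (hp : 3 < p) (hG : Nat.card G = p ^ 4)
    (hZ : Nat.card (Subgroup.center G) = p)
    (hw : ∀ b : ZMod p, b ≠ 0 → ∃ u, b = u ^ 2 ∨ b = w * u ^ 2) :
    ∃ k, Nonempty (G ≃* Rep p w k) := by
  have hp' := (Fact.out : p.Prime)
  have := finite_of_card hG
  obtain ⟨K, A, hKN, hAN, hZK, hKA, hK, hA, hcomm, hcen⟩ := exists_chain_of_card_center hG hZ
  have hZ1 : Nat.card (Subgroup.center G) = p ^ 1 := by rw [hZ, pow_one]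
  have hpow {c : G} (hc : c ∈ Subgroup.center G) : c ^ p = 1 := by
    have h := pow_card_eq_one' (x := (⟨c, hc⟩ : Subgroup.center G))
    rw [hZ] at h
    exact congrArg Subtype.val h
  have hZgen {c : G} (hc : c ∈ Subgroup.center G) (hc1 : c ≠ 1) :
      Subgroup.zpowers c = Subgroup.center G :=
    Subgroup.eq_of_le_of_card_ge (Subgroup.zpowers_le.2 hc)
      (by rw [hZ, Nat.card_zpowers, orderOf_eq_prime (hpow hc) hc1])
  have hlt {n m : ℕ} (hnm : n < m) {K L : Subgroup G} (hK : Nat.card K = p ^ n)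
      (hL : Nat.card L = p ^ m) (h : K ≤ L) : ∃ x ∈ L, x ∉ K :=
    SetLike.exists_of_lt (lt_of_le_of_ne h fun h => by
      rw [h, hL] at hK
      exact hnm.ne' (Nat.pow_right_injective hp'.two_le hK))
  obtain ⟨x, hx⟩ := exists_notMem hG (by norm_num) hA
  obtain ⟨y, hyA, hyK⟩ := hlt (by norm_num) hK hA hKA
  obtain ⟨n, hnK, hnZ⟩ := hlt (by norm_num) hZ1 hK hZK
  -- `A` and `x` generate the group
  have hcent {a : G} (ha : a ∈ A) (hax : a * x = x * a) : a ∈ Subgroup.center G := by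
    have h1 : Subgroup.centralizer {a} = ⊤ := eq_top_of_card_pow_three hG hA
      (fun b hb => Subgroup.mem_centralizer_singleton_iff.2 (hcomm b hb a ha))
      (Subgroup.mem_centralizer_singleton_iff.2 hax.symm) hx
    exact Subgroup.mem_center_iff.2 fun g =>
      Subgroup.mem_centralizer_singleton_iff.1 (h1 ▸ Subgroup.mem_top g)
  obtain ⟨c, hc⟩ : ∃ c, comm y x = c := ⟨_, rfl⟩
  have hcK : c ∈ K := hc ▸ comm_mem_of_card_eq_sq hG hK y x
  have hyx := comm_eq_iff.1 hc
  -- otherwise `y` would be central up to a power of `n`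
  have hcZ : c ∉ Subgroup.center G := fun h => by
    have hu : comm n x ≠ 1 := fun h => hnZ (hcent (hKA hnK) (comm_eq_one_iff.1 h))
    have huZ := hcen n hnK x
    obtain ⟨e, he⟩ := exists_pow_of_mem_zpowers (hZgen huZ hu ▸ h)
    have h1 := pow_mul_of_mul_eq (comm_eq_iff.1 rfl) huZ e
    rw [← he] at h1
    have h2 : y * (n ^ e)⁻¹ ∈ Subgroup.center G := by
      refine hcent (mul_mem hyA (inv_mem (pow_mem (hKA hnK) e))) ?_
      have h3 : (n ^ e)⁻¹ * x = x * (c⁻¹ * (n ^ e)⁻¹) := by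
        rw [inv_mul_eq_iff_eq_mul, ← mul_assoc, ← mul_assoc, h1]
        group
      rw [mul_assoc, h3, ← mul_assoc, hyx]
      group
    have h3 := mul_mem (hZK h2) (pow_mem hnK e)
    rw [inv_mul_cancel_right] at h3
    exact hyK h3
  obtain ⟨d, hd⟩ : ∃ d, comm c x = d := ⟨_, rfl⟩
  have hdZ : d ∈ Subgroup.center G := hd ▸ hcen c hcK x
  have hd1 : d ≠ 1 := fun h => hcZ (hcent (hKA hcK) (comm_eq_one_iff.1 (hd.trans h)))
  have hcx := comm_eq_iff.1 hd
  have hxp : x ^ p ∈ A := by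
    have := A.pow_index_mem x
    rwa [index_eq_of_card hG hA] at this
  -- `x ^ p` commutes with `y`, so the collection formula in the exponent `p` leaves `c ^ p = 1`
  have hcp : c ^ p = 1 := by
    have h1 := mul_pow_of_maximal_class hyx hcx hdZ p
    obtain ⟨m, hm⟩ := dvd_choose_two hp
    rw [hm, pow_mul, hpow hdZ, one_pow, mul_one, hcomm y hyA _ hxp] at h1
    simpa using h1
  have hyp : y ^ p ∈ Subgroup.center G := by
    refine hcent (pow_mem hyA p) ?_
    have h1 : x⁻¹ * y * x = y * c := by rw [mul_assoc, hyx]; group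
    have h2 : x⁻¹ * y ^ p * x = y ^ p := by
      have h3 : (x⁻¹ * y * x) ^ p = x⁻¹ * y ^ p * x := by
        simpa using conj_pow (a := x⁻¹) (b := y) (i := p)
      rw [← h3, h1, Commute.mul_pow (hcomm y hyA c (hKA hcK)), hcp, mul_one]
    rw [mul_assoc, inv_mul_eq_iff_eq_mul] at h2
    exact h2
  have hxp' : x ^ p ∈ Subgroup.center G := hcent hxp (by rw [← pow_succ, ← pow_succ'])
  obtain ⟨a, ha⟩ := exists_pow_of_mem_zpowers (hZgen hdZ hd1 ▸ hxp')
  obtain ⟨b, hb⟩ := exists_pow_of_mem_zpowers (hZgen hdZ hd1 ▸ hyp)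
  have hd' (u : G) : comm d u = 1 :=
    comm_eq_one_iff.2 (Subgroup.mem_center_iff.1 hdZ u).symm
  have hcy : comm c y = 1 := comm_eq_one_iff.2 (hcomm c (hKA hcK) y hyA)
  have hi := mem_closure_range ![x, y, c, d]
  have key := fun k : Fin 15 => nonempty_mulEquiv_of_matRel (w := w) (k := k) hp hG
    (g := ![x, y, c, d]) (D := ⟨0, 0, a, 0, b, 0, 1, 0, 1⟩) (by constructor <;> simp)
    (by constructor <;> simp [ha, hb, hcp, hpow hdZ, hc, hd, hd', hcy])
    (eq_top_of_chain hG (S₁ := Subgroup.center G) (S₂ := K) (S₃ := A)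
      ⟨⟨⟨hi 3, hKA (hZK hdZ)⟩, hZK hdZ⟩, hdZ⟩ ⟨⟨hi 2, hKA hcK⟩, hcK⟩ ⟨hi 1, hyA⟩ (hi 0)
      hd1 hcZ hyK hx)
  by_cases hb0 : (b : ZMod p) = 0
  · by_cases ha0 : (a : ZMod p) = 0
    · exact ⟨6, key 6 1 (by simp [MatRel, vec_eq_iff, powVec, commVec, pcData, ha0, hb0])
        (by simp)⟩
    · refine ⟨7, key 7 !![1, 0, 0, 0; 0, a, 0, 0; 0, 0, a, 0; 0, 0, 0, a] ?_ ?_⟩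
      · simp [MatRel, vec_eq_iff, powVec, commVec, pcData, hb0]
      · rw [det_block_two_two]; simp [ha0]
  · obtain ⟨u, hu⟩ := hw b hb0
    have hu0 : u ≠ 0 := by rintro rfl; simp [hb0] at hu
    -- the first row is `x ^ u` times a power of `y` that makes its `p`-th power trivial; the third
    -- row is its commutator with `y`, and the last one its commutator with the third row
    have hdet : !![u, -a * u / b, 0, 0; 0, 1, 0, 0; 0, 0, u, u * (u - 1) / 2;
        0, 0, 0, u ^ 2].det ≠ 0 := by
      rw [det_block_two_two]; simp [hu0]
    obtain hu | hu := hu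
    · refine ⟨8, key 8 _ ?_ hdet⟩
      simp [MatRel, vec_eq_iff, powVec, commVec, pcData]
      exact ⟨by field_simp; ring, hu, (pow_two u).symm⟩
    · refine ⟨9, key 9 _ ?_ hdet⟩
      simp [MatRel, vec_eq_iff, powVec, commVec, pcData]
      exact ⟨by field_simp; ring, hu, (pow_two u).symm⟩

theorem exists_rep {w : ℕ} (hp : 3 < p) (hG : Nat.card G = p ^ 4)
    (hw : ∀ b : ZMod p, b ≠ 0 → ∃ u, b = u ^ 2 ∨ b = w * u ^ 2) :
    ∃ k, Nonempty (G ≃* Rep p w k) := by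
  by_cases hnc : ∃ x y : G, y * x ≠ x * y
  · exact (card_center_of_noncomm hG hnc).elim
      (fun hZ => exists_rep_of_card_center_eq_prime hp hG hZ hw)
      fun hZ => exists_rep_of_card_center hp hG hZ hnc
  · push Not at hnc
    let _ : CommGroup G := { ‹Group G› with mul_comm := fun a b => hnc b a }
    exact exists_rep_of_comm hp hG

end

/-! ### The classification -/

section

variable {p : ℕ} [Fact p.Prime] {w : (ZMod p)ˣ} (hw : ∀ x : (ZMod p)ˣ, x ∈ Subgroup.zpowers w)

include hw

theorem eq_sq_or_eq_mul_sq (b : ZMod p) (hb : b ≠ 0) :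
    ∃ u, b = u ^ 2 ∨ b = ((w : ZMod p).val : ℕ) * u ^ 2 := by
  obtain ⟨n, hn⟩ := Subgroup.mem_zpowers_iff.1 (hw (Units.mk0 b hb))
  have h1 : b = ((w ^ n : (ZMod p)ˣ) : ZMod p) := by rw [hn]; rfl
  rw [ZMod.natCast_zmod_val]
  obtain ⟨m, rfl | rfl⟩ := Int.even_or_odd' n
  · exact ⟨(w ^ m : (ZMod p)ˣ), .inl (by rw [h1, mul_comm, zpow_mul]; norm_cast)⟩
  · exact ⟨(w ^ m : (ZMod p)ˣ), .inr (by
      rw [h1, add_comm, zpow_add, mul_comm 2, zpow_mul]; norm_cast; simp)⟩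

theorem not_isSquare_generator (hp : 3 < p) : ¬ IsSquare (((w : ZMod p).val : ℕ) : ZMod p) := by
  intro h
  obtain ⟨b, hb⟩ := FiniteField.exists_nonsquare (F := ZMod p) (by rw [ZMod.ringChar_zmod_n]; lia)
  have hb0 : b ≠ 0 := by rintro rfl; exact hb (IsSquare.zero)
  obtain ⟨u, hu | hu⟩ := eq_sq_or_eq_mul_sq hw b hb0
  · exact hb (hu ▸ IsSquare.sq u)
  · exact hb (hu ▸ h.mul (IsSquare.sq u))

end

end OrderP4

theorem mainTheorem2 (p : ℕ) [Fact p.Prime] (hp : 3 < p) (w : (ZMod p)ˣ)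
    (hw : ∀ x : (ZMod p)ˣ, x ∈ Subgroup.zpowers w) :
    -- there are exactly fifteen isomorphism classes of groups of order `p ^ 4`
    Nat.card (Quotient (OrderP4.isoSetoid (p ^ 4))) = 15 ∧
    -- the fifteen presented groups form a system of representatives
    (∀ k, Nat.card (OrderP4.Rep p (w : ZMod p).val k) = p ^ 4) ∧
    (∀ k l, Nonempty (OrderP4.Rep p (w : ZMod p).val k ≃* OrderP4.Rep p (w : ZMod p).val l) →
      k = l) ∧
    (∀ (H : Type*) [Group H], Nat.card H = p ^ 4 →
      ∃ k, Nonempty (H ≃* OrderP4.Rep p (w : ZMod p).val k)) ∧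
    -- identification of the abelian ones: numbers 1, 2, 5, 11, 15
    Nonempty (OrderP4.Rep p (w : ZMod p).val 0 ≃* Multiplicative (ZMod (p ^ 4))) ∧
    Nonempty (OrderP4.Rep p (w : ZMod p).val 1 ≃*
      Multiplicative (ZMod (p ^ 2) × ZMod (p ^ 2))) ∧
    Nonempty (OrderP4.Rep p (w : ZMod p).val 4 ≃* Multiplicative (ZMod (p ^ 3) × ZMod p)) ∧
    Nonempty (OrderP4.Rep p (w : ZMod p).val 10 ≃*
      Multiplicative (ZMod (p ^ 2) × ZMod p × ZMod p)) ∧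
    Nonempty (OrderP4.Rep p (w : ZMod p).val 14 ≃* Multiplicative (Fin 4 → ZMod p)) ∧
    -- the automorphisms of each representative, in bijection with the listed exponent matrices
    (∀ k, ∀ M ∈ OrderP4.autMatrices p k,
      ∃! α : MulAut (OrderP4.Rep p (w : ZMod p).val k), OrderP4.HasExponents α M) ∧
    (∀ k, ∀ α : MulAut (OrderP4.Rep p (w : ZMod p).val k),
      ∃! M, M ∈ OrderP4.autMatrices p k ∧ OrderP4.HasExponents α M) ∧
    -- the automorphism group of number 15 is `GL(4, p)`
    (∃ e : MulAut (OrderP4.Rep p (w : ZMod p).val 14) ≃* GL (Fin 4) (ZMod p),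
      ∀ α, OrderP4.HasExponents α (e α : Matrix (Fin 4) (Fin 4) (ZMod p)).transpose) := by
  have hw0 : (((w : ZMod p).val : ℕ) : ZMod p) ≠ 0 := by
    rw [ZMod.natCast_zmod_val]; exact w.ne_zero
  have hinj (k l : Fin 15) (h : Nonempty (OrderP4.Rep p (w : ZMod p).val k ≃*
      OrderP4.Rep p (w : ZMod p).val l)) : k = l := by
    obtain ⟨e⟩ := h
    obtain ⟨f⟩ := OrderP4.nonempty_vecIso hp e
    exact OrderP4.eq_of_vecIso (OrderP4.not_isSquare_generator hw hp) f
  refine ⟨OrderP4.card_quotient_isoSetoid (pow_ne_zero 4 (Fact.out : p.Prime).ne_zero)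
      (OrderP4.Rep p (w : ZMod p).val) (fun k => OrderP4.card_rep' hp) hinj
      (fun H _ hH => OrderP4.exists_rep hp hH (OrderP4.eq_sq_or_eq_mul_sq hw)),
    fun k => OrderP4.card_rep' hp, hinj,
    fun H _ hH => OrderP4.exists_rep hp hH (OrderP4.eq_sq_or_eq_mul_sq hw),
    OrderP4.rep_zero_equiv hp, OrderP4.rep_one_equiv hp, OrderP4.rep_four_equiv hp,
    OrderP4.rep_ten_equiv hp, OrderP4.rep_fourteen_equiv hp,
    fun k M hM => OrderP4.existsUnique_aut hp M hM,
    fun k α => OrderP4.existsUnique_matrix hp hw0 α,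
    OrderP4.exists_mulEquiv_GL hp hw0⟩
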